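/- Consider the massive Thirring (MT) system in light-cone coordinates \[ \mathrm{i}u_x+v+\sigma u|v|^2=0,\qquad \mathrm{i}v_t+u+\sigma v|u|^2=0,\qquad \sigma=\pm1, \] and let $\rho_1,\rho_2$ be real with $-1<\rho_1\rho_2<0$ if $\sigma=1$, and $0<\rho_1\rho_2<1$ if $\sigma=-1$. Put $\rho=1+\sigma\rho_1\rho_2$, $\hat\rho=\sqrt{-\sigma\rho_1\rho_2\rho}$, $\phi(x,t)=\rho\left(\frac{\rho_2}{\rho_1}x+\frac{\rho_1}{\rho_2}t\right)$, and define coefficients by the expansions at $\kappa=0$ \[ \tfrac{\rho_2}{\rho_1}\hat\rho(e^\kappa-1)=\sum_{r\ge1}\alpha_r\kappa^r,\quad \tfrac{\rho_1\rho}{\rho_2}\Big[\tfrac1{\hat\rho+\mathrm i\rho}-\tfrac1{e^\kappa\hat\rho+\mathrm i\rho}\Big]=\sum_{r\ge1}\beta_r\kappa^r,\quad \ln\tfrac{e^\kappa\hat\rho+\mathrm i\rho}{\hat\rho+\mathrm i\rho}=\sum_{r\ge1}\theta_r\kappa^r, \] \[ \ln\tfrac{e^\kappa\hat\rho+\mathrm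 i\sigma\rho_1\rho_2}{\hat\rho+\mathrm i\sigma\rho_1\rho_2}=\sum_{r\ge1}\vartheta_r\kappa^r,\quad \ln e^\kappa=\sum_{r\ge1}\zeta_r\kappa^r,\quad \ln\Big(\tfrac2\kappa\,\tfrac{e^\kappa-1}{e^\kappa+1}\Big)=\sum_{r\ge1}s_r\kappa^r. \] Let $S_j$ be the elementary Schur polynomials, $\sum_{j\ge0}S_j(\boldsymbol x)\lambda^j=\exp\big(\sum_{j\ge1}x_j\lambda^j\big)$. For vectors $\boldsymbol x^\pm(n,k,l)$ depending on $(x,t)$ and on $n,k,l\in\mathbb Z$ put, with $\boldsymbol s=(s_1,s_2,\dots)$, \[ \sigma_{n,k,l}=\det_{1\le i,j\le N}\big(m^{(n,k,l)}_{2i-1,2j-1}\big),\qquad m^{(n,k,l)}_{i,j}=\sum_{\gamma=0}^{\min(i,j)}\frac1{4^\gamma}S_{i-\gamma}(\boldsymbol x^++\gamma\boldsymbol s)\,S_{j-\gamma}(\boldsymbol x^-+\gamma\boldsymbol s), \] \[ u=\rho_1\frac{\sigma_{-1,1,0}}{\sigma_{-1,0,0}}e^{\mathrm i\phi},\qquad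 v=\rho_2\frac{\sigma_{-1,0,1}}{\sigma_{0,0,0}}e^{\mathrm i\phi}. \] The general $N$-th order rogue wave ($N\ge1$) with complex parameters $b_1,b_2,\dots$ is the one for \[ x_r^+=\alpha_rx+\beta_rt+(n+\tfrac12)\theta_r+k\vartheta_r+l\zeta_r+b_r,\qquad x_r^-=\alpha_rx+\beta_r^*t-(n+\tfrac12)\theta_r^*-k\vartheta_r^*-l\zeta_r+b_r^*. \] The reduced one, $(u_N,v_N)$, with complex parameters $a_3,a_5,\dots$, is the one for $\boldsymbol s=(0,s_2,0,s_4,\dots)$, $x_{2r}^\pm=0$ $(r\ge1)$, \[ x_1^\pm=\frac{\rho_2\hat\rho}{\rho_1}x+\frac{\rho_1\rho\hat\rho}{\rho_2(\hat\rho\pm\mathrm i\rho)^2}t\pm(n+\tfrac12)\frac{\hat\rho}{\hat\rho\pm\mathrm i\rho}\pm k\frac{\hat\rho}{\hat\rho\pm\mathrm i\sigma\rho_1\rho_2}\pm l, \] \[ x_{2r+1}^+=\alpha_{2r+1}x+\beta_{2r+1}t+(n+\tfrac12)\theta_{2r+1}+k\vartheta_{2r+1}+a_{2r+1},\quad x_{2r+1}^-=\alpha_{2r+1}x+\beta_{2r+1}^*t-(n+\tfrac12)\theta_{2r+1}^*-k\vartheta_{2r+1}^*+a_{2r+1}^*\quad(r\ge1).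 \] Theorem. (i) $s_r=0$ for every odd $r$. (ii) For all complex $a_3,a_5,\dots$, the reduced determinants satisfy $\sigma_{-1,0,0}=\sigma_{0,0,0}^*$ and $\sigma_{0,0,0}\ne0$ on $\mathbb R^2$, and $(u_N,v_N)$ is a rogue wave of the MT system: a smooth solution on $\mathbb R^2$ with $u_N-\rho_1e^{\mathrm i\phi}\to0$ and $v_N-\rho_2e^{\mathrm i\phi}\to0$ as $|(x,t)|\to\infty$. (iii) The reduced $\sigma_{n,k,l}$, $u_N$ and $v_N$ depend only on the $N-1$ free complex parameters $a_3,a_5,\dots,a_{2N-1}$. (iv) Every general $N$-th order rogue wave is of the reduced form. If $b_1=0$, then its variables $x_r^\pm$ with odd $r$ are those of the reduced form with $a_{2r+1}=b_{2r+1}$ $(r\ge1)$, and $\sigma_{n,k,l}$ (for all $n,k,l$), $u$ and $v$ are exactly the reduced ones, so that the even-indexed variables may be set to zero. For arbitrary $b_1,b_2,\dots$ there are real $x_0,t_0$ and complex $a_3,a_5,\dots$ such that $\sigma_{n,k,l}(x,t)$ equals the reduced $\sigma_{n,k,l}(x-x_0,t-t_0)$ for all $n,k,l$, and $u(x,t)=e^{\mathrm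 i\phi(x_0,t_0)}u_N(x-x_0,t-t_0)$, $v(x,t)=e^{\mathrm i\phi(x_0,t_0)}v_N(x-x_0,t-t_0)$. -/

import Mathlib

open scoped ComplexConjugate ContDiff
open Filter Topology

namespace MTRogue

noncomputable section

/-- The massive Thirring system in light-cone coordinates,
`i u_x + v + σ u |v|² = 0` and `i v_t + u + σ v |u|² = 0`, for smooth `u v` on the whole plane. -/
structure IsMTSolution (σ : ℝ) (u v : ℝ → ℝ → ℂ) : Prop where
  smooth_u : ContDiff ℝ ∞ (fun z : ℝ × ℝ => u z.1 z.2)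
  smooth_v : ContDiff ℝ ∞ (fun z : ℝ × ℝ => v z.1 z.2)
  eq_u : ∀ x t : ℝ, Complex.I * deriv (fun y : ℝ => u y t) x + v x t
    + (σ : ℂ) * u x t * ((‖v x t‖ ^ 2 : ℝ) : ℂ) = 0
  eq_v : ∀ x t : ℝ, Complex.I * deriv (fun y : ℝ => v x y) t + u x t
    + (σ : ℂ) * v x t * ((‖u x t‖ ^ 2 : ℝ) : ℂ) = 0

/-- The condition on the background amplitudes. -/
def Admissible (σ ρ₁ ρ₂ : ℝ) : Prop :=
  (σ = 1 ∧ -1 < ρ₁ * ρ₂ ∧ ρ₁ * ρ₂ < 0) ∨ (σ = -1 ∧ 0 < ρ₁ * ρ₂ ∧ ρ₁ * ρ₂ < 1)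

/-- `ρ = 1 + σ ρ₁ ρ₂`. -/
def rho (σ ρ₁ ρ₂ : ℝ) : ℝ := 1 + σ * ρ₁ * ρ₂

/-- `ρ̂ = √(-σ ρ₁ ρ₂ ρ)`. -/
def rhoHat (σ ρ₁ ρ₂ : ℝ) : ℝ := Real.sqrt (-σ * ρ₁ * ρ₂ * rho σ ρ₁ ρ₂)

/-- The phase factor `exp (i (1 + σ ρ₁ ρ₂) ((ρ₂/ρ₁) x + (ρ₁/ρ₂) t))` of the plane wave. -/
def planeWave (σ ρ₁ ρ₂ x t : ℝ) : ℂ :=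
  Complex.exp (Complex.I * (((1 + σ * ρ₁ * ρ₂) * (ρ₂ / ρ₁ * x + ρ₁ / ρ₂ * t) : ℝ) : ℂ))

/-- A rogue wave on the background with amplitudes `ρ₁, ρ₂`: a smooth solution of the massive
Thirring system which tends to the plane wave as `(x, t)` tends to infinity in any direction. -/
structure IsRogueWave (σ ρ₁ ρ₂ : ℝ) (u v : ℝ → ℝ → ℂ) : Prop where
  solution : IsMTSolution σ u v
  background_u : Tendsto (fun z : ℝ × ℝ => u z.1 z.2 - (ρ₁ : ℂ) * planeWave σ ρ₁ ρ₂ z.1 z.2)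
    (cocompact (ℝ × ℝ)) (𝓝 0)
  background_v : Tendsto (fun z : ℝ × ℝ => v z.1 z.2 - (ρ₂ : ℂ) * planeWave σ ρ₁ ρ₂ z.1 z.2)
    (cocompact (ℝ × ℝ)) (𝓝 0)

/-- The elementary Schur polynomial `S_j(x)`: the coefficient of `λ ^ j` in the formal power series
`exp (∑_{r ≥ 1} x_r λ ^ r)`. The entry `x 0` is not used. -/
def schur (j : ℕ) (x : ℕ → ℂ) : ℂ :=
  PowerSeries.coeff j
    ((PowerSeries.exp ℂ).subst (PowerSeries.mk fun r => if r = 0 then 0 else x r) :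
      PowerSeries ℂ)

/-- The coefficient of `κ ^ r` in the Taylor expansion of `F` at `κ = 0`. -/
def taylorCoeff (F : ℂ → ℂ) (r : ℕ) : ℂ := iteratedDeriv r F 0 / (r.factorial : ℂ)

/-- `(ρ₂/ρ₁) ρ̂ (e^κ - 1) = ∑ α_r κ^r`. -/
def alphaCoeff (σ ρ₁ ρ₂ : ℝ) (r : ℕ) : ℂ :=
  taylorCoeff (fun κ : ℂ =>
    (ρ₂ : ℂ) / (ρ₁ : ℂ) * ((rhoHat σ ρ₁ ρ₂ : ℂ) * (Complex.exp κ - 1))) r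

/-- `(ρ₁ρ/ρ₂) (1/(ρ̂ + iρ) - 1/(e^κ ρ̂ + iρ)) = ∑ β_r κ^r`. -/
def betaCoeff (σ ρ₁ ρ₂ : ℝ) (r : ℕ) : ℂ :=
  taylorCoeff (fun κ : ℂ =>
    (ρ₁ : ℂ) * (rho σ ρ₁ ρ₂ : ℂ) / (ρ₂ : ℂ) *
      (1 / ((rhoHat σ ρ₁ ρ₂ : ℂ) + Complex.I * (rho σ ρ₁ ρ₂ : ℂ)) -
        1 / (Complex.exp κ * (rhoHat σ ρ₁ ρ₂ : ℂ) + Complex.I * (rho σ ρ₁ ρ₂ : ℂ)))) r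

/-- `ln ((e^κ ρ̂ + iρ)/(ρ̂ + iρ)) = ∑ θ_r κ^r`. -/
def thetaCoeff (σ ρ₁ ρ₂ : ℝ) (r : ℕ) : ℂ :=
  taylorCoeff (fun κ : ℂ =>
    Complex.log ((Complex.exp κ * (rhoHat σ ρ₁ ρ₂ : ℂ) + Complex.I * (rho σ ρ₁ ρ₂ : ℂ)) /
      ((rhoHat σ ρ₁ ρ₂ : ℂ) + Complex.I * (rho σ ρ₁ ρ₂ : ℂ)))) r

/-- `ln ((e^κ ρ̂ + iσρ₁ρ₂)/(ρ̂ + iσρ₁ρ₂)) = ∑ ϑ_r κ^r`. -/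
def varthetaCoeff (σ ρ₁ ρ₂ : ℝ) (r : ℕ) : ℂ :=
  taylorCoeff (fun κ : ℂ =>
    Complex.log ((Complex.exp κ * (rhoHat σ ρ₁ ρ₂ : ℂ) + Complex.I * ((σ * ρ₁ * ρ₂ : ℝ) : ℂ)) /
      ((rhoHat σ ρ₁ ρ₂ : ℂ) + Complex.I * ((σ * ρ₁ * ρ₂ : ℝ) : ℂ)))) r

/-- `ln e^κ = ∑ ζ_r κ^r`. -/
def zetaCoeff (r : ℕ) : ℂ := taylorCoeff (fun κ : ℂ => Complex.log (Complex.exp κ)) r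

/-- `ln ((2/κ) (e^κ - 1)/(e^κ + 1)) = ∑ s_r κ^r`. The singularity at `κ = 0` is removable with
value `ln 1 = 0`, and `0` is also the value that the expression below takes at `κ = 0`. -/
def sCoeff (r : ℕ) : ℂ :=
  taylorCoeff (fun κ : ℂ =>
    Complex.log (2 / κ * ((Complex.exp κ - 1) / (Complex.exp κ + 1)))) r

/-- The shift vector `(0, s_2, 0, s_4, …)`. -/
def sEven (r : ℕ) : ℂ := if Even r then sCoeff r else 0

/-- `m_{i,j} = ∑_{γ=0}^{min(i,j)} 4^{-γ} S_{i-γ}(x⁺ + γ s) S_{j-γ}(x⁻ + γ s)`. -/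
def mEntry (xp xm s : ℕ → ℂ) (i j : ℕ) : ℂ :=
  ∑ γ ∈ Finset.range (min i j + 1),
    1 / (4 : ℂ) ^ γ * schur (i - γ) (fun r => xp r + (γ : ℂ) * s r)
      * schur (j - γ) (fun r => xm r + (γ : ℂ) * s r)

/-- `det_{1 ≤ i, j ≤ N} (m_{2i-1, 2j-1})`. -/
def schurDet (N : ℕ) (xp xm s : ℕ → ℂ) : ℂ :=
  Matrix.det (Matrix.of fun i j : Fin N =>
    mEntry xp xm s (2 * (i : ℕ) + 1) (2 * (j : ℕ) + 1))

/-- `u = ρ₁ (g / f^*) e^{i…}`, with `g = τ_{-1,1,0}` and `f^* = τ_{-1,0,0}`. -/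
def waveU (σ ρ₁ ρ₂ : ℝ) (τ : ℤ → ℤ → ℤ → ℝ → ℝ → ℂ) (x t : ℝ) : ℂ :=
  (ρ₁ : ℂ) * (τ (-1) 1 0 x t / τ (-1) 0 0 x t) * planeWave σ ρ₁ ρ₂ x t

/-- `v = ρ₂ (h / f) e^{i…}`, with `h = τ_{-1,0,1}` and `f = τ_{0,0,0}`. -/
def waveV (σ ρ₁ ρ₂ : ℝ) (τ : ℤ → ℤ → ℤ → ℝ → ℝ → ℂ) (x t : ℝ) : ℂ :=
  (ρ₂ : ℂ) * (τ (-1) 0 1 x t / τ 0 0 0 x t) * planeWave σ ρ₁ ρ₂ x t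

/-! ### The general family, with parameters `b_1, b_2, b_3, …` -/

/-- `x_r⁺ = α_r x + β_r t + (n + 1/2) θ_r + k ϑ_r + l ζ_r + b_r`. -/
def genPlus (σ ρ₁ ρ₂ : ℝ) (b : ℕ → ℂ) (n k l : ℤ) (x t : ℝ) (r : ℕ) : ℂ :=
  alphaCoeff σ ρ₁ ρ₂ r * (x : ℂ) + betaCoeff σ ρ₁ ρ₂ r * (t : ℂ)
    + ((n : ℂ) + 1 / 2) * thetaCoeff σ ρ₁ ρ₂ r + (k : ℂ) * varthetaCoeff σ ρ₁ ρ₂ r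
    + (l : ℂ) * zetaCoeff r + b r

/-- `x_r⁻ = α_r x + β_r^* t - (n + 1/2) θ_r^* - k ϑ_r^* - l ζ_r + b_r^*`. -/
def genMinus (σ ρ₁ ρ₂ : ℝ) (b : ℕ → ℂ) (n k l : ℤ) (x t : ℝ) (r : ℕ) : ℂ :=
  alphaCoeff σ ρ₁ ρ₂ r * (x : ℂ) + conj (betaCoeff σ ρ₁ ρ₂ r) * (t : ℂ)
    - ((n : ℂ) + 1 / 2) * conj (thetaCoeff σ ρ₁ ρ₂ r)
    - (k : ℂ) * conj (varthetaCoeff σ ρ₁ ρ₂ r)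
    - (l : ℂ) * zetaCoeff r + conj (b r)

/-- The determinants `σ_{n,k,l}` of the general family. -/
def genTau (N : ℕ) (σ ρ₁ ρ₂ : ℝ) (b : ℕ → ℂ) (n k l : ℤ) (x t : ℝ) : ℂ :=
  schurDet N (genPlus σ ρ₁ ρ₂ b n k l x t) (genMinus σ ρ₁ ρ₂ b n k l x t) sCoeff

/-! ### The reduced family, with parameters `a_3, a_5, …` -/

/-- The vector `(x_1⁺, 0, x_3⁺, 0, …)`. -/
def redPlus (σ ρ₁ ρ₂ : ℝ) (a : ℕ → ℂ) (n k l : ℤ) (x t : ℝ) (r : ℕ) : ℂ :=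
  if r = 1 then
    (ρ₂ : ℂ) * (rhoHat σ ρ₁ ρ₂ : ℂ) / (ρ₁ : ℂ) * (x : ℂ)
      + (ρ₁ : ℂ) * (rho σ ρ₁ ρ₂ : ℂ) * (rhoHat σ ρ₁ ρ₂ : ℂ) /
          ((ρ₂ : ℂ) * ((rhoHat σ ρ₁ ρ₂ : ℂ) + Complex.I * (rho σ ρ₁ ρ₂ : ℂ)) ^ 2) * (t : ℂ)
      + ((n : ℂ) + 1 / 2) * ((rhoHat σ ρ₁ ρ₂ : ℂ) /
          ((rhoHat σ ρ₁ ρ₂ : ℂ) + Complex.I * (rho σ ρ₁ ρ₂ : ℂ)))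
      + (k : ℂ) * ((rhoHat σ ρ₁ ρ₂ : ℂ) /
          ((rhoHat σ ρ₁ ρ₂ : ℂ) + Complex.I * ((σ * ρ₁ * ρ₂ : ℝ) : ℂ)))
      + (l : ℂ)
  else if Odd r then
    alphaCoeff σ ρ₁ ρ₂ r * (x : ℂ) + betaCoeff σ ρ₁ ρ₂ r * (t : ℂ)
      + ((n : ℂ) + 1 / 2) * thetaCoeff σ ρ₁ ρ₂ r + (k : ℂ) * varthetaCoeff σ ρ₁ ρ₂ r + a r
  else 0

/-- The vector `(x_1⁻, 0, x_3⁻, 0, …)`. -/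
def redMinus (σ ρ₁ ρ₂ : ℝ) (a : ℕ → ℂ) (n k l : ℤ) (x t : ℝ) (r : ℕ) : ℂ :=
  if r = 1 then
    (ρ₂ : ℂ) * (rhoHat σ ρ₁ ρ₂ : ℂ) / (ρ₁ : ℂ) * (x : ℂ)
      + (ρ₁ : ℂ) * (rho σ ρ₁ ρ₂ : ℂ) * (rhoHat σ ρ₁ ρ₂ : ℂ) /
          ((ρ₂ : ℂ) * ((rhoHat σ ρ₁ ρ₂ : ℂ) - Complex.I * (rho σ ρ₁ ρ₂ : ℂ)) ^ 2) * (t : ℂ)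
      - ((n : ℂ) + 1 / 2) * ((rhoHat σ ρ₁ ρ₂ : ℂ) /
          ((rhoHat σ ρ₁ ρ₂ : ℂ) - Complex.I * (rho σ ρ₁ ρ₂ : ℂ)))
      - (k : ℂ) * ((rhoHat σ ρ₁ ρ₂ : ℂ) /
          ((rhoHat σ ρ₁ ρ₂ : ℂ) - Complex.I * ((σ * ρ₁ * ρ₂ : ℝ) : ℂ)))
      - (l : ℂ)
  else if Odd r then
    alphaCoeff σ ρ₁ ρ₂ r * (x : ℂ) + conj (betaCoeff σ ρ₁ ρ₂ r) * (t : ℂ)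
      - ((n : ℂ) + 1 / 2) * conj (thetaCoeff σ ρ₁ ρ₂ r)
      - (k : ℂ) * conj (varthetaCoeff σ ρ₁ ρ₂ r) + conj (a r)
  else 0

/-- The determinants `σ_{n,k,l}` of the reduced family. -/
def redTau (N : ℕ) (σ ρ₁ ρ₂ : ℝ) (a : ℕ → ℂ) (n k l : ℤ) (x t : ℝ) : ℂ :=
  schurDet N (redPlus σ ρ₁ ρ₂ a n k l x t) (redMinus σ ρ₁ ρ₂ a n k l x t) sEven

/-- The reduced wave `u_N`. -/
def redU (N : ℕ) (σ ρ₁ ρ₂ : ℝ) (a : ℕ → ℂ) : ℝ → ℝ → ℂ :=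
  waveU σ ρ₁ ρ₂ (redTau N σ ρ₁ ρ₂ a)

/-- The reduced wave `v_N`. -/
def redV (N : ℕ) (σ ρ₁ ρ₂ : ℝ) (a : ℕ → ℂ) : ℝ → ℝ → ℂ :=
  waveV σ ρ₁ ρ₂ (redTau N σ ρ₁ ρ₂ a)

/-- The general wave `u`. -/
def genU (N : ℕ) (σ ρ₁ ρ₂ : ℝ) (b : ℕ → ℂ) : ℝ → ℝ → ℂ :=
  waveU σ ρ₁ ρ₂ (genTau N σ ρ₁ ρ₂ b)

/-- The general wave `v`. -/
def genV (N : ℕ) (σ ρ₁ ρ₂ : ℝ) (b : ℕ → ℂ) : ℝ → ℝ → ℂ :=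
  waveV σ ρ₁ ρ₂ (genTau N σ ρ₁ ρ₂ b)

end

end MTRogue

namespace MTRogue

/-! The entry `m_{i,j}` is the coefficient of `κ^i λ^j` in `A(κ) B(λ) / (1 - T(κ) T(λ))`, where `A`,
`B` are the generating series of the Schur polynomials of `x⁺`, `x⁻` and `T(κ) = tanh (κ/2) = (κ/2)
exp (∑ s_r κ^r)`. The matrix of odd coefficients is `pairing N A B`. Everything follows from two
properties of this kernel.

First, `1 - T(κ) T(λ) = 2 (e^κ + e^λ) / ((e^κ + 1)(e^λ + 1))`, so multiplication by `e^κ + e^λ`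
leaves a product of a function of `κ` and one of `λ`, that is, a matrix of rank one
(`pairing_exp_mul`). With `p = ρ̂ e^κ`, the `x`-flow multiplies by `p`, the `t`-flow by `1/(p +
iρ)`, and the shifts of `n`, `k`, `l` by `p + iρ`, `p + iσρ₁ρ₂`, `p`, all up to constants. Flows and
shifts are thus rank-one updates of one matrix, and a Toda-type bilinear identity (`toda_identity`)
follows from the matrix determinant lemma.

Second, multiplying `A` or `B` by an even series acts on odd coefficients through a triangular
matrix, so the determinant only changes by a power of the constant term
(`det_pairing_even_mul_left`). Hence even-indexed variables are irrelevant, and the shift of `n` and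
`k` together is the shift of `l` (`Admissible.genTau_succ_succ`), because `e^{-κ} (p + iρ)(p +
iσρ₁ρ₂)` is even when `ρ̂² = -σρ₁ρ₂ρ`. With this reduction, four instances of the Toda identity
become bilinear equations that imply the MT system.

The determinant `σ_{0,0,0}` has no zeros because a kernel vector would generate a kernel subspace
invariant under a triangular matrix, and the lowest such vector is excluded directly
(`det_pairing_conj_ne_zero`). At infinity `x_1^±` dominates, with `α_1 x + β_1 t` a real-linear
isomorphism of the plane onto `ℂ`; all `σ_{n,k,l}` then have the same leading term, nonzero by a
Vandermonde determinant (`Admissible.tendsto_genTau_div`). The same isomorphism removes `b_1` by a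
translation. -/

/-! ### Elementary Schur polynomials and their generating series -/

/-- The power series `∑_{r ≥ 1} x_r λ ^ r`. -/
noncomputable def varSeries (x : ℕ → ℂ) : PowerSeries ℂ :=
  PowerSeries.mk fun r => if r = 0 then 0 else x r

/-- The generating series `exp (∑_{r ≥ 1} x_r λ ^ r)` of the elementary Schur polynomials. -/
noncomputable def schurSeries (x : ℕ → ℂ) : PowerSeries ℂ :=
  (PowerSeries.exp ℂ).subst (varSeries x)

theorem schur_eq_coeff (j : ℕ) (x : ℕ → ℂ) : schur j x = PowerSeries.coeff j (schurSeries x) := rfl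

theorem coeff_varSeries_succ (x : ℕ → ℂ) (r : ℕ) :
    PowerSeries.coeff (r + 1) (varSeries x) = x (r + 1) := by
  simp [varSeries]

theorem constantCoeff_varSeries (x : ℕ → ℂ) : PowerSeries.constantCoeff (varSeries x) = 0 := by
  rw [← PowerSeries.coeff_zero_eq_constantCoeff_apply]
  simp [varSeries]

theorem hasSubst_varSeries (x : ℕ → ℂ) : PowerSeries.HasSubst (varSeries x) :=
  PowerSeries.HasSubst.of_constantCoeff_zero' (constantCoeff_varSeries x)

theorem derivative_schurSeries (x : ℕ → ℂ) :
    PowerSeries.derivative ℂ (schurSeries x)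
      = PowerSeries.derivative ℂ (varSeries x) * schurSeries x := by
  rw [schurSeries, PowerSeries.derivative_subst (hasSubst_varSeries x),
    PowerSeries.derivative_exp, mul_comm]

theorem constantCoeff_schurSeries (x : ℕ → ℂ) :
    PowerSeries.constantCoeff (schurSeries x) = 1 := by
  rw [schurSeries, ← PowerSeries.coeff_zero_eq_constantCoeff_apply,
    PowerSeries.coeff_subst' (hasSubst_varSeries x), finsum_eq_single _ 0]
  · simp
  · intro n hn
    simp [constantCoeff_varSeries, hn]

/-- The recurrence satisfied by the coefficients of a solution of `F' = Y' F`. -/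
theorem coeff_succ_of_derivative_eq {F : PowerSeries ℂ} {x : ℕ → ℂ}
    (h : PowerSeries.derivative ℂ F = PowerSeries.derivative ℂ (varSeries x) * F) (j : ℕ) :
    ((j : ℂ) + 1) * PowerSeries.coeff (j + 1) F
      = ∑ r ∈ Finset.range (j + 1),
          ((r : ℂ) + 1) * x (r + 1) * PowerSeries.coeff (j - r) F := by
  have := congrArg (PowerSeries.coeff j) h
  rw [PowerSeries.coeff_derivative, PowerSeries.coeff_mul,
    Finset.Nat.sum_antidiagonal_eq_sum_range_succ_mk] at this
  rw [mul_comm, this]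
  refine Finset.sum_congr rfl fun r _ => ?_
  rw [PowerSeries.coeff_derivative, coeff_varSeries_succ]
  ring

/-- The linear equation `F' = Y' F` with `F(0) = 1` has a unique formal solution. Exponentials are
identified by this criterion throughout. -/
theorem eq_schurSeries_of_derivative_eq {F : PowerSeries ℂ} {x : ℕ → ℂ}
    (h : PowerSeries.derivative ℂ F = PowerSeries.derivative ℂ (varSeries x) * F)
    (h0 : PowerSeries.constantCoeff F = 1) : F = schurSeries x := by
  ext j
  induction j using Nat.strong_induction_on with
  | _ j ih =>
    rcases j with _ | j
    · simp [h0, constantCoeff_schurSeries]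
    · have h1 := coeff_succ_of_derivative_eq h j
      have h2 := coeff_succ_of_derivative_eq (derivative_schurSeries x) j
      have hj : ((j : ℂ) + 1) ≠ 0 := Nat.cast_add_one_ne_zero j
      apply mul_left_cancel₀ hj
      rw [h1, h2]
      refine Finset.sum_congr rfl fun r _ => ?_
      rw [ih (j - r) (by omega)]

theorem schur_succ (x : ℕ → ℂ) (j : ℕ) :
    ((j : ℂ) + 1) * schur (j + 1) x
      = ∑ r ∈ Finset.range (j + 1), ((r : ℂ) + 1) * x (r + 1) * schur (j - r) x :=
  coeff_succ_of_derivative_eq (derivative_schurSeries x) j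

theorem schur_zero (x : ℕ → ℂ) : schur 0 x = 1 := by
  rw [schur_eq_coeff, PowerSeries.coeff_zero_eq_constantCoeff_apply, constantCoeff_schurSeries]

theorem schur_succ_eq (x : ℕ → ℂ) (j : ℕ) :
    schur (j + 1) x = ((j : ℂ) + 1)⁻¹ *
      ∑ r ∈ Finset.range (j + 1), ((r : ℂ) + 1) * x (r + 1) * schur (j - r) x := by
  rw [← schur_succ, inv_mul_cancel_left₀ (Nat.cast_add_one_ne_zero j)]

theorem schur_congr {x y : ℕ → ℂ} (j : ℕ) (h : ∀ r, 1 ≤ r → r ≤ j → x r = y r) :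
    schur j x = schur j y := by
  induction j using Nat.strong_induction_on with
  | _ j ih =>
    rcases j with _ | j
    · simp [schur_zero]
    · rw [schur_succ_eq, schur_succ_eq]
      congr 1
      refine Finset.sum_congr rfl fun r hr => ?_
      rw [Finset.mem_range] at hr
      rw [ih (j - r) (by omega) fun q h1 h2 => h q h1 (by omega), h (r + 1) (by omega) (by omega)]

theorem schurSeries_congr {x y : ℕ → ℂ} (h : ∀ r, 1 ≤ r → x r = y r) :
    schurSeries x = schurSeries y := by
  ext j
  exact schur_congr j fun r h1 _ => h r h1

theorem varSeries_add (x y : ℕ → ℂ) :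
    varSeries (fun r => x r + y r) = varSeries x + varSeries y := by
  ext r
  simp only [varSeries, PowerSeries.coeff_mk, map_add]
  split_ifs <;> simp

theorem schurSeries_add (x y : ℕ → ℂ) :
    schurSeries (fun r => x r + y r) = schurSeries x * schurSeries y := by
  symm
  apply eq_schurSeries_of_derivative_eq
  · rw [varSeries_add, Derivation.leibniz, derivative_schurSeries, derivative_schurSeries,
      map_add, smul_eq_mul, smul_eq_mul]
    ring
  · rw [map_mul, constantCoeff_schurSeries, constantCoeff_schurSeries, one_mul]

theorem schurSeries_zero : schurSeries (fun _ => 0) = 1 := by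
  symm
  apply eq_schurSeries_of_derivative_eq
  · have : varSeries (fun _ => 0) = 0 := by ext r; simp [varSeries]
    rw [this]; simp
  · simp

theorem schurSeries_nat_mul (x : ℕ → ℂ) (m : ℕ) :
    schurSeries (fun r => (m : ℂ) * x r) = schurSeries x ^ m := by
  induction m with
  | zero => simpa using schurSeries_zero
  | succ m ih =>
    rw [pow_succ, ← ih, ← schurSeries_add]
    refine schurSeries_congr fun r _ => ?_
    push_cast; ring

theorem conj_schur (j : ℕ) (x : ℕ → ℂ) : conj (schur j x) = schur j (fun r => conj (x r)) := by
  induction j using Nat.strong_induction_on with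
  | _ j ih =>
    rcases j with _ | j
    · simp [schur_zero]
    · rw [schur_succ_eq, schur_succ_eq, map_mul, map_sum]
      congr 1
      · simp
      · refine Finset.sum_congr rfl fun r _ => ?_
        rw [map_mul, ih (j - r) (by omega)]
        simp

/-- Coefficientwise complex conjugation of power series. -/
noncomputable abbrev conjSeries : PowerSeries ℂ →+* PowerSeries ℂ := PowerSeries.map (starRingEnd ℂ)

theorem conjSeries_schurSeries (x : ℕ → ℂ) :
    conjSeries (schurSeries x) = schurSeries (fun r => conj (x r)) := by
  ext j
  rw [PowerSeries.coeff_map, ← schur_eq_coeff, ← schur_eq_coeff]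
  exact conj_schur j x

/-- A power series is even if all its odd coefficients vanish. -/
def IsEvenSeries (F : PowerSeries ℂ) : Prop := ∀ j, Odd j → PowerSeries.coeff j F = 0

theorem isEvenSeries_schurSeries {x : ℕ → ℂ} (h : ∀ r, Odd r → x r = 0) :
    IsEvenSeries (schurSeries x) := by
  intro j
  induction j using Nat.strong_induction_on with
  | _ j ih =>
    intro hj
    rcases j with _ | j
    · simp at hj
    · rw [← schur_eq_coeff, schur_succ_eq]
      apply mul_eq_zero_of_right
      refine Finset.sum_eq_zero fun r hr => ?_
      rw [Finset.mem_range] at hr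
      rcases Nat.even_or_odd (r + 1) with he | ho
      · rw [schur_eq_coeff, ih (j - r) (by omega) (by grind), mul_zero]
      · rw [h _ ho]; ring

theorem contDiff_schur {E : Type*} [NormedAddCommGroup E] [NormedSpace ℝ E] {n : WithTop ℕ∞}
    (x : E → ℕ → ℂ) (h : ∀ r, ContDiff ℝ n (fun z => x z r)) (j : ℕ) :
    ContDiff ℝ n (fun z => schur j (x z)) := by
  induction j using Nat.strong_induction_on with
  | _ j ih =>
    rcases j with _ | j
    · simp only [schur_zero]; exact contDiff_const
    · simp only [schur_succ_eq]
      refine contDiff_const.mul (ContDiff.sum fun r _ => ?_)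
      exact (contDiff_const.mul (h _)).mul (ih (j - r) (by omega))

/-- The derivative of a Schur polynomial along a curve in the space of its variables. -/
theorem hasDerivAt_schur {x : ℝ → ℕ → ℂ} {x' : ℕ → ℂ} {y : ℝ}
    (h : ∀ r, HasDerivAt (fun z => x z r) (x' r) y) (j : ℕ) :
    HasDerivAt (fun z => schur j (x z))
      (PowerSeries.coeff j (varSeries x' * schurSeries (x y))) y := by
  induction j using Nat.strong_induction_on with
  | _ j ih =>
    rcases j with _ | j
    · simp only [schur_zero]
      refine (hasDerivAt_const y (1 : ℂ)).congr_deriv ?_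
      rw [PowerSeries.coeff_zero_eq_constantCoeff_apply, map_mul, constantCoeff_varSeries, zero_mul]
    · simp only [schur_succ_eq]
      have h1 := (HasDerivAt.fun_sum (u := Finset.range (j + 1)) fun r _ =>
        (((h (r + 1)).const_mul ((r : ℂ) + 1)).fun_mul (ih (j - r) (by omega)))).const_mul
          ((j : ℂ) + 1)⁻¹
      refine h1.congr_deriv ?_
      -- After clearing `1/(j+1)`, the claim is the coefficient of `κ^j` in the derivative of `Y'
      -- F`, expanded by the product rule. Here `Y'` denotes `varSeries x'` and `F` the Schur
      -- series.
      rw [inv_mul_eq_iff_eq_mul₀ (Nat.cast_add_one_ne_zero j), mul_comm _ (PowerSeries.coeff _ _),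
        ← PowerSeries.coeff_derivative, Derivation.leibniz, derivative_schurSeries,
        smul_eq_mul, smul_eq_mul, map_add, Finset.sum_add_distrib, add_comm]
      congr 1
      · rw [mul_left_comm, PowerSeries.coeff_mul,
          Finset.Nat.sum_antidiagonal_eq_sum_range_succ_mk]
        refine Finset.sum_congr rfl fun r _ => ?_
        rw [PowerSeries.coeff_derivative, coeff_varSeries_succ]
        ring
      · rw [mul_comm, PowerSeries.coeff_mul, Finset.Nat.sum_antidiagonal_eq_sum_range_succ_mk]
        refine Finset.sum_congr rfl fun r _ => ?_
        rw [PowerSeries.coeff_derivative, coeff_varSeries_succ, schur_eq_coeff]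
        ring

/-- If the first variable dominates, then `S_j (x) ~ x_1 ^ j / j!`. -/
theorem tendsto_schur_div_pow {ι : Type*} {l : Filter ι} (x : ι → ℕ → ℂ) (c : ι → ℂ)
    (hc : ∀ᶠ z in l, c z ≠ 0)
    (h1 : Tendsto (fun z => x z 1 / c z) l (𝓝 1))
    (h : ∀ r, 2 ≤ r → Tendsto (fun z => x z r / c z ^ r) l (𝓝 0)) (j : ℕ) :
    Tendsto (fun z => schur j (x z) / c z ^ j) l (𝓝 ((j.factorial : ℂ)⁻¹)) := by
  induction j using Nat.strong_induction_on with
  | _ j ih =>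
    rcases j with _ | j
    · simp only [schur_zero]; simpa using tendsto_const_nhds
    · have key : Tendsto (fun z => ((j : ℂ) + 1)⁻¹ * ∑ r ∈ Finset.range (j + 1),
          (((r : ℂ) + 1) * (x z (r + 1) / c z ^ (r + 1))) * (schur (j - r) (x z) / c z ^ (j - r)))
          l (𝓝 (((j : ℂ) + 1)⁻¹ * ∑ r ∈ Finset.range (j + 1),
            (((r : ℂ) + 1) * (if r = 0 then 1 else 0)) * (((j - r).factorial : ℂ)⁻¹))) := by
        refine Tendsto.const_mul _ (tendsto_finsetSum _ fun r _ => Tendsto.mul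
          (Tendsto.const_mul _ ?_) (ih (j - r) (by omega)))
        by_cases hr : r = 0
        · simpa [hr] using h1
        · simpa [hr] using h (r + 1) (by omega)
      -- Only the term containing `x_1` survives in the limit, and `1/(j+1) · 1/j! = 1/(j+1)!`.
      have e : ((j : ℂ) + 1)⁻¹ * ∑ r ∈ Finset.range (j + 1),
            (((r : ℂ) + 1) * (if r = 0 then 1 else 0)) * (((j - r).factorial : ℂ)⁻¹)
          = (((j + 1).factorial : ℂ)⁻¹) := by
        rw [Finset.sum_eq_single 0]
        · simp [Nat.factorial_succ, mul_comm]
        · intro r _ hr; simp [hr]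
        · simp
      rw [e] at key
      refine key.congr' ?_
      filter_upwards [hc] with z hz
      rw [schur_succ_eq, mul_div_assoc, Finset.sum_div]
      congr 1
      refine Finset.sum_congr rfl fun r hr => ?_
      rw [Finset.mem_range] at hr
      have : c z ^ (j + 1) = c z ^ (r + 1) * c z ^ (j - r) := by
        rw [← pow_add]; congr 1; omega
      rw [this]
      field_simp

/-! ### Taylor series at zero and the coefficients of the flows -/

/-- The Taylor series of `F` at `0`. -/
noncomputable def taylorSeries (F : ℂ → ℂ) : PowerSeries ℂ := PowerSeries.mk (taylorCoeff F)

theorem taylorCoeff_congr {F G : ℂ → ℂ} (h : F =ᶠ[𝓝 0] G) : taylorCoeff F = taylorCoeff G := by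
  funext r
  rw [taylorCoeff, taylorCoeff, h.iteratedDeriv_eq]

theorem taylorSeries_congr {F G : ℂ → ℂ} (h : F =ᶠ[𝓝 0] G) : taylorSeries F = taylorSeries G := by
  rw [taylorSeries, taylorSeries, taylorCoeff_congr h]

theorem taylorSeries_mul {F G : ℂ → ℂ} (hF : AnalyticAt ℂ F 0) (hG : AnalyticAt ℂ G 0) :
    taylorSeries (fun z => F z * G z) = taylorSeries F * taylorSeries G := by
  ext r
  rw [PowerSeries.coeff_mul, Finset.Nat.sum_antidiagonal_eq_sum_range_succ_mk]
  simp only [taylorSeries, PowerSeries.coeff_mk, taylorCoeff]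
  rw [iteratedDeriv_fun_mul hF.contDiffAt hG.contDiffAt, Finset.sum_div]
  refine Finset.sum_congr rfl fun i hi => ?_
  rw [Finset.mem_range] at hi
  rw [Nat.cast_choose ℂ (by omega : i ≤ r)]
  have := Nat.factorial_ne_zero
  have h1 : (r.factorial : ℂ) ≠ 0 := by exact_mod_cast this r
  have h2 : (i.factorial : ℂ) ≠ 0 := by exact_mod_cast this i
  have h3 : ((r - i).factorial : ℂ) ≠ 0 := by exact_mod_cast this (r - i)
  field_simp

theorem taylorSeries_add {F G : ℂ → ℂ} (hF : AnalyticAt ℂ F 0) (hG : AnalyticAt ℂ G 0) :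
    taylorSeries (fun z => F z + G z) = taylorSeries F + taylorSeries G := by
  ext r
  rw [map_add]
  simp only [taylorSeries, PowerSeries.coeff_mk, taylorCoeff]
  rw [iteratedDeriv_fun_add hF.contDiffAt hG.contDiffAt, add_div]

theorem taylorSeries_const (c : ℂ) : taylorSeries (fun _ => c) = PowerSeries.C c := by
  ext r
  simp only [taylorSeries, PowerSeries.coeff_mk, taylorCoeff, PowerSeries.coeff_C,
    iteratedDeriv_const]
  split_ifs with h
  · simp [h]
  · simp

theorem taylorSeries_exp : taylorSeries Complex.exp = PowerSeries.exp ℂ := by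
  ext r
  simp [taylorSeries, taylorCoeff, iteratedDeriv_eq_iterate, PowerSeries.coeff_exp]

theorem derivative_taylorSeries (F : ℂ → ℂ) :
    PowerSeries.derivative ℂ (taylorSeries F) = taylorSeries (deriv F) := by
  ext r
  rw [PowerSeries.coeff_derivative]
  simp only [taylorSeries, PowerSeries.coeff_mk, taylorCoeff]
  rw [iteratedDeriv_succ', Nat.factorial_succ]
  have h1 : (r.factorial : ℂ) ≠ 0 := by exact_mod_cast Nat.factorial_ne_zero r
  have h2 : (r : ℂ) + 1 ≠ 0 := Nat.cast_add_one_ne_zero r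
  push_cast
  field_simp

theorem constantCoeff_taylorSeries (F : ℂ → ℂ) :
    PowerSeries.constantCoeff (taylorSeries F) = F 0 := by
  rw [← PowerSeries.coeff_zero_eq_constantCoeff_apply]
  simp [taylorSeries, taylorCoeff]

theorem taylorSeries_id : taylorSeries (fun z => z) = PowerSeries.X := by
  apply PowerSeries.derivative.ext
  · rw [derivative_taylorSeries, PowerSeries.derivative_X]
    have : deriv (fun z : ℂ => z) = fun _ => 1 := by funext z; simp
    rw [this, taylorSeries_const, map_one]
  · rw [constantCoeff_taylorSeries]; simp

theorem derivative_varSeries_taylorCoeff (F : ℂ → ℂ) :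
    PowerSeries.derivative ℂ (varSeries (taylorCoeff F)) = taylorSeries (deriv F) := by
  rw [← derivative_taylorSeries]
  ext r
  rw [PowerSeries.coeff_derivative, PowerSeries.coeff_derivative, coeff_varSeries_succ]
  simp [taylorSeries]

theorem schurSeries_taylorCoeff {F : ℂ → ℂ} (hF : AnalyticAt ℂ F 0) (h0 : F 0 = 0) :
    schurSeries (taylorCoeff F) = taylorSeries (fun z => Complex.exp (F z)) := by
  symm
  apply eq_schurSeries_of_derivative_eq
  · rw [derivative_varSeries_taylorCoeff, derivative_taylorSeries,
      ← taylorSeries_mul hF.deriv hF.cexp']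
    apply taylorSeries_congr
    filter_upwards [hF.eventually_analyticAt] with z hz
    rw [deriv_cexp hz.differentiableAt, mul_comm]
  · rw [constantCoeff_taylorSeries, h0, Complex.exp_zero]

/-- Exponentiating undoes the logarithm in the definitions of `θ_r`, `ϑ_r` and `s_r`: adding such a
vector to the variables multiplies the generating series by the explicit function `h`. -/
theorem schurSeries_taylorCoeff_log {h : ℂ → ℂ} (hh : AnalyticAt ℂ h 0) (h0 : h 0 = 1) :
    schurSeries (taylorCoeff fun z => Complex.log (h z)) = taylorSeries h := by
  have hs : h 0 ∈ Complex.slitPlane := by rw [h0]; exact Complex.one_mem_slitPlane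
  rw [schurSeries_taylorCoeff (hh.clog hs) (by simp [h0])]
  apply taylorSeries_congr
  have hne : ∀ᶠ z in 𝓝 (0 : ℂ), h z ≠ 0 :=
    hh.continuousAt.eventually_ne (by rw [h0]; exact one_ne_zero)
  filter_upwards [hne] with z hz
  exact Complex.exp_log hz

theorem taylorSeries_exp_affine (a b : ℂ) :
    taylorSeries (fun z => Complex.exp z * a + b)
      = PowerSeries.C a * PowerSeries.exp ℂ + PowerSeries.C b := by
  rw [taylorSeries_add (by fun_prop) (by fun_prop), taylorSeries_mul (by fun_prop) (by fun_prop),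
    taylorSeries_const, taylorSeries_const, taylorSeries_exp, mul_comm]

theorem schurSeries_log_affine {a b : ℂ} (hab : a + b ≠ 0) :
    PowerSeries.C (a + b) *
        schurSeries (taylorCoeff fun z => Complex.log ((Complex.exp z * a + b) / (a + b)))
      = PowerSeries.C a * PowerSeries.exp ℂ + PowerSeries.C b := by
  rw [schurSeries_taylorCoeff_log (by fun_prop (disch := assumption)) (by simp [hab]),
    ← taylorSeries_const, ← taylorSeries_mul (by fun_prop) (by fun_prop (disch := assumption)),
    ← taylorSeries_exp_affine]
  congr 1
  funext z
  field_simp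

theorem taylorCoeff_log_exp : taylorCoeff (fun z => Complex.log (Complex.exp z))
    = taylorCoeff (fun z => z) := by
  apply taylorCoeff_congr
  -- The principal logarithm inverts `exp` only where the imaginary part lies in `(-π, π]`; a unit
  -- disc suffices for Taylor coefficients.
  have h : ∀ᶠ z in 𝓝 (0 : ℂ), ‖z‖ < 1 := by
    have := Metric.ball_mem_nhds (0 : ℂ) one_pos
    filter_upwards [this] with z hz
    simpa using hz
  filter_upwards [h] with z hz
  have := (Complex.abs_im_le_norm z).trans_lt hz
  rw [abs_lt] at this
  have hpi := Real.pi_gt_three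
  exact Complex.log_exp (by linarith) (by linarith)

theorem zetaCoeff_eq (r : ℕ) : zetaCoeff r = if r = 1 then 1 else 0 := by
  have : zetaCoeff r = PowerSeries.coeff r (taylorSeries fun z => z) := by
    rw [taylorSeries, PowerSeries.coeff_mk, ← taylorCoeff_log_exp]; rfl
  rw [this, taylorSeries_id, PowerSeries.coeff_X]

theorem schurSeries_zetaCoeff : schurSeries zetaCoeff = PowerSeries.exp ℂ := by
  have : zetaCoeff = taylorCoeff (fun z => z) := by
    rw [← taylorCoeff_log_exp]; rfl
  rw [this, schurSeries_taylorCoeff (by fun_prop) rfl, ← taylorSeries_exp]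

/-- Both `2/κ` and `(e^κ - 1)/(e^κ + 1)` are odd, so the argument of the logarithm is even. The
equality holds at every `κ`, including the points where a division by zero takes its default value,
so no branch of the logarithm matters. -/
theorem sCoeff_odd (r : ℕ) : sCoeff (2 * r + 1) = 0 := by
  have he : (fun κ : ℂ => Complex.log (2 / κ * ((Complex.exp κ - 1) / (Complex.exp κ + 1))))
      = fun κ : ℂ => Complex.log (2 / -κ * ((Complex.exp (-κ) - 1) / (Complex.exp (-κ) + 1))) := by
    funext κ
    congr 1
    rw [Complex.exp_neg]
    have h := Complex.exp_ne_zero κ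
    have e : ((Complex.exp κ)⁻¹ - 1) / ((Complex.exp κ)⁻¹ + 1)
        = -((Complex.exp κ - 1) / (Complex.exp κ + 1)) := by
      rw [← neg_div]
      have e1 : (Complex.exp κ)⁻¹ - 1 = (Complex.exp κ)⁻¹ * -(Complex.exp κ - 1) := by
        field_simp; ring
      have e2 : (Complex.exp κ)⁻¹ + 1 = (Complex.exp κ)⁻¹ * (Complex.exp κ + 1) := by
        field_simp; ring
      rw [e1, e2, mul_div_mul_left _ _ (inv_ne_zero h)]
    rw [e, div_neg]; ring
  have h1 := iteratedDeriv_comp_neg (2 * r + 1)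
    (fun κ : ℂ => Complex.log (2 / κ * ((Complex.exp κ - 1) / (Complex.exp κ + 1)))) 0
  rw [← he, neg_zero, Odd.neg_one_pow ⟨r, rfl⟩, neg_one_smul] at h1
  rw [sCoeff, taylorCoeff, self_eq_neg.mp h1, zero_div]

/-- This is `κ exp (∑ s_r κ^r) = 2 (e^κ - 1)/(e^κ + 1)` with denominators cleared, the link between
the vector `s` and `tanh (κ/2)`. -/
theorem X_mul_schurSeries_sCoeff :
    PowerSeries.X * schurSeries sCoeff * (PowerSeries.exp ℂ + 1)
      = PowerSeries.C 2 * (PowerSeries.exp ℂ - 1) := by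
  -- `dslope` fills the removable singularity of `(e^z - 1)/z` at zero. The logarithms agree there
  -- too, since `2/0 = 0` and `log 0 = 0 = log 1`.
  set h : ℂ → ℂ := fun z => 2 / (Complex.exp z + 1) * dslope Complex.exp 0 z with hh
  have h2 : Complex.exp 0 + 1 ≠ 0 := by norm_num
  have hds : AnalyticAt ℂ (dslope Complex.exp 0) 0 := by
    have : DifferentiableOn ℂ (dslope Complex.exp 0) Set.univ :=
      (Complex.differentiableOn_dslope Filter.univ_mem).mpr
        Complex.differentiable_exp.differentiableOn
    exact this.analyticAt Filter.univ_mem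
  have hq : AnalyticAt ℂ (fun z => 2 / (Complex.exp z + 1)) 0 := by
    fun_prop (disch := assumption)
  have han : AnalyticAt ℂ h 0 := hq.mul hds
  have h0 : h 0 = 1 := by
    simp only [hh, dslope_same, Complex.deriv_exp, Complex.exp_zero]; norm_num
  have hs : sCoeff = taylorCoeff fun z => Complex.log (h z) := by
    have : (fun κ : ℂ => Complex.log (2 / κ * ((Complex.exp κ - 1) / (Complex.exp κ + 1))))
        = fun z => Complex.log (h z) := by
      funext κ
      by_cases hκ : κ = 0
      · rw [hκ, h0]; simp
      · congr 1
        simp only [hh]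
        rw [dslope_of_ne _ hκ, slope_def_field, Complex.exp_zero, sub_zero]
        ring
    funext r
    rw [sCoeff, this]
  have hsm : ∀ z : ℂ, z * dslope Complex.exp 0 z = Complex.exp z - 1 := fun z => by
    have := sub_smul_dslope Complex.exp 0 z
    simpa using this
  rw [hs, schurSeries_taylorCoeff_log han h0, ← taylorSeries_id,
    ← taylorSeries_mul (by fun_prop) han]
  have e1 : PowerSeries.exp ℂ + 1 = taylorSeries (fun z => Complex.exp z * 1 + 1) := by
    rw [taylorSeries_exp_affine]; simp
  have e2 : PowerSeries.C 2 * (PowerSeries.exp ℂ - 1)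
      = taylorSeries (fun z => Complex.exp z * 2 + -2) := by
    rw [taylorSeries_exp_affine, map_neg]; ring
  rw [e1, e2]
  refine (taylorSeries_mul (F := fun z => z * h z) (analyticAt_id.fun_mul han)
    (by fun_prop)).symm.trans ?_
  apply taylorSeries_congr
  have hne : ∀ᶠ z in 𝓝 (0 : ℂ), Complex.exp z + 1 ≠ 0 :=
    (by fun_prop : ContinuousAt (fun z => Complex.exp z + 1) 0).eventually_ne h2
  filter_upwards [hne] with z hz
  have := hsm z
  simp only [hh]
  field_simp
  linear_combination this

/-! ### Constants of the background and the spectral variable -/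

section Background

variable {σ ρ₁ ρ₂ : ℝ}

theorem Admissible.rho_pos (h : Admissible σ ρ₁ ρ₂) : 0 < rho σ ρ₁ ρ₂ := by
  rcases h with ⟨rfl, h1, h2⟩ | ⟨rfl, h1, h2⟩ <;> (unfold rho; linarith)

theorem Admissible.rho_lt_one (h : Admissible σ ρ₁ ρ₂) : rho σ ρ₁ ρ₂ < 1 := by
  rcases h with ⟨rfl, h1, h2⟩ | ⟨rfl, h1, h2⟩ <;> (unfold rho; linarith)

theorem Admissible.left_ne_zero (h : Admissible σ ρ₁ ρ₂) : ρ₁ ≠ 0 := by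
  rintro rfl
  rcases h with ⟨rfl, h1, h2⟩ | ⟨rfl, h1, h2⟩ <;> simp at *

theorem Admissible.right_ne_zero (h : Admissible σ ρ₁ ρ₂) : ρ₂ ≠ 0 := by
  rintro rfl
  rcases h with ⟨rfl, h1, h2⟩ | ⟨rfl, h1, h2⟩ <;> simp at *

theorem mul_eq_rho_sub_one (σ ρ₁ ρ₂ : ℝ) : σ * ρ₁ * ρ₂ = rho σ ρ₁ ρ₂ - 1 := by
  unfold rho; ring

theorem Admissible.rhoHat_pos (h : Admissible σ ρ₁ ρ₂) : 0 < rhoHat σ ρ₁ ρ₂ := by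
  unfold rhoHat
  apply Real.sqrt_pos_of_pos
  have h1 := h.rho_pos
  have h2 := h.rho_lt_one
  have h3 := mul_eq_rho_sub_one σ ρ₁ ρ₂
  have : -σ * ρ₁ * ρ₂ = 1 - rho σ ρ₁ ρ₂ := by linarith
  rw [this]
  exact mul_pos (by linarith) h1

theorem Admissible.rhoHat_sq (h : Admissible σ ρ₁ ρ₂) :
    rhoHat σ ρ₁ ρ₂ ^ 2 = rho σ ρ₁ ρ₂ * (1 - rho σ ρ₁ ρ₂) := by
  have h1 := h.rho_pos
  have h2 := h.rho_lt_one
  have h3 := mul_eq_rho_sub_one σ ρ₁ ρ₂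
  have h4 : -σ * ρ₁ * ρ₂ = 1 - rho σ ρ₁ ρ₂ := by linarith
  unfold rhoHat
  rw [h4, Real.sq_sqrt (mul_pos (by linarith) h1).le]
  ring

theorem ofReal_add_I_mul_ne_zero {a : ℝ} (ha : 0 < a) (b : ℝ) : (a : ℂ) + Complex.I * b ≠ 0 := by
  intro h
  have := congrArg Complex.re h
  simp at this
  exact ha.ne' this

variable (σ ρ₁ ρ₂)

/-- The spectral variable `ρ̂ e^κ` as a formal power series. -/
noncomputable def specSeries : PowerSeries ℂ :=
  PowerSeries.C (rhoHat σ ρ₁ ρ₂ : ℂ) * PowerSeries.exp ℂ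

theorem conjSeries_exp : conjSeries (PowerSeries.exp ℂ) = PowerSeries.exp ℂ :=
  PowerSeries.map_exp _

theorem conjSeries_specSeries : conjSeries (specSeries σ ρ₁ ρ₂) = specSeries σ ρ₁ ρ₂ := by
  rw [specSeries, map_mul, conjSeries_exp, PowerSeries.map_C, Complex.conj_ofReal]

theorem constantCoeff_specSeries :
    PowerSeries.constantCoeff (specSeries σ ρ₁ ρ₂) = rhoHat σ ρ₁ ρ₂ := by
  simp [specSeries]

/-- The series `ρ̂ e^κ + i c` for real `c`. -/
noncomputable def shiftSeries (c : ℝ) : PowerSeries ℂ :=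
  specSeries σ ρ₁ ρ₂ + PowerSeries.C (Complex.I * c)

theorem conjSeries_shiftSeries (c : ℝ) :
    conjSeries (shiftSeries σ ρ₁ ρ₂ c) = shiftSeries σ ρ₁ ρ₂ (-c) := by
  rw [shiftSeries, shiftSeries, map_add, conjSeries_specSeries, PowerSeries.map_C]
  congr 2
  simp

theorem constantCoeff_shiftSeries (c : ℝ) :
    PowerSeries.constantCoeff (shiftSeries σ ρ₁ ρ₂ c) = rhoHat σ ρ₁ ρ₂ + Complex.I * c := by
  simp [shiftSeries, constantCoeff_specSeries]

variable {σ ρ₁ ρ₂}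

theorem Admissible.constantCoeff_shiftSeries_ne_zero (h : Admissible σ ρ₁ ρ₂) (c : ℝ) :
    PowerSeries.constantCoeff (shiftSeries σ ρ₁ ρ₂ c) ≠ 0 := by
  rw [constantCoeff_shiftSeries]
  exact ofReal_add_I_mul_ne_zero h.rhoHat_pos c

theorem Admissible.shiftSeries_mul_inv (h : Admissible σ ρ₁ ρ₂) (c : ℝ) :
    shiftSeries σ ρ₁ ρ₂ c * (shiftSeries σ ρ₁ ρ₂ c)⁻¹ = 1 :=
  PowerSeries.mul_inv_cancel _ (h.constantCoeff_shiftSeries_ne_zero c)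

/-- Raising `n` by one therefore multiplies the plus series by `ρ̂ e^κ + iρ`, normalized to constant
term one. The next lemma plays the same role for `k`. -/
theorem Admissible.schurSeries_thetaCoeff (h : Admissible σ ρ₁ ρ₂) :
    PowerSeries.C (rhoHat σ ρ₁ ρ₂ + Complex.I * (rho σ ρ₁ ρ₂ : ℝ))
        * schurSeries (thetaCoeff σ ρ₁ ρ₂) = shiftSeries σ ρ₁ ρ₂ (rho σ ρ₁ ρ₂) :=
  schurSeries_log_affine (ofReal_add_I_mul_ne_zero h.rhoHat_pos _)

theorem Admissible.schurSeries_varthetaCoeff (h : Admissible σ ρ₁ ρ₂) :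
    PowerSeries.C (rhoHat σ ρ₁ ρ₂ + Complex.I * (σ * ρ₁ * ρ₂ : ℝ))
        * schurSeries (varthetaCoeff σ ρ₁ ρ₂) = shiftSeries σ ρ₁ ρ₂ (σ * ρ₁ * ρ₂) :=
  schurSeries_log_affine (ofReal_add_I_mul_ne_zero h.rhoHat_pos _)

theorem alphaSeries (σ ρ₁ ρ₂ : ℝ) : taylorSeries (fun κ : ℂ =>
    (ρ₂ : ℂ) / (ρ₁ : ℂ) * ((rhoHat σ ρ₁ ρ₂ : ℂ) * (Complex.exp κ - 1)))
      = PowerSeries.C (ρ₂ / ρ₁ : ℂ)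
        * (specSeries σ ρ₁ ρ₂ - PowerSeries.C (rhoHat σ ρ₁ ρ₂ : ℂ)) := by
  rw [taylorSeries_mul (by fun_prop) (by fun_prop), taylorSeries_const]
  have : (fun z : ℂ => (rhoHat σ ρ₁ ρ₂ : ℂ) * (Complex.exp z - 1))
      = fun z => Complex.exp z * (rhoHat σ ρ₁ ρ₂ : ℂ) + -(rhoHat σ ρ₁ ρ₂ : ℂ) := by
    funext z; ring
  rw [this, taylorSeries_exp_affine, map_neg, specSeries, sub_eq_add_neg]

theorem varSeries_taylorCoeff {F : ℂ → ℂ} (h0 : F 0 = 0) :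
    varSeries (taylorCoeff F) = taylorSeries F := by
  apply PowerSeries.derivative.ext
  · rw [derivative_varSeries_taylorCoeff, derivative_taylorSeries]
  · rw [constantCoeff_varSeries, constantCoeff_taylorSeries, h0]

theorem varSeries_alphaCoeff (σ ρ₁ ρ₂ : ℝ) : varSeries (alphaCoeff σ ρ₁ ρ₂)
    = PowerSeries.C (ρ₂ / ρ₁ : ℂ) * (specSeries σ ρ₁ ρ₂ - PowerSeries.C (rhoHat σ ρ₁ ρ₂ : ℂ)) := by
  rw [← alphaSeries]
  exact varSeries_taylorCoeff (by simp)

/-- Up to an additive constant the `t`-flow is a multiple of `1/(ρ̂ e^κ + iρ)`, the inverse of the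
symbol of the shift in `n`. -/
theorem Admissible.varSeries_betaCoeff (h : Admissible σ ρ₁ ρ₂) :
    varSeries (betaCoeff σ ρ₁ ρ₂) = PowerSeries.C (ρ₁ * rho σ ρ₁ ρ₂ / ρ₂ : ℂ) *
      (PowerSeries.C (rhoHat σ ρ₁ ρ₂ + Complex.I * (rho σ ρ₁ ρ₂ : ℝ))⁻¹
        - (shiftSeries σ ρ₁ ρ₂ (rho σ ρ₁ ρ₂))⁻¹) := by
  have hne := ofReal_add_I_mul_ne_zero h.rhoHat_pos (rho σ ρ₁ ρ₂)
  have hd : Complex.exp 0 * (rhoHat σ ρ₁ ρ₂ : ℂ) + Complex.I * (rho σ ρ₁ ρ₂ : ℂ) ≠ 0 := by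
    simpa using hne
  have hinv : taylorSeries (fun κ : ℂ =>
      1 / (Complex.exp κ * (rhoHat σ ρ₁ ρ₂ : ℂ) + Complex.I * (rho σ ρ₁ ρ₂ : ℂ)))
      = (shiftSeries σ ρ₁ ρ₂ (rho σ ρ₁ ρ₂))⁻¹ := by
    rw [PowerSeries.eq_inv_iff_mul_eq_one (h.constantCoeff_shiftSeries_ne_zero _), shiftSeries,
      specSeries, ← taylorSeries_exp_affine,
      ← taylorSeries_mul (by fun_prop (disch := assumption)) (by fun_prop),
      ← map_one PowerSeries.C, ← taylorSeries_const]
    apply taylorSeries_congr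
    have hn : ∀ᶠ κ in 𝓝 (0 : ℂ),
        Complex.exp κ * (rhoHat σ ρ₁ ρ₂ : ℂ) + Complex.I * (rho σ ρ₁ ρ₂ : ℂ) ≠ 0 :=
      ContinuousAt.eventually_ne (by fun_prop) hd
    filter_upwards [hn] with κ hκ
    exact one_div_mul_cancel hκ
  rw [← hinv]
  refine (varSeries_taylorCoeff (by simp)).trans ?_
  rw [taylorSeries_mul (by fun_prop) (by fun_prop (disch := assumption)), taylorSeries_const]
  congr 1
  have : ∀ z : ℂ, 1 / ((rhoHat σ ρ₁ ρ₂ : ℂ) + Complex.I * (rho σ ρ₁ ρ₂ : ℂ)) -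
      1 / (Complex.exp z * (rhoHat σ ρ₁ ρ₂ : ℂ) + Complex.I * (rho σ ρ₁ ρ₂ : ℂ))
      = ((rhoHat σ ρ₁ ρ₂ : ℂ) + Complex.I * (rho σ ρ₁ ρ₂ : ℂ))⁻¹ + -1 *
      (1 / (Complex.exp z * (rhoHat σ ρ₁ ρ₂ : ℂ) + Complex.I * (rho σ ρ₁ ρ₂ : ℂ))) := by
    intro z; ring
  simp only [this]
  rw [taylorSeries_add (by fun_prop) (by fun_prop (disch := assumption)), taylorSeries_const,
    taylorSeries_mul (by fun_prop) (by fun_prop (disch := assumption)), taylorSeries_const]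
  simp [sub_eq_add_neg]

theorem taylorCoeff_eq_coeff (F : ℂ → ℂ) (r : ℕ) :
    taylorCoeff F r = PowerSeries.coeff r (taylorSeries F) := by
  simp [taylorSeries]

theorem conj_alphaCoeff (σ ρ₁ ρ₂ : ℝ) (r : ℕ) :
    conj (alphaCoeff σ ρ₁ ρ₂ r) = alphaCoeff σ ρ₁ ρ₂ r := by
  have : alphaCoeff σ ρ₁ ρ₂ r = PowerSeries.coeff r (PowerSeries.C (ρ₂ / ρ₁ : ℂ) *
      (specSeries σ ρ₁ ρ₂ - PowerSeries.C (rhoHat σ ρ₁ ρ₂ : ℂ))) := by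
    rw [← alphaSeries, ← taylorCoeff_eq_coeff]; rfl
  rw [this, ← PowerSeries.coeff_map, map_mul, map_sub, conjSeries_specSeries, PowerSeries.map_C,
    PowerSeries.map_C, map_div₀, Complex.conj_ofReal, Complex.conj_ofReal, Complex.conj_ofReal]

theorem conj_zetaCoeff (r : ℕ) : conj (zetaCoeff r) = zetaCoeff r := by
  rw [zetaCoeff_eq]; split_ifs <;> simp

theorem schur_one (x : ℕ → ℂ) : schur 1 x = x 1 := by
  rw [schur_succ_eq]; simp [schur_zero]

theorem alphaCoeff_one (σ ρ₁ ρ₂ : ℝ) :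
    alphaCoeff σ ρ₁ ρ₂ 1 = (ρ₂ : ℂ) * (rhoHat σ ρ₁ ρ₂ : ℂ) / (ρ₁ : ℂ) := by
  rw [show alphaCoeff σ ρ₁ ρ₂ 1 = PowerSeries.coeff 1 (varSeries (alphaCoeff σ ρ₁ ρ₂)) from
    (coeff_varSeries_succ _ 0).symm, varSeries_alphaCoeff]
  simp [specSeries, PowerSeries.coeff_exp]
  ring

theorem Admissible.betaCoeff_one (h : Admissible σ ρ₁ ρ₂) :
    betaCoeff σ ρ₁ ρ₂ 1 = (ρ₁ : ℂ) * (rho σ ρ₁ ρ₂ : ℂ) * (rhoHat σ ρ₁ ρ₂ : ℂ) /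
      ((ρ₂ : ℂ) * ((rhoHat σ ρ₁ ρ₂ : ℂ) + Complex.I * (rho σ ρ₁ ρ₂ : ℂ)) ^ 2) := by
  have hne := ofReal_add_I_mul_ne_zero h.rhoHat_pos (rho σ ρ₁ ρ₂)
  have hd : Complex.exp 0 * (rhoHat σ ρ₁ ρ₂ : ℂ) + Complex.I * (rho σ ρ₁ ρ₂ : ℂ) ≠ 0 := by
    simpa using hne
  have h1 : HasDerivAt (fun κ : ℂ =>
      (Complex.exp κ * (rhoHat σ ρ₁ ρ₂ : ℂ) + Complex.I * (rho σ ρ₁ ρ₂ : ℂ)))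
      (Complex.exp 0 * (rhoHat σ ρ₁ ρ₂ : ℂ)) 0 :=
    ((Complex.hasDerivAt_exp 0).mul_const _).add_const _
  have h2 := ((h1.fun_inv hd).const_sub
    (1 / ((rhoHat σ ρ₁ ρ₂ : ℂ) + Complex.I * (rho σ ρ₁ ρ₂ : ℂ)))).const_mul
      ((ρ₁ : ℂ) * (rho σ ρ₁ ρ₂ : ℂ) / (ρ₂ : ℂ))
  simp only [betaCoeff, taylorCoeff, iteratedDeriv_one, one_div (Complex.exp _ * _ + _)]
  rw [h2.deriv]
  have hr := h.right_ne_zero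
  have hr' : (ρ₂ : ℂ) ≠ 0 := by exact_mod_cast hr
  simp only [Complex.exp_zero, one_mul, Nat.factorial_one, Nat.cast_one, div_one]
  field_simp

theorem Admissible.thetaCoeff_one (h : Admissible σ ρ₁ ρ₂) :
    thetaCoeff σ ρ₁ ρ₂ 1 = (rhoHat σ ρ₁ ρ₂ : ℂ) /
      ((rhoHat σ ρ₁ ρ₂ : ℂ) + Complex.I * (rho σ ρ₁ ρ₂ : ℂ)) := by
  have h1 := congrArg (PowerSeries.coeff 1) h.schurSeries_thetaCoeff
  rw [PowerSeries.coeff_C_mul, ← schur_eq_coeff, schur_one] at h1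
  rw [eq_div_iff (ofReal_add_I_mul_ne_zero h.rhoHat_pos _), mul_comm, h1]
  simp [shiftSeries, specSeries, PowerSeries.coeff_exp]

theorem Admissible.varthetaCoeff_one (h : Admissible σ ρ₁ ρ₂) :
    varthetaCoeff σ ρ₁ ρ₂ 1 = (rhoHat σ ρ₁ ρ₂ : ℂ) /
      ((rhoHat σ ρ₁ ρ₂ : ℂ) + Complex.I * ((σ * ρ₁ * ρ₂ : ℝ) : ℂ)) := by
  have h1 := congrArg (PowerSeries.coeff 1) h.schurSeries_varthetaCoeff
  rw [PowerSeries.coeff_C_mul, ← schur_eq_coeff, schur_one] at h1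
  rw [eq_div_iff (ofReal_add_I_mul_ne_zero h.rhoHat_pos _), mul_comm, h1]
  simp [shiftSeries, specSeries, PowerSeries.coeff_exp]

/-- The offset `1/2` makes `n ↦ -1 - n` the reflection `n + 1/2 ↦ -(n + 1/2)`. This is the source of
all conjugation symmetries of the determinants. -/
theorem conj_genPlus (b : ℕ → ℂ) (n k l : ℤ) (x t : ℝ) (r : ℕ) :
    conj (genPlus σ ρ₁ ρ₂ b n k l x t r) = genMinus σ ρ₁ ρ₂ b (-1 - n) (-k) (-l) x t r := by
  simp only [genPlus, genMinus, map_add, map_mul, conj_alphaCoeff, conj_zetaCoeff,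
    Complex.conj_ofReal, map_div₀, map_one, map_ofNat, map_intCast]
  push_cast
  ring

theorem genPlus_n_succ (b : ℕ → ℂ) (n k l : ℤ) (x t : ℝ) :
    genPlus σ ρ₁ ρ₂ b (n + 1) k l x t
      = fun r => genPlus σ ρ₁ ρ₂ b n k l x t r + thetaCoeff σ ρ₁ ρ₂ r := by
  funext r; simp only [genPlus]; push_cast; ring

theorem genPlus_k_succ (b : ℕ → ℂ) (n k l : ℤ) (x t : ℝ) :
    genPlus σ ρ₁ ρ₂ b n (k + 1) l x t
      = fun r => genPlus σ ρ₁ ρ₂ b n k l x t r + varthetaCoeff σ ρ₁ ρ₂ r := by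
  funext r; simp only [genPlus]; push_cast; ring

theorem genPlus_l_succ (b : ℕ → ℂ) (n k l : ℤ) (x t : ℝ) :
    genPlus σ ρ₁ ρ₂ b n k (l + 1) x t
      = fun r => genPlus σ ρ₁ ρ₂ b n k l x t r + zetaCoeff r := by
  funext r; simp only [genPlus]; push_cast; ring

end Background

/-! ### The generating kernel and its matrix of odd coefficients -/

/-- The power series of `tanh (κ / 2)`, in the form `(κ / 2) exp (∑ s_r κ ^ r)`. -/
noncomputable def tanhSeries : PowerSeries ℂ :=
  PowerSeries.C (1 / 2) * PowerSeries.X * schurSeries sCoeff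

theorem exp_add_one_mul_tanhSeries :
    (PowerSeries.exp ℂ + 1) * tanhSeries = PowerSeries.exp ℂ - 1 := by
  have h : PowerSeries.C (1 / 2 : ℂ) * PowerSeries.C 2 = 1 := by
    rw [← map_mul, ← map_one PowerSeries.C]; norm_num
  rw [tanhSeries]
  linear_combination PowerSeries.C (1 / 2) * X_mul_schurSeries_sCoeff
    + (PowerSeries.exp ℂ - 1) * h

theorem exp_add_one_ne_zero : PowerSeries.exp ℂ + 1 ≠ 0 := by
  intro h
  have := congrArg PowerSeries.constantCoeff h
  norm_num at this

/-- The equation `(e^κ + 1) T = e^κ - 1` has real coefficients and determines `T`. -/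
theorem conjSeries_tanhSeries : conjSeries tanhSeries = tanhSeries := by
  apply mul_left_cancel₀ exp_add_one_ne_zero
  have := congrArg conjSeries exp_add_one_mul_tanhSeries
  rw [map_mul, map_add, map_sub, conjSeries_exp, map_one] at this
  rw [this, exp_add_one_mul_tanhSeries]

theorem coeff_mul_tanhSeries_pow (A : PowerSeries ℂ) (γ i : ℕ) :
    PowerSeries.coeff i (A * tanhSeries ^ γ)
      = if γ ≤ i then (1 / 2) ^ γ * PowerSeries.coeff (i - γ) (A * schurSeries sCoeff ^ γ)
        else 0 := by
  have : A * tanhSeries ^ γ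
      = PowerSeries.C ((1 / 2) ^ γ) * (PowerSeries.X ^ γ * (A * schurSeries sCoeff ^ γ)) := by
    rw [tanhSeries, mul_pow, mul_pow, map_pow]; ring
  rw [this, PowerSeries.coeff_C_mul, PowerSeries.coeff_X_pow_mul']
  split_ifs <;> simp

/-- The factor `4^{-γ}` splits into `2^{-γ}` for each side, and each half combines with the shift by
`γ s` into `T^γ`. As `T^γ` has order `γ`, the range of summation may be enlarged at will. -/
theorem mEntry_eq_sum (xp xm : ℕ → ℂ) {i j K : ℕ} (hK : min i j < K) :
    mEntry xp xm sCoeff i j = ∑ γ ∈ Finset.range K,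
      PowerSeries.coeff i (schurSeries xp * tanhSeries ^ γ)
        * PowerSeries.coeff j (schurSeries xm * tanhSeries ^ γ) := by
  rw [mEntry]
  have hsub : Finset.range (min i j + 1) ⊆ Finset.range K :=
    Finset.range_subset_range.mpr hK
  rw [← Finset.sum_subset hsub]
  · refine Finset.sum_congr rfl fun γ hγ => ?_
    rw [Finset.mem_range] at hγ
    rw [coeff_mul_tanhSeries_pow, coeff_mul_tanhSeries_pow, if_pos (by omega), if_pos (by omega),
      schur_eq_coeff, schur_eq_coeff, schurSeries_add, schurSeries_add, schurSeries_nat_mul]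
    have : (1 : ℂ) / 4 ^ γ = (1 / 2) ^ γ * (1 / 2) ^ γ := by
      rw [← mul_pow, ← one_div_pow]; norm_num
    rw [this]; ring
  · intro γ _ hγ
    rw [Finset.mem_range] at hγ
    rw [coeff_mul_tanhSeries_pow, coeff_mul_tanhSeries_pow]
    by_cases h : γ ≤ i
    · rw [if_neg (show ¬ γ ≤ j by omega), mul_zero]
    · rw [if_neg h, zero_mul]

variable (N : ℕ)

/-- The first `N` odd coefficients of a power series. -/
noncomputable def oddVec (A : PowerSeries ℂ) : Fin N → ℂ :=
  fun i => PowerSeries.coeff (2 * (i : ℕ) + 1) A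

/-- The matrix of the coefficients of `κ ^ i λ ^ j`, with `i` and `j` odd, in the expansion of
`A(κ) B(λ) / (1 - tanh (κ / 2) tanh (λ / 2))`. -/
noncomputable def pairing (A B : PowerSeries ℂ) : Matrix (Fin N) (Fin N) ℂ :=
  ∑ γ ∈ Finset.range (2 * N),
    Matrix.vecMulVec (oddVec N (A * tanhSeries ^ γ)) (oddVec N (B * tanhSeries ^ γ))

theorem schurDet_eq_det_pairing (xp xm : ℕ → ℂ) :
    schurDet N xp xm sCoeff = (pairing N (schurSeries xp) (schurSeries xm)).det := by
  rw [schurDet]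
  congr 1
  ext i j
  rw [pairing, Matrix.sum_apply, Matrix.of_apply, mEntry_eq_sum (K := 2 * N)]
  · rfl
  · have := i.isLt; omega

variable {N}

theorem oddVec_add (A B : PowerSeries ℂ) : oddVec N (A + B) = oddVec N A + oddVec N B := by
  funext i; simp [oddVec]

theorem oddVec_sub (A B : PowerSeries ℂ) : oddVec N (A - B) = oddVec N A - oddVec N B := by
  funext i; simp [oddVec]

theorem oddVec_C_mul (c : ℂ) (A : PowerSeries ℂ) :
    oddVec N (PowerSeries.C c * A) = c • oddVec N A := by
  funext i; simp [oddVec]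

theorem pairing_add_left (A A' B : PowerSeries ℂ) :
    pairing N (A + A') B = pairing N A B + pairing N A' B := by
  simp only [pairing, add_mul, oddVec_add, Matrix.add_vecMulVec, Finset.sum_add_distrib]

theorem pairing_add_right (A B B' : PowerSeries ℂ) :
    pairing N A (B + B') = pairing N A B + pairing N A B' := by
  simp only [pairing, add_mul, oddVec_add, Matrix.vecMulVec_add, Finset.sum_add_distrib]

theorem pairing_C_mul_left (c : ℂ) (A B : PowerSeries ℂ) :
    pairing N (PowerSeries.C c * A) B = c • pairing N A B := by
  simp only [pairing, mul_assoc, oddVec_C_mul, Matrix.smul_vecMulVec, Finset.smul_sum]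

theorem pairing_C_mul_right (c : ℂ) (A B : PowerSeries ℂ) :
    pairing N A (PowerSeries.C c * B) = c • pairing N A B := by
  simp only [pairing, mul_assoc, oddVec_C_mul, Matrix.vecMulVec_smul, Finset.smul_sum]

theorem pairing_sub_left (A A' B : PowerSeries ℂ) :
    pairing N (A - A') B = pairing N A B - pairing N A' B := by
  rw [eq_sub_iff_add_eq, ← pairing_add_left, sub_add_cancel]

theorem pairing_sub_right (A B B' : PowerSeries ℂ) :
    pairing N A (B - B') = pairing N A B - pairing N A B' := by
  rw [eq_sub_iff_add_eq, ← pairing_add_right, sub_add_cancel]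

/-- `T^{2N}` has order `2N`, while the odd indices in use stop at `2N - 1`. So truncating the
geometric series at `2N` loses nothing. -/
theorem oddVec_mul_tanhSeries_pow (A : PowerSeries ℂ) :
    oddVec N (A * tanhSeries ^ (2 * N)) = 0 := by
  funext i
  rw [oddVec, coeff_mul_tanhSeries_pow, if_neg (by have := i.isLt; omega)]
  rfl

/-- Telescoping of the geometric series: multiplying the kernel by `1 - T(κ) T(λ)` leaves `A(κ)
B(λ)`. -/
theorem pairing_mul_tanhSeries (A B : PowerSeries ℂ) :
    pairing N A B - pairing N (A * tanhSeries) (B * tanhSeries)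
      = Matrix.vecMulVec (oddVec N A) (oddVec N B) := by
  have h := Finset.sum_range_sub' (fun γ => Matrix.vecMulVec (oddVec N (A * tanhSeries ^ γ))
    (oddVec N (B * tanhSeries ^ γ))) (2 * N)
  rw [oddVec_mul_tanhSeries_pow, Matrix.zero_vecMulVec, sub_zero, pow_zero, mul_one, mul_one,
    Finset.sum_sub_distrib] at h
  rw [← h]
  simp only [pairing, pow_succ', mul_assoc]

/-- The basic rank-one property, from `(e^κ + e^λ)/(1 - T(κ) T(λ)) = (e^κ + 1)(e^λ + 1)/2`. -/
theorem pairing_exp_mul (A B : PowerSeries ℂ) :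
    pairing N (PowerSeries.exp ℂ * A) B + pairing N A (PowerSeries.exp ℂ * B)
      = (1 / 2 : ℂ) • Matrix.vecMulVec (oddVec N ((PowerSeries.exp ℂ + 1) * A))
          (oddVec N ((PowerSeries.exp ℂ + 1) * B)) := by
  have hW := exp_add_one_mul_tanhSeries
  have h2 : PowerSeries.C (1 / 2 : ℂ) * 2 = 1 := by
    rw [← map_ofNat PowerSeries.C, ← map_mul, ← map_one PowerSeries.C]; norm_num
  have key := pairing_mul_tanhSeries (N := N)
    (PowerSeries.C (1 / 2) * ((PowerSeries.exp ℂ + 1) * A))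
    (PowerSeries.C (1 / 2) * ((PowerSeries.exp ℂ + 1) * B))
  -- With `G = (e^κ + 1) F / 2`, the relation for `T` gives `e^κ F = (1 + T) G` and `F = (1 - T) G`.
  -- In the sum the mixed terms cancel and `2 (1 - T(κ) T(λ))` remains.
  have e1 : ∀ F : PowerSeries ℂ, PowerSeries.exp ℂ * F
      = PowerSeries.C (1 / 2) * ((PowerSeries.exp ℂ + 1) * F)
        + PowerSeries.C (1 / 2) * ((PowerSeries.exp ℂ + 1) * F) * tanhSeries := fun F => by
    linear_combination -PowerSeries.C (1 / 2) * F * hW - PowerSeries.exp ℂ * F * h2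
  have e2 : ∀ F : PowerSeries ℂ, F
      = PowerSeries.C (1 / 2) * ((PowerSeries.exp ℂ + 1) * F)
        - PowerSeries.C (1 / 2) * ((PowerSeries.exp ℂ + 1) * F) * tanhSeries := fun F => by
    linear_combination PowerSeries.C (1 / 2) * F * hW - F * h2
  have e3 : pairing N (PowerSeries.exp ℂ * A) B + pairing N A (PowerSeries.exp ℂ * B)
      = (2 : ℂ) • Matrix.vecMulVec
        (oddVec N (PowerSeries.C (1 / 2) * ((PowerSeries.exp ℂ + 1) * A)))
        (oddVec N (PowerSeries.C (1 / 2) * ((PowerSeries.exp ℂ + 1) * B))) := by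
    rw [← key]
    conv_lhs =>
      rw [e1 A, e1 B]
      arg 1
      rw [e2 B]
    conv_lhs =>
      arg 2
      rw [e2 A]
    simp only [pairing_add_left, pairing_sub_left, pairing_add_right, pairing_sub_right]
    module
  rw [e3, oddVec_C_mul, oddVec_C_mul, Matrix.smul_vecMulVec, Matrix.vecMulVec_smul, smul_smul,
    smul_smul]
  norm_num

theorem sum_range_two_mul {M : Type*} [AddCommMonoid M] (f : ℕ → M) (m : ℕ) :
    ∑ k ∈ Finset.range (2 * m), f k = ∑ j ∈ Finset.range m, (f (2 * j) + f (2 * j + 1)) := by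
  induction m with
  | zero => simp
  | succ m ih =>
    rw [mul_add, mul_one, Finset.sum_range_succ, Finset.sum_range_succ, ih,
      Finset.sum_range_succ, add_assoc]

variable (N)

/-- The lower triangular matrix of multiplication by an even series on the odd coefficients. -/
noncomputable def evenMatrix (e : PowerSeries ℂ) : Matrix (Fin N) (Fin N) ℂ :=
  Matrix.of fun i j => if (j : ℕ) ≤ i then PowerSeries.coeff (2 * ((i : ℕ) - j)) e else 0

variable {N}

/-- An odd coefficient of `e A` with `e` even involves only odd coefficients of `A`. The convolution
is split into pairs of consecutive indices, of which only the odd one contributes. -/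
theorem oddVec_even_mul {e : PowerSeries ℂ} (he : IsEvenSeries e) (A : PowerSeries ℂ) :
    oddVec N (e * A) = (evenMatrix N e).mulVec (oddVec N A) := by
  funext i
  rw [oddVec, mul_comm e, PowerSeries.coeff_mul, Finset.Nat.sum_antidiagonal_eq_sum_range_succ_mk,
    show (2 * (i : ℕ) + 1).succ = 2 * (i + 1) by omega, sum_range_two_mul]
  rw [Matrix.mulVec, dotProduct]
  simp only [evenMatrix, Matrix.of_apply, oddVec]
  rw [Fin.sum_univ_eq_sum_range (fun j => (if j ≤ (i : ℕ) then
    PowerSeries.coeff (2 * ((i : ℕ) - j)) e else 0) * PowerSeries.coeff (2 * j + 1) A) N]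
  rw [← Finset.sum_subset (Finset.range_subset_range.mpr i.isLt)]
  · refine Finset.sum_congr rfl fun j hj => ?_
    rw [Finset.mem_range] at hj
    rw [if_pos (by omega), he (2 * (i : ℕ) + 1 - 2 * j) (by grind), mul_zero, zero_add,
      show 2 * (i : ℕ) + 1 - (2 * j + 1) = 2 * (i - j) by omega, mul_comm]
  · intro j _ hj
    rw [Finset.mem_range] at hj
    rw [if_neg (by omega), zero_mul]

theorem pairing_even_mul_left {e : PowerSeries ℂ} (he : IsEvenSeries e) (A B : PowerSeries ℂ) :
    pairing N (e * A) B = evenMatrix N e * pairing N A B := by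
  simp only [pairing, mul_assoc, oddVec_even_mul he, Finset.mul_sum, Matrix.mul_vecMulVec]

theorem pairing_even_mul_right {e : PowerSeries ℂ} (he : IsEvenSeries e) (A B : PowerSeries ℂ) :
    pairing N A (e * B) = pairing N A B * (evenMatrix N e).transpose := by
  simp only [pairing, mul_assoc, oddVec_even_mul he, Finset.sum_mul, Matrix.vecMulVec_mul,
    Matrix.vecMul_transpose]

theorem det_evenMatrix (e : PowerSeries ℂ) :
    (evenMatrix N e).det = PowerSeries.constantCoeff e ^ N := by
  rw [Matrix.det_of_isLowerTriangular]
  · simp [evenMatrix]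
  · intro i j hij
    have : (i : ℕ) < j := by simpa using hij
    exact if_neg this.not_ge

/-- An even factor with constant term one is invisible to the determinant. This serves both to drop
even-indexed variables and to relate the shifts of `n`, `k` and `l`. -/
theorem det_pairing_even_mul_left {e : PowerSeries ℂ} (he : IsEvenSeries e) (A B : PowerSeries ℂ) :
    (pairing N (e * A) B).det = PowerSeries.constantCoeff e ^ N * (pairing N A B).det := by
  rw [pairing_even_mul_left he, Matrix.det_mul, det_evenMatrix]

theorem det_pairing_even_mul_right {e : PowerSeries ℂ} (he : IsEvenSeries e) (A B : PowerSeries ℂ) :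
    (pairing N A (e * B)).det = PowerSeries.constantCoeff e ^ N * (pairing N A B).det := by
  rw [pairing_even_mul_right he, Matrix.det_mul, Matrix.det_transpose, det_evenMatrix, mul_comm]

theorem conj_oddVec (A : PowerSeries ℂ) : star (oddVec N A) = oddVec N (conjSeries A) := by
  funext i; simp [oddVec]

theorem conjTranspose_pairing (A B : PowerSeries ℂ) :
    (pairing N A B).conjTranspose = pairing N (conjSeries B) (conjSeries A) := by
  rw [pairing, Matrix.conjTranspose_sum]
  simp only [Matrix.conjTranspose_vecMulVec, conj_oddVec, map_mul, map_pow, conjSeries_tanhSeries,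
    pairing]

/-! ### Rank-one updates and derivatives of determinants -/

section DeterminantCalculus

variable {N : ℕ}

theorem dense_det_add_scalar_ne_zero (M : Matrix (Fin N) (Fin N) ℂ) :
    Dense {ε : ℂ | (M + Matrix.scalar (Fin N) ε).det ≠ 0} := by
  have hfin : {ε : ℂ | (M + Matrix.scalar (Fin N) ε).det = 0}.Finite := by
    -- `det (M + ε)` is the characteristic polynomial of `-M` at `ε`, which is monic and so has
    -- finitely many roots.
    have hne : (-M).charpoly ≠ 0 := (Matrix.charpoly_monic _).ne_zero
    refine ((-M).charpoly.roots.toFinset.finite_toSet).subset fun ε hε => ?_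
    rw [Finset.mem_coe, Multiset.mem_toFinset, Polynomial.mem_roots hne, Polynomial.IsRoot.def,
      Matrix.eval_charpoly, sub_neg_eq_add, add_comm]
    exact hε
  exact hfin.countable.dense_compl ℂ

/-- Two continuous functions of a matrix agree if they agree on invertible matrices. -/
theorem eq_of_forall_det_ne_zero {f g : Matrix (Fin N) (Fin N) ℂ → ℂ} (hf : Continuous f)
    (hg : Continuous g) (h : ∀ M, M.det ≠ 0 → f M = g M) (M : Matrix (Fin N) (Fin N) ℂ) :
    f M = g M := by
  have hc : Continuous fun ε : ℂ => M + Matrix.scalar (Fin N) ε := by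
    refine continuous_const.add ?_
    exact Continuous.matrix_diagonal (by fun_prop : Continuous fun (ε : ℂ) (_ : Fin N) => ε)
  have := (hf.comp hc).ext_on (dense_det_add_scalar_ne_zero M) (hg.comp hc) fun ε hε => h _ hε
  simpa using congrFun this 0

/-- The matrix determinant lemma for an update of rank two: `det (M + U V) = det M · det (1 + V M⁻¹
U)`, with a two-by-two determinant on the right. -/
theorem det_sub_vecMulVec_sub_vecMulVec {M : Matrix (Fin N) (Fin N) ℂ} (hM : M.det ≠ 0)
    (φ φ' x y : Fin N → ℂ) :
    (M - Matrix.vecMulVec φ x - Matrix.vecMulVec φ' y).det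
      = M.det * ((1 - x ⬝ᵥ M⁻¹.mulVec φ) * (1 - y ⬝ᵥ M⁻¹.mulVec φ')
          - (x ⬝ᵥ M⁻¹.mulVec φ') * (y ⬝ᵥ M⁻¹.mulVec φ)) := by
  set U : Matrix (Fin N) (Fin 2) ℂ := Matrix.of fun i k => ![φ i, φ' i] k with hU
  set V : Matrix (Fin 2) (Fin N) ℂ := Matrix.of fun k j => ![-x j, -y j] k with hV
  have e : M - Matrix.vecMulVec φ x - Matrix.vecMulVec φ' y = M + U * V := by
    ext i j
    simp [hU, hV, Matrix.mul_apply, Matrix.vecMulVec_apply]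
    ring
  have hV0 : ∀ j, V 0 j = -x j := fun j => rfl
  have hV1 : ∀ j, V 1 j = -y j := fun j => rfl
  have hU0 : ∀ j, U j 0 = φ j := fun j => rfl
  have hU1 : ∀ j, U j 1 = φ' j := fun j => rfl
  have key : ∀ (k l : Fin 2) (v w : Fin N → ℂ), (∀ j, V k j = -v j) → (∀ j, U j l = w j) →
      (V * M⁻¹ * U) k l = -(v ⬝ᵥ M⁻¹.mulVec w) := by
    intro k l v w h1 h2
    rw [Matrix.mul_assoc, Matrix.mul_apply, dotProduct, ← Finset.sum_neg_distrib]
    refine Finset.sum_congr rfl fun j _ => ?_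
    rw [h1, neg_mul, Matrix.mul_apply, Matrix.mulVec, dotProduct]
    simp only [h2]
  rw [e, Matrix.det_add_mul U V hM.isUnit, Matrix.det_fin_two]
  simp only [Matrix.add_apply, key 0 0 x φ hV0 hU0, key 0 1 x φ' hV0 hU1, key 1 0 y φ hV1 hU0,
    key 1 1 y φ' hV1 hU1, Matrix.one_apply_eq]
  rw [Matrix.one_apply_ne (by decide), Matrix.one_apply_ne (by decide)]
  ring

/-- The bilinear identity behind the Toda-type equations, for rank-one updates of a matrix. -/
theorem det_bilinear_identity (M : Matrix (Fin N) (Fin N) ℂ) (φ φ' ψ ψ' : Fin N → ℂ) (a b : ℂ) :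
    ((M - Matrix.vecMulVec φ (ψ' + b • ψ) - Matrix.vecMulVec (φ' - a • φ) (ψ' + b • ψ)).det
        - (M - Matrix.vecMulVec φ (ψ' + b • ψ)).det) * (M - Matrix.vecMulVec φ (ψ' + a • ψ)).det
      - (M - Matrix.vecMulVec φ (ψ' + b • ψ)).det *
        ((M - Matrix.vecMulVec φ (ψ' + a • ψ)
            - Matrix.vecMulVec (φ' - b • φ) (ψ' + a • ψ)).det
          - (M - Matrix.vecMulVec φ (ψ' + a • ψ)).det)
      = (a - b) * ((M - Matrix.vecMulVec φ (ψ' + (a + b) • ψ) + Matrix.vecMulVec φ' ψ).det * M.det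
          - (M - Matrix.vecMulVec φ (ψ' + b • ψ)).det
            * (M - Matrix.vecMulVec φ (ψ' + a • ψ)).det) := by
  refine eq_of_forall_det_ne_zero
    (f := fun M =>
      ((M - Matrix.vecMulVec φ (ψ' + b • ψ) - Matrix.vecMulVec (φ' - a • φ) (ψ' + b • ψ)).det
          - (M - Matrix.vecMulVec φ (ψ' + b • ψ)).det) * (M - Matrix.vecMulVec φ (ψ' + a • ψ)).det
        - (M - Matrix.vecMulVec φ (ψ' + b • ψ)).det *
          ((M - Matrix.vecMulVec φ (ψ' + a • ψ)
              - Matrix.vecMulVec (φ' - b • φ) (ψ' + a • ψ)).det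
            - (M - Matrix.vecMulVec φ (ψ' + a • ψ)).det))
    (g := fun M => (a - b) *
      ((M - Matrix.vecMulVec φ (ψ' + (a + b) • ψ) + Matrix.vecMulVec φ' ψ).det * M.det
          - (M - Matrix.vecMulVec φ (ψ' + b • ψ)).det
            * (M - Matrix.vecMulVec φ (ψ' + a • ψ)).det)) ?_ ?_ ?_ M
  · fun_prop
  · fun_prop
  -- For invertible `M` every determinant is `det M` times a polynomial in the four numbers `ψ M⁻¹
  -- φ`, `ψ M⁻¹ φ'`, `ψ' M⁻¹ φ`, `ψ' M⁻¹ φ'`, and the identity is one of polynomials.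
  · intro M hM
    have h0 : ∀ x, (M - Matrix.vecMulVec φ x).det = M.det * (1 - x ⬝ᵥ M⁻¹.mulVec φ) := fun x => by
      simpa using det_sub_vecMulVec_sub_vecMulVec hM φ φ' x 0
    have h1 : ∀ x (c : ℂ), M - Matrix.vecMulVec φ x - Matrix.vecMulVec (φ' - c • φ) x
        = M - Matrix.vecMulVec φ ((1 - c) • x) - Matrix.vecMulVec φ' x := fun x c => by
      rw [Matrix.sub_vecMulVec, Matrix.smul_vecMulVec, Matrix.vecMulVec_smul]
      module
    have h2 : ∀ x, M - Matrix.vecMulVec φ x + Matrix.vecMulVec φ' ψ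
        = M - Matrix.vecMulVec φ x - Matrix.vecMulVec φ' (-ψ) := fun x => by
      rw [Matrix.vecMulVec_neg, sub_neg_eq_add]
    simp only [h1, h2, h0, det_sub_vecMulVec_sub_vecMulVec hM, add_dotProduct, smul_dotProduct,
      neg_dotProduct, smul_eq_mul]
    ring

/-- Along a rank-one direction the determinant is affine, so its derivative equals a finite
difference. This is why `flowDet` can be defined without differentiation. -/
theorem det_add_smul_vecMulVec (M : Matrix (Fin N) (Fin N) ℂ) (u v : Fin N → ℂ) (ε : ℂ) :
    (M + ε • Matrix.vecMulVec u v).det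
      = M.det + ε * ((M + Matrix.vecMulVec u v).det - M.det) := by
  refine eq_of_forall_det_ne_zero (f := fun M => (M + ε • Matrix.vecMulVec u v).det)
    (g := fun M => M.det + ε * ((M + Matrix.vecMulVec u v).det - M.det)) ?_ ?_ ?_ M
  · fun_prop
  · fun_prop
  · intro M hM
    have h : ∀ x, M + Matrix.vecMulVec u x
        = M - Matrix.vecMulVec u (-x) - Matrix.vecMulVec u 0 := fun x => by
      rw [Matrix.vecMulVec_neg]; simp
    rw [← Matrix.vecMulVec_smul]
    simp only [h, det_sub_vecMulVec_sub_vecMulVec hM, neg_dotProduct, smul_dotProduct,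
      zero_dotProduct, smul_eq_mul]
    ring

theorem contDiff_det {n : WithTop ℕ∞} :
    ContDiff ℂ n (fun M : Fin N → Fin N → ℂ => (Matrix.of M).det) := by
  simp only [Matrix.det_apply, Matrix.of_apply]
  fun_prop

/-- The derivative of a determinant in a direction which is the sum of a rank-one matrix and a
multiple of the matrix itself. -/
theorem hasDerivAt_det {M : ℝ → Matrix (Fin N) (Fin N) ℂ} {y : ℝ} {u v : Fin N → ℂ} {c d : ℂ}
    (h : ∀ i j, HasDerivAt (fun z => M z i j) ((c • Matrix.vecMulVec u v + d • M y) i j) y) :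
    HasDerivAt (fun z => (M z).det)
      (c * ((M y + Matrix.vecMulVec u v).det - (M y).det) + d * (N * (M y).det)) y := by
  set D : (Fin N → Fin N → ℂ) → ℂ := fun M => (Matrix.of M).det with hD
  have hdiff : ∀ K, HasFDerivAt D (fderiv ℂ D K) K := fun K =>
    ((contDiff_det (n := 1)).differentiable (by norm_num)).differentiableAt.hasFDerivAt
  set F : Matrix (Fin N) (Fin N) ℂ → Fin N → Fin N → ℂ := fun K i j => K i j with hF
  have hdir : ∀ E : Matrix (Fin N) (Fin N) ℂ,
      HasDerivAt (fun ε : ℂ => (M y + ε • E).det) (fderiv ℂ D (F (M y)) (F E)) 0 := by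
    intro E
    have h1 : HasDerivAt (fun ε : ℂ => F (M y) + ε • F E) (F E) 0 := by
      simpa using ((hasDerivAt_id (0 : ℂ)).smul_const (F E)).const_add (F (M y))
    have h2 : HasFDerivAt D (fderiv ℂ D (F (M y))) (F (M y) + (0 : ℂ) • F E) := by
      rw [zero_smul, add_zero]; exact hdiff _
    exact h2.comp_hasDerivAt 0 h1
  have h1 : fderiv ℂ D (F (M y)) (F (Matrix.vecMulVec u v))
      = (M y + Matrix.vecMulVec u v).det - (M y).det := by
    refine (hdir (Matrix.vecMulVec u v)).unique ?_
    simp only [det_add_smul_vecMulVec]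
    simpa using ((hasDerivAt_id (0 : ℂ)).mul_const
      ((M y + Matrix.vecMulVec u v).det - (M y).det)).const_add (M y).det
  -- Euler's relation: the determinant is homogeneous of degree `N`.
  have h2 : fderiv ℂ D (F (M y)) (F (M y)) = N * (M y).det := by
    refine (hdir (M y)).unique ?_
    have : (fun ε : ℂ => (M y + ε • M y).det) = fun ε => (1 + ε) ^ N * (M y).det := by
      funext ε
      have e : M y + ε • M y = (1 + ε) • M y := by module
      rw [e, Matrix.det_smul, Fintype.card_fin]
    rw [this]
    have := (((hasDerivAt_id (0 : ℂ)).const_add 1).fun_pow N).mul_const (M y).det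
    simpa using this
  have hM : HasDerivAt (fun z => F (M z)) (c • F (Matrix.vecMulVec u v) + d • F (M y)) y :=
    hasDerivAt_pi.mpr fun i => hasDerivAt_pi.mpr fun j => h i j
  refine (((hdiff (F (M y))).restrictScalars ℝ).comp_hasDerivAt y hM).congr_deriv ?_
  rw [ContinuousLinearMap.coe_restrictScalars', map_add, map_smul, map_smul, smul_eq_mul,
    smul_eq_mul, h1, h2]

end DeterminantCalculus

/-! ### Rank-one flows and the Toda-type identity -/

section Flow

variable (N : ℕ)

/-- Multiplication by `X(κ) + Y(λ)` turns the generating kernel into the product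
`R₁(κ) R₂(λ)`. -/
def IsRankOneFlow (X Y R₁ R₂ : PowerSeries ℂ) : Prop :=
  ∀ A B : PowerSeries ℂ, pairing N (X * A) B + pairing N A (Y * B)
    = Matrix.vecMulVec (oddVec N (R₁ * A)) (oddVec N (R₂ * B))

/-- The derivative of the determinant of `pairing N A B` along a flow of rank one. -/
noncomputable def flowDet (X Y A B : PowerSeries ℂ) : ℂ :=
  (pairing N A B + (pairing N (X * A) B + pairing N A (Y * B))).det - (pairing N A B).det

variable {N}

theorem det_pairing_C_mul (c d : ℂ) (A B : PowerSeries ℂ) :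
    (pairing N (PowerSeries.C c * A) (PowerSeries.C d * B)).det
      = (c * d) ^ N * (pairing N A B).det := by
  rw [pairing_C_mul_left, pairing_C_mul_right, smul_smul, Matrix.det_smul, Fintype.card_fin]

theorem flowDet_C_mul (X Y : PowerSeries ℂ) (c d : ℂ) (A B : PowerSeries ℂ) :
    flowDet N X Y (PowerSeries.C c * A) (PowerSeries.C d * B)
      = (c * d) ^ N * flowDet N X Y A B := by
  rw [flowDet, flowDet, mul_sub, det_pairing_C_mul]
  congr 1
  rw [mul_left_comm X, mul_left_comm Y]
  simp only [pairing_C_mul_left, pairing_C_mul_right]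
  have := Matrix.det_smul (pairing N A B + (pairing N (X * A) B + pairing N A (Y * B))) (c * d)
  rw [Fintype.card_fin] at this
  rw [← this]
  congr 1
  module

/-- The rank-one property turns multiplication of `A` by `X - a` into minus multiplication of `B` by
`Y + a`, up to a rank-one matrix. Hence every determinant here is, up to sign, that of `M = pairing
N A ((Y + a)(Y + b) B)` after rank-one updates, and `det_bilinear_identity` applies. -/
theorem toda_identity {X Y R₁ R₂ : PowerSeries ℂ} (h : IsRankOneFlow N X Y R₁ R₂) (a b : ℂ)
    (A B : PowerSeries ℂ) :
    flowDet N X Y ((X - PowerSeries.C a) * A) ((Y + PowerSeries.C b) * B)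
        * (pairing N ((X - PowerSeries.C b) * A) ((Y + PowerSeries.C a) * B)).det
      - (pairing N ((X - PowerSeries.C a) * A) ((Y + PowerSeries.C b) * B)).det
        * flowDet N X Y ((X - PowerSeries.C b) * A) ((Y + PowerSeries.C a) * B)
      = (a - b) * ((pairing N ((X - PowerSeries.C a) * ((X - PowerSeries.C b) * A)) B).det
            * (pairing N A ((Y + PowerSeries.C a) * ((Y + PowerSeries.C b) * B))).det
          - (pairing N ((X - PowerSeries.C a) * A) ((Y + PowerSeries.C b) * B)).det
            * (pairing N ((X - PowerSeries.C b) * A) ((Y + PowerSeries.C a) * B)).det) := by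
  set M := pairing N A ((Y + PowerSeries.C a) * ((Y + PowerSeries.C b) * B)) with hM
  set φ := oddVec N (R₁ * A) with hφ
  set φ' := oddVec N (R₁ * (X * A)) with hφ'
  set ψ := oddVec N (R₂ * B) with hψ
  set ψ' := oddVec N (R₂ * (Y * B)) with hψ'
  have hR : ∀ c : ℂ, oddVec N (R₂ * ((Y + PowerSeries.C c) * B)) = ψ' + c • ψ := fun c => by
    rw [show R₂ * ((Y + PowerSeries.C c) * B) = R₂ * (Y * B) + PowerSeries.C c * (R₂ * B) by ring,
      oddVec_add, oddVec_C_mul]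
  have hL : ∀ c : ℂ, oddVec N (R₁ * ((X - PowerSeries.C c) * A)) = φ' - c • φ := fun c => by
    rw [show R₁ * ((X - PowerSeries.C c) * A) = R₁ * (X * A) - PowerSeries.C c * (R₁ * A) by ring,
      oddVec_sub, oddVec_C_mul]
  have hstep : ∀ (c : ℂ) (A B : PowerSeries ℂ), pairing N ((X - PowerSeries.C c) * A) B
      = -(pairing N A ((Y + PowerSeries.C c) * B)
          - Matrix.vecMulVec (oddVec N (R₁ * A)) (oddVec N (R₂ * B))) := fun c A B => by
    rw [← h A B, sub_mul, add_mul, pairing_sub_left, pairing_add_right, pairing_C_mul_left,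
      pairing_C_mul_right]
    abel
  have ea : pairing N ((X - PowerSeries.C a) * A) ((Y + PowerSeries.C b) * B)
      = -(M - Matrix.vecMulVec φ (ψ' + b • ψ)) := by rw [hstep, hR]
  have eb : pairing N ((X - PowerSeries.C b) * A) ((Y + PowerSeries.C a) * B)
      = -(M - Matrix.vecMulVec φ (ψ' + a • ψ)) := by rw [hstep, hR, mul_left_comm]
  have eab : pairing N ((X - PowerSeries.C a) * ((X - PowerSeries.C b) * A)) B
      = M - Matrix.vecMulVec φ (ψ' + (a + b) • ψ) + Matrix.vecMulVec φ' ψ := by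
    rw [hstep, eb, hL, Matrix.sub_vecMulVec, Matrix.smul_vecMulVec, Matrix.vecMulVec_add,
      Matrix.vecMulVec_add, Matrix.vecMulVec_smul, Matrix.vecMulVec_smul]
    module
  have fa : flowDet N X Y ((X - PowerSeries.C a) * A) ((Y + PowerSeries.C b) * B)
      = (-1) ^ N * ((M - Matrix.vecMulVec φ (ψ' + b • ψ)
          - Matrix.vecMulVec (φ' - a • φ) (ψ' + b • ψ)).det
        - (M - Matrix.vecMulVec φ (ψ' + b • ψ)).det) := by
    rw [flowDet, h, hL, hR, ea, mul_sub]
    have := Matrix.det_neg (M - Matrix.vecMulVec φ (ψ' + b • ψ)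
          - Matrix.vecMulVec (φ' - a • φ) (ψ' + b • ψ))
    have h2 := Matrix.det_neg (M - Matrix.vecMulVec φ (ψ' + b • ψ))
    rw [Fintype.card_fin] at this h2
    rw [← this, ← h2]
    congr 2
    abel
  have fb : flowDet N X Y ((X - PowerSeries.C b) * A) ((Y + PowerSeries.C a) * B)
      = (-1) ^ N * ((M - Matrix.vecMulVec φ (ψ' + a • ψ)
          - Matrix.vecMulVec (φ' - b • φ) (ψ' + a • ψ)).det
        - (M - Matrix.vecMulVec φ (ψ' + a • ψ)).det) := by
    rw [flowDet, h, hL, hR, eb, mul_sub]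
    have := Matrix.det_neg (M - Matrix.vecMulVec φ (ψ' + a • ψ)
          - Matrix.vecMulVec (φ' - b • φ) (ψ' + a • ψ))
    have h2 := Matrix.det_neg (M - Matrix.vecMulVec φ (ψ' + a • ψ))
    rw [Fintype.card_fin] at this h2
    rw [← this, ← h2]
    congr 2
    abel
  -- Each matrix carrying a single shift differs from an update of `M` by the sign `-1`; these signs
  -- occur in pairs.
  have hs : ((-1 : ℂ) ^ N) * (-1) ^ N = 1 := by rw [← mul_pow]; norm_num
  rw [fa, fb, ea, eb, eab, Matrix.det_neg, Matrix.det_neg, Fintype.card_fin]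
  linear_combination det_bilinear_identity M φ φ' ψ ψ' a b + hs * (
    ((M - Matrix.vecMulVec φ (ψ' + b • ψ) - Matrix.vecMulVec (φ' - a • φ) (ψ' + b • ψ)).det
        - (M - Matrix.vecMulVec φ (ψ' + b • ψ)).det) * (M - Matrix.vecMulVec φ (ψ' + a • ψ)).det
      - (M - Matrix.vecMulVec φ (ψ' + b • ψ)).det *
        ((M - Matrix.vecMulVec φ (ψ' + a • ψ)
            - Matrix.vecMulVec (φ' - b • φ) (ψ' + a • ψ)).det
          - (M - Matrix.vecMulVec φ (ψ' + a • ψ)).det)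
      + (a - b) * ((M - Matrix.vecMulVec φ (ψ' + b • ψ)).det
            * (M - Matrix.vecMulVec φ (ψ' + a • ψ)).det))

/-- The identity `toda_identity` for series normalized by constants. -/
theorem toda_identity_of_eq {X Y R₁ R₂ : PowerSeries ℂ} (h : IsRankOneFlow N X Y R₁ R₂) {a b : ℂ}
    {A Aa Ab Aab B Ba Bb Bab : PowerSeries ℂ} {ca cb da db : ℂ}
    (hca : ca ≠ 0) (hcb : cb ≠ 0) (hda : da ≠ 0) (hdb : db ≠ 0)
    (h1 : PowerSeries.C ca * Aa = (X - PowerSeries.C a) * A)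
    (h2 : PowerSeries.C cb * Ab = (X - PowerSeries.C b) * A)
    (h3 : PowerSeries.C ca * Aab = (X - PowerSeries.C a) * Ab)
    (k1 : PowerSeries.C db * Ba = (Y + PowerSeries.C b) * Bab)
    (k2 : PowerSeries.C da * Bb = (Y + PowerSeries.C a) * Bab)
    (k3 : PowerSeries.C da * B = (Y + PowerSeries.C a) * Ba) :
    flowDet N X Y Aa Ba * (pairing N Ab Bb).det - (pairing N Aa Ba).det * flowDet N X Y Ab Bb
      = (a - b) * ((pairing N Aab Bab).det * (pairing N A B).det
          - (pairing N Aa Ba).det * (pairing N Ab Bb).det) := by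
  have key := toda_identity h a b A Bab
  have e1 : (X - PowerSeries.C a) * ((X - PowerSeries.C b) * A)
      = PowerSeries.C (ca * cb) * Aab := by
    rw [map_mul]
    linear_combination -(X - PowerSeries.C a) * h2 - PowerSeries.C cb * h3
  have e2 : (Y + PowerSeries.C a) * ((Y + PowerSeries.C b) * Bab)
      = PowerSeries.C (da * db) * B := by
    rw [map_mul]
    linear_combination -(Y + PowerSeries.C a) * k1 - PowerSeries.C db * k3
  have e3 : ∀ (c : ℂ) (F G : PowerSeries ℂ), (pairing N (PowerSeries.C c * F) G).det
      = c ^ N * (pairing N F G).det := fun c F G => by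
    simpa using det_pairing_C_mul c 1 F G
  have e4 : ∀ (c : ℂ) (F G : PowerSeries ℂ), (pairing N F (PowerSeries.C c * G)).det
      = c ^ N * (pairing N F G).det := fun c F G => by
    simpa using det_pairing_C_mul 1 c F G
  rw [e1, e2, ← h1, ← h2, ← k1, ← k2, e3 (ca * cb), e4 (da * db), flowDet_C_mul, flowDet_C_mul,
    det_pairing_C_mul,
    det_pairing_C_mul] at key
  -- Schur series have constant term one, whereas the symbols `X - a`, `Y + b` do not. Each term of
  -- the identity carries the same power of the normalizing constants.
  have hne : (ca * cb * da * db) ^ N ≠ 0 := by positivity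
  apply mul_left_cancel₀ hne
  simp only [mul_pow] at key ⊢
  linear_combination key

end Flow

/-! ### Derivatives of the determinants along flows -/

section Derivative

variable {N : ℕ}

theorem hasDerivAt_coeff_schurSeries_mul {x : ℝ → ℕ → ℂ} {x' : ℕ → ℂ} {y : ℝ}
    (h : ∀ r, HasDerivAt (fun z => x z r) (x' r) y) (F : PowerSeries ℂ) (j : ℕ) :
    HasDerivAt (fun z => PowerSeries.coeff j (schurSeries (x z) * F))
      (PowerSeries.coeff j (varSeries x' * schurSeries (x y) * F)) y := by
  simp only [PowerSeries.coeff_mul j]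
  exact HasDerivAt.fun_sum fun p _ => (hasDerivAt_schur h p.1).mul_const _

theorem hasDerivAt_pairing {x w : ℝ → ℕ → ℂ} {x' w' : ℕ → ℂ} {y : ℝ}
    (hx : ∀ r, HasDerivAt (fun z => x z r) (x' r) y)
    (hw : ∀ r, HasDerivAt (fun z => w z r) (w' r) y) (i j : Fin N) :
    HasDerivAt (fun z => pairing N (schurSeries (x z)) (schurSeries (w z)) i j)
      ((pairing N (varSeries x' * schurSeries (x y)) (schurSeries (w y))
        + pairing N (schurSeries (x y)) (varSeries w' * schurSeries (w y))) i j) y := by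
  simp only [pairing, ← Finset.sum_add_distrib, Matrix.sum_apply, Matrix.add_apply,
    Matrix.vecMulVec_apply, oddVec]
  exact HasDerivAt.fun_sum fun γ _ => (hasDerivAt_coeff_schurSeries_mul hx _ _).fun_mul
    (hasDerivAt_coeff_schurSeries_mul hw _ _)

/-- The constants `d`, `d'` rescale the matrix as a whole, so they contribute only a multiple of the
determinant, which drops out of Wronskians. -/
theorem hasDerivAt_det_pairing {X Y R₁ R₂ : PowerSeries ℂ} (h : IsRankOneFlow N X Y R₁ R₂)
    {x w : ℝ → ℕ → ℂ} {x' w' : ℕ → ℂ} {y : ℝ} {c d d' : ℂ}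
    (hx : ∀ r, HasDerivAt (fun z => x z r) (x' r) y)
    (hw : ∀ r, HasDerivAt (fun z => w z r) (w' r) y)
    (hx' : varSeries x' = PowerSeries.C c * X + PowerSeries.C d)
    (hw' : varSeries w' = PowerSeries.C c * Y + PowerSeries.C d') :
    HasDerivAt (fun z => (pairing N (schurSeries (x z)) (schurSeries (w z))).det)
      (c * flowDet N X Y (schurSeries (x y)) (schurSeries (w y))
        + (d + d') * (N * (pairing N (schurSeries (x y)) (schurSeries (w y))).det)) y := by
  rw [flowDet, h]
  refine hasDerivAt_det fun i j => ?_
  refine (hasDerivAt_pairing hx hw i j).congr_deriv ?_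
  refine congrFun (congrFun (?_ : (_ : Matrix (Fin N) (Fin N) ℂ) = _) i) j
  rw [← h (schurSeries (x y)) (schurSeries (w y)), hx', hw']
  simp only [add_mul, pairing_add_left, pairing_add_right, mul_assoc,
    pairing_C_mul_left, pairing_C_mul_right]
  module

end Derivative

/-! ### The flows used for `x` and `t` -/

section ConcreteFlows

variable {N : ℕ}

theorem IsRankOneFlow.add_const {X Y R₁ R₂ : PowerSeries ℂ} (h : IsRankOneFlow N X Y R₁ R₂)
    (c : ℂ) : IsRankOneFlow N (X + PowerSeries.C c) (Y - PowerSeries.C c) R₁ R₂ := fun A B => by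
  rw [← h A B, add_mul, sub_mul, pairing_add_left, pairing_sub_right, pairing_C_mul_left,
    pairing_C_mul_right]
  abel

/-- `1/X + 1/Y = (X + Y)/(X Y)`, so inverting both symbols keeps the rank equal to one. The `t`-flow
arises in this way from the `x`-flow. -/
theorem IsRankOneFlow.inverse {X Y R₁ R₂ X' Y' : PowerSeries ℂ} (h : IsRankOneFlow N X Y R₁ R₂)
    (hX : X * X' = 1) (hY : Y * Y' = 1) : IsRankOneFlow N X' Y' (R₁ * X') (R₂ * Y') := fun A B => by
  have h1 := h (X' * A) (Y' * B)
  rw [← mul_assoc, ← mul_assoc Y, hX, hY, one_mul, one_mul] at h1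
  rw [mul_assoc, mul_assoc, ← h1, add_comm]

theorem isRankOneFlow_exp : IsRankOneFlow N (PowerSeries.exp ℂ) (PowerSeries.exp ℂ)
    (PowerSeries.C (1 / 2) * (PowerSeries.exp ℂ + 1)) (PowerSeries.exp ℂ + 1) := fun A B => by
  rw [pairing_exp_mul, mul_assoc, oddVec_C_mul, Matrix.smul_vecMulVec]

theorem isRankOneFlow_specSeries (σ ρ₁ ρ₂ : ℝ) :
    IsRankOneFlow N (specSeries σ ρ₁ ρ₂) (specSeries σ ρ₁ ρ₂)
      (PowerSeries.C (rhoHat σ ρ₁ ρ₂ : ℂ) * (PowerSeries.C (1 / 2) * (PowerSeries.exp ℂ + 1)))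
      (PowerSeries.exp ℂ + 1) := fun A B => by
  rw [specSeries, mul_assoc, mul_assoc, mul_assoc, oddVec_C_mul, pairing_C_mul_left,
    pairing_C_mul_right, ← smul_add, isRankOneFlow_exp, Matrix.smul_vecMulVec]

/-- The power series of `e^{-κ}`. -/
noncomputable def expNeg : PowerSeries ℂ := PowerSeries.evalNegHom (PowerSeries.exp ℂ)

theorem exp_mul_expNeg : PowerSeries.exp ℂ * expNeg = 1 := PowerSeries.exp_mul_exp_neg_eq_one

theorem coeff_expNeg (j : ℕ) :
    PowerSeries.coeff j expNeg = (-1) ^ j * PowerSeries.coeff j (PowerSeries.exp ℂ) := by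
  rw [expNeg, PowerSeries.evalNegHom, PowerSeries.coeff_rescale]

theorem isEvenSeries_exp_add_expNeg : IsEvenSeries (PowerSeries.exp ℂ + expNeg) := fun j hj => by
  rw [map_add, coeff_expNeg, hj.neg_one_pow]; ring

theorem IsEvenSeries.add {e e' : PowerSeries ℂ} (h : IsEvenSeries e) (h' : IsEvenSeries e') :
    IsEvenSeries (e + e') := fun j hj => by rw [map_add, h j hj, h' j hj, add_zero]

theorem IsEvenSeries.C_mul {e : PowerSeries ℂ} (h : IsEvenSeries e) (c : ℂ) :
    IsEvenSeries (PowerSeries.C c * e) := fun j hj => by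
  rw [PowerSeries.coeff_C_mul, h j hj, mul_zero]

theorem isEvenSeries_C (c : ℂ) : IsEvenSeries (PowerSeries.C c) := fun j hj => by
  rw [PowerSeries.coeff_C, if_neg]; rintro rfl; simp at hj

end ConcreteFlows

/-! ### Absence of zeros -/

section Nonvanishing

variable {N : ℕ}

/-- Sandwiching the hypothesis between `w*` and `w` gives `r |v* w|² = 0`; applying it to `w` then
leaves `W* w = 0`. -/
theorem mulVec_eq_zero_of_conjTranspose_add {W : Matrix (Fin N) (Fin N) ℂ} {v w : Fin N → ℂ} {r : ℂ}
    (hr : r ≠ 0) (h : W + W.conjTranspose = r • Matrix.vecMulVec v (star v))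
    (hw : W.mulVec w = 0) : star v ⬝ᵥ w = 0 ∧ W.conjTranspose.mulVec w = 0 := by
  have h1 : star w ⬝ᵥ W.mulVec w = 0 := by rw [hw, dotProduct_zero]
  have h2 : star w ⬝ᵥ W.conjTranspose.mulVec w = 0 := by
    rw [Matrix.dotProduct_mulVec, Matrix.vecMul_conjTranspose, star_star, hw, star_zero,
      zero_dotProduct]
  have h3 := congrArg (fun M => star w ⬝ᵥ M.mulVec w) h
  simp only [Matrix.add_mulVec, dotProduct_add, h1, h2, Matrix.smul_mulVec,
    Matrix.vecMulVec_mulVec, dotProduct_smul, add_zero] at h3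
  have h4 : star v ⬝ᵥ w = 0 := by
    have e : star w ⬝ᵥ v = star (star v ⬝ᵥ w) := by
      rw [Matrix.star_dotProduct]
    rw [e] at h3
    simpa [hr] using h3.symm
  refine ⟨h4, ?_⟩
  have h5 := congrArg (fun M => M.mulVec w) h
  simp only [Matrix.add_mulVec, hw, zero_add, Matrix.smul_mulVec, Matrix.vecMulVec_mulVec,
    h4] at h5
  simpa using h5

theorem conjSeries_expNeg : conjSeries expNeg = expNeg := by
  have h := congrArg conjSeries exp_mul_expNeg
  rw [map_mul, conjSeries_exp, map_one] at h
  have h2 := exp_mul_expNeg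
  linear_combination expNeg * h - conjSeries expNeg * h2

theorem conjSeries_conjSeries (H : PowerSeries ℂ) : conjSeries (conjSeries H) = H := by
  ext j; simp

theorem constantCoeff_conjSeries (H : PowerSeries ℂ) :
    PowerSeries.constantCoeff (conjSeries H) = conj (PowerSeries.constantCoeff H) := by
  rw [← PowerSeries.coeff_zero_eq_constantCoeff_apply, PowerSeries.coeff_map,
    PowerSeries.coeff_zero_eq_constantCoeff_apply]

/-- The rank-one flow makes `W + W*` a multiple of `v v*`. This form is only semidefinite, so it
does not settle invertibility; it does constrain a kernel vector `w`. Commuting with the even series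
`e^κ + e^{-κ}` then shows that `ker W` is invariant under an upper triangular matrix with a single
Jordan block, so a nonzero kernel would contain the first basis vector, which is impossible. -/
theorem det_pairing_conj_ne_zero {σ ρ₁ ρ₂ : ℝ} (hρ : Admissible σ ρ₁ ρ₂) {c : ℝ} (hc : c ≠ 0)
    {H : PowerSeries ℂ} (hH : PowerSeries.constantCoeff H ≠ 0) :
    (pairing N (shiftSeries σ ρ₁ ρ₂ c * H) (conjSeries H)).det ≠ 0 := by
  set W := pairing N (shiftSeries σ ρ₁ ρ₂ c * H) (conjSeries H) with hW
  set F := (PowerSeries.exp ℂ + 1) * conjSeries H with hF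
  have hr : (rhoHat σ ρ₁ ρ₂ : ℂ) * (1 / 2) ≠ 0 := by
    have : (rhoHat σ ρ₁ ρ₂ : ℂ) ≠ 0 := by exact_mod_cast hρ.rhoHat_pos.ne'
    simpa using this
  have hconj : conjSeries F = (PowerSeries.exp ℂ + 1) * H := by
    rw [hF, map_mul, map_add, conjSeries_exp, map_one, conjSeries_conjSeries]
  have hsum : W + W.conjTranspose = ((rhoHat σ ρ₁ ρ₂ : ℂ) * (1 / 2)) •
      Matrix.vecMulVec (oddVec N (conjSeries F)) (star (oddVec N (conjSeries F))) := by
    have h1 :=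
      (isRankOneFlow_specSeries (N := N) σ ρ₁ ρ₂).add_const (Complex.I * c) H (conjSeries H)
    have h2 : W.conjTranspose = pairing N H
        ((specSeries σ ρ₁ ρ₂ - PowerSeries.C (Complex.I * c)) * conjSeries H) := by
      rw [hW, conjTranspose_pairing, map_mul, conjSeries_shiftSeries, shiftSeries,
        conjSeries_conjSeries, Complex.ofReal_neg, mul_neg, map_neg, sub_eq_add_neg]
    rw [h2, hW, shiftSeries, h1, ← mul_assoc, ← map_mul, mul_assoc, oddVec_C_mul,
      Matrix.smul_vecMulVec, hconj, ← hF, conj_oddVec, ← hconj,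
      conjSeries_conjSeries]
  have hstar : star (oddVec N (conjSeries F)) = oddVec N F := by
    rw [conj_oddVec, conjSeries_conjSeries]
  have hker : ∀ w, W.mulVec w = 0 → oddVec N F ⬝ᵥ w = 0 ∧ W.conjTranspose.mulVec w = 0 :=
    fun w hw => by
      have := mulVec_eq_zero_of_conjTranspose_add hr hsum hw
      rwa [hstar] at this
  have hstep : ∀ w, W.mulVec w = 0 → oddVec N (expNeg * F) ⬝ᵥ w = 0 ∧
      W.mulVec ((evenMatrix N (PowerSeries.exp ℂ + expNeg)).transpose.mulVec w) = 0 := by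
    intro w hw
    obtain ⟨hv, hWw⟩ := hker w hw
    have hneg := (isRankOneFlow_exp (N := N)).inverse exp_mul_expNeg exp_mul_expNeg
    have e1 := isRankOneFlow_exp (N := N) (shiftSeries σ ρ₁ ρ₂ c * H) (conjSeries H)
    have e2 := hneg (shiftSeries σ ρ₁ ρ₂ c * H) (conjSeries H)
    have e3 := pairing_even_mul_left (N := N) isEvenSeries_exp_add_expNeg
      (shiftSeries σ ρ₁ ρ₂ c * H) (conjSeries H)
    have e4 := pairing_even_mul_right (N := N) isEvenSeries_exp_add_expNeg
      (shiftSeries σ ρ₁ ρ₂ c * H) (conjSeries H)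
    set Q := oddVec N (PowerSeries.C (1 / 2) * (PowerSeries.exp ℂ + 1) * expNeg *
      (shiftSeries σ ρ₁ ρ₂ c * H)) with hQ
    have e5 : (PowerSeries.exp ℂ + 1) * expNeg * conjSeries H = expNeg * F := by rw [hF]; ring
    have e6 : W.mulVec ((evenMatrix N (PowerSeries.exp ℂ + expNeg)).transpose.mulVec w)
        = (oddVec N (expNeg * F) ⬝ᵥ w) • Q := by
      rw [Matrix.mulVec_mulVec, ← e4]
      -- The flows of `e^κ` and `e^{-κ}` add up to a rank-two relation. Its left factor `e^κ +
      -- e^{-κ}` is even and acts as a matrix on `W`, which kills `w`.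
      have e7 : pairing N (shiftSeries σ ρ₁ ρ₂ c * H)
            ((PowerSeries.exp ℂ + expNeg) * conjSeries H)
          = Matrix.vecMulVec (oddVec N (PowerSeries.C (1 / 2) * (PowerSeries.exp ℂ + 1) *
              (shiftSeries σ ρ₁ ρ₂ c * H))) (oddVec N F)
            + Matrix.vecMulVec Q (oddVec N (expNeg * F))
            - evenMatrix N (PowerSeries.exp ℂ + expNeg) * W := by
        rw [← e3, ← e5, ← e2, hF, ← e1, add_mul, pairing_add_right, add_mul, pairing_add_left]
        abel
      rw [e7, Matrix.sub_mulVec, Matrix.add_mulVec, Matrix.vecMulVec_mulVec,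
        Matrix.vecMulVec_mulVec, hv, ← Matrix.mulVec_mulVec, hw, Matrix.mulVec_zero]
      simp
    -- Since also `W* w = 0`, the image of `W` is orthogonal to `w`.
    have e8 : star w ⬝ᵥ W.mulVec ((evenMatrix N (PowerSeries.exp ℂ + expNeg)).transpose.mulVec w)
        = 0 := by
      rw [Matrix.dotProduct_mulVec]
      have : Matrix.vecMul (star w) W = star (W.conjTranspose.mulVec w) := by
        rw [Matrix.star_mulVec, Matrix.conjTranspose_conjTranspose]
      rw [this, hWw, star_zero, zero_dotProduct]
    -- The conjugate series of `Q` is `ρ̂ F/2 - (ic/2) e^{-κ} F`, and `w` annihilates the `F` part.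
    -- With `e8` the squared modulus of the remaining pairing, times `c`, vanishes; here `c ≠ 0` is
    -- needed.
    have e9 : star Q ⬝ᵥ w = -(1 / 2) * (Complex.I * c) * (oddVec N (expNeg * F) ⬝ᵥ w) := by
      have : conjSeries (PowerSeries.C (1 / 2) * (PowerSeries.exp ℂ + 1) * expNeg *
          (shiftSeries σ ρ₁ ρ₂ c * H)) = PowerSeries.C ((1 / 2) * (rhoHat σ ρ₁ ρ₂ : ℂ)) * F
            + PowerSeries.C (-(1 / 2) * (Complex.I * c)) * (expNeg * F) := by
        have h2 := exp_mul_expNeg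
        rw [map_mul, map_mul, map_mul, map_mul, map_add, conjSeries_exp, map_one,
          conjSeries_expNeg, conjSeries_shiftSeries, PowerSeries.map_C, hF, shiftSeries,
          specSeries]
        have h3 : (starRingEnd ℂ) (1 / 2) = 1 / 2 := by rw [map_div₀, map_one, map_ofNat]
        rw [h3]
        simp only [map_mul, map_neg, Complex.ofReal_neg, mul_neg]
        linear_combination PowerSeries.C (1 / 2) * PowerSeries.C (rhoHat σ ρ₁ ρ₂ : ℂ)
          * (PowerSeries.exp ℂ + 1) * conjSeries H * h2
      rw [hQ, conj_oddVec, this, oddVec_add, oddVec_C_mul, oddVec_C_mul, add_dotProduct,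
        smul_dotProduct, smul_dotProduct, hv, smul_zero, zero_add, smul_eq_mul]
    have e10 : oddVec N (expNeg * F) ⬝ᵥ w = 0 := by
      rw [e6, dotProduct_smul, show star w ⬝ᵥ Q = star (star Q ⬝ᵥ w) by
        rw [Matrix.star_dotProduct], e9] at e8
      have hc' : (c : ℂ) ≠ 0 := by exact_mod_cast hc
      simpa [hc'] using e8
    refine ⟨e10, ?_⟩
    rw [e6, e10, zero_smul]
  -- Induction on the last index `m` at which a kernel vector may be nonzero.
  have hind : ∀ m : ℕ, ∀ w : Fin N → ℂ, (∀ j : Fin N, m < j → w j = 0) → W.mulVec w = 0 →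
      w = 0 := by
    intro m
    induction m with
    | zero =>
      intro w hsupp hw
      rcases Nat.eq_zero_or_pos N with rfl | hN
      · exact Subsingleton.elim _ _
      · by_contra hne
        have hw0 : w ⟨0, hN⟩ ≠ 0 := by
          intro h0
          apply hne
          funext j
          by_cases hj : (j : ℕ) = 0
          · rw [show j = ⟨0, hN⟩ from Fin.ext hj, h0]; rfl
          · exact hsupp j (Nat.pos_of_ne_zero hj)
        have hdot : ∀ G : PowerSeries ℂ, oddVec N G ⬝ᵥ w = PowerSeries.coeff 1 G * w ⟨0, hN⟩ := by
          intro G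
          rw [dotProduct, Finset.sum_eq_single ⟨0, hN⟩]
          · rfl
          · intro j _ hj
            rw [hsupp j (Nat.pos_of_ne_zero fun h => hj (Fin.ext h)), mul_zero]
          · simp
        -- If only the entry with index zero survives, the coefficients of `κ` in `F` and in `e^{-κ}
        -- F` both vanish. They differ by `F(0) = 2 conj (H(0))`, which is nonzero.
        have h1 := (hker w hw).1
        have h2 := (hstep w hw).1
        rw [hdot, mul_eq_zero, or_iff_left hw0] at h1 h2
        rw [PowerSeries.coeff_mul, Finset.Nat.sum_antidiagonal_eq_sum_range_succ_mk,
          Finset.sum_range_succ, Finset.sum_range_one] at h2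
        simp only [coeff_expNeg, Nat.sub_zero, h1, PowerSeries.coeff_exp, Nat.sub_self] at h2
        have h3 : PowerSeries.constantCoeff F ≠ 0 := by
          rw [hF, map_mul]
          have : PowerSeries.constantCoeff (conjSeries H) ≠ 0 := by
            rw [constantCoeff_conjSeries]
            exact (map_ne_zero _).mpr hH
          simp only [map_add, PowerSeries.constantCoeff_exp, map_one]
          exact mul_ne_zero (by norm_num) this
        simp [h3] at h2
    | succ m ih =>
      intro w hsupp hw
      set e := PowerSeries.exp ℂ + expNeg with he
      have he0 : PowerSeries.coeff 0 e = 2 := by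
        simp only [he, map_add, coeff_expNeg, PowerSeries.coeff_exp]; norm_num
      have he2 : PowerSeries.coeff 2 e = 1 := by
        simp only [he, map_add, coeff_expNeg, PowerSeries.coeff_exp]; norm_num
      have hT : ∀ j, (evenMatrix N e).transpose.mulVec w j
          = ∑ i : Fin N,
            (if (j : ℕ) ≤ i then PowerSeries.coeff (2 * ((i : ℕ) - j)) e else 0) * w i :=
        fun j => rfl
      have hw' : W.mulVec ((evenMatrix N e).transpose.mulVec w - (2 : ℂ) • w) = 0 := by
        rw [Matrix.mulVec_sub, (hstep w hw).2, Matrix.mulVec_smul, hw, smul_zero, sub_zero]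
      -- The matrix of `e^κ + e^{-κ} = 2 + κ² + …` minus `2` is strictly triangular, so it lowers
      -- the support and the induction hypothesis applies. The entry `m` of the result is then the
      -- entry `m + 1` of `w`, because the coefficient of `κ²` is one.
      have hz : (evenMatrix N e).transpose.mulVec w - (2 : ℂ) • w = 0 := by
        refine ih _ (fun j hj => ?_) hw'
        rw [Pi.sub_apply, hT, Finset.sum_eq_single j]
        · rw [if_pos le_rfl, Nat.sub_self, mul_zero, he0, Pi.smul_apply, smul_eq_mul, sub_self]
        · intro i _ hij
          by_cases hji : (j : ℕ) ≤ i
          · have : (j : ℕ) ≠ i := fun h => hij (Fin.ext h).symm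
            rw [hsupp i (by omega), mul_zero]
          · rw [if_neg hji, zero_mul]
        · simp
      refine ih w (fun j hj => ?_) hw
      by_cases hjm : (j : ℕ) = m + 1
      · have hm : m < N := by have := j.isLt; omega
        have h1 := congrFun hz ⟨m, hm⟩
        rw [Pi.sub_apply, hT, Finset.sum_eq_add_of_mem ⟨m, hm⟩ j (Finset.mem_univ _)
          (Finset.mem_univ _)] at h1
        · simp only [le_refl, if_true, Nat.sub_self, mul_zero, he0, hjm, Nat.le_succ,
            Nat.add_sub_cancel_left, mul_one, he2, one_mul, Pi.smul_apply, smul_eq_mul,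
            Pi.zero_apply, add_sub_cancel_left] at h1
          exact h1
        · intro h
          rw [Fin.ext_iff] at h
          simp at h; omega
        · intro i _ hi
          by_cases hji : m ≤ (i : ℕ)
          · have h2 : (i : ℕ) ≠ m := fun h => hi.1 (Fin.ext h)
            have h3 : (i : ℕ) ≠ j := fun h => hi.2 (Fin.ext h)
            rw [hsupp i (by omega), mul_zero]
          · rw [if_neg hji, zero_mul]
      · exact hsupp j (by omega)
  intro hdet
  obtain ⟨w, hw0, hw⟩ := Matrix.exists_mulVec_eq_zero_iff.mpr hdet
  exact hw0 (hind N w (fun j hj => absurd j.isLt (by omega)) hw)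

end Nonvanishing

/-! ### The determinants under shifts and conjugation -/

section TauFunctions

variable {σ ρ₁ ρ₂ : ℝ} {b : ℕ → ℂ} {x t : ℝ}

variable (σ ρ₁ ρ₂ b x t) in
/-- The generating series of the Schur polynomials of `x⁺(n, k, l)`. -/
noncomputable def plusSeries (n k l : ℤ) : PowerSeries ℂ :=
  schurSeries (genPlus σ ρ₁ ρ₂ b n k l x t)

variable (σ ρ₁ ρ₂ b x t) in
/-- The generating series of the Schur polynomials of `x⁻(n, k, l)`. -/
noncomputable def minusSeries (n k l : ℤ) : PowerSeries ℂ :=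
  schurSeries (genMinus σ ρ₁ ρ₂ b n k l x t)

theorem genTau_eq_det_pairing (N : ℕ) (n k l : ℤ) :
    genTau N σ ρ₁ ρ₂ b n k l x t
      = (pairing N (plusSeries σ ρ₁ ρ₂ b x t n k l) (minusSeries σ ρ₁ ρ₂ b x t n k l)).det :=
  schurDet_eq_det_pairing N _ _

theorem conjSeries_plusSeries (n k l : ℤ) :
    conjSeries (plusSeries σ ρ₁ ρ₂ b x t n k l)
      = minusSeries σ ρ₁ ρ₂ b x t (-1 - n) (-k) (-l) := by
  rw [plusSeries, minusSeries, conjSeries_schurSeries]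
  congr 1
  funext r
  exact conj_genPlus b n k l x t r

theorem minusSeries_eq (n k l : ℤ) : minusSeries σ ρ₁ ρ₂ b x t n k l
    = conjSeries (plusSeries σ ρ₁ ρ₂ b x t (-1 - n) (-k) (-l)) := by
  rw [conjSeries_plusSeries]
  congr 1 <;> ring

theorem conj_genTau (N : ℕ) (n k l : ℤ) :
    conj (genTau N σ ρ₁ ρ₂ b n k l x t) = genTau N σ ρ₁ ρ₂ b (-1 - n) (-k) (-l) x t := by
  rw [genTau_eq_det_pairing, genTau_eq_det_pairing, starRingEnd_apply, ← Matrix.det_conjTranspose,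
    conjTranspose_pairing, conjSeries_plusSeries, minusSeries_eq n, conjSeries_conjSeries]

theorem Admissible.plusSeries_n (h : Admissible σ ρ₁ ρ₂) (n k l : ℤ) :
    PowerSeries.C (rhoHat σ ρ₁ ρ₂ + Complex.I * (rho σ ρ₁ ρ₂ : ℝ))
        * plusSeries σ ρ₁ ρ₂ b x t (n + 1) k l
      = shiftSeries σ ρ₁ ρ₂ (rho σ ρ₁ ρ₂) * plusSeries σ ρ₁ ρ₂ b x t n k l := by
  rw [plusSeries, genPlus_n_succ, schurSeries_add, ← h.schurSeries_thetaCoeff, plusSeries]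
  ring

theorem Admissible.plusSeries_k (h : Admissible σ ρ₁ ρ₂) (n k l : ℤ) :
    PowerSeries.C (rhoHat σ ρ₁ ρ₂ + Complex.I * (σ * ρ₁ * ρ₂ : ℝ))
        * plusSeries σ ρ₁ ρ₂ b x t n (k + 1) l
      = shiftSeries σ ρ₁ ρ₂ (σ * ρ₁ * ρ₂) * plusSeries σ ρ₁ ρ₂ b x t n k l := by
  rw [plusSeries, genPlus_k_succ, schurSeries_add, ← h.schurSeries_varthetaCoeff, plusSeries]
  ring

theorem plusSeries_l (n k l : ℤ) : plusSeries σ ρ₁ ρ₂ b x t n k (l + 1)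
    = PowerSeries.exp ℂ * plusSeries σ ρ₁ ρ₂ b x t n k l := by
  rw [plusSeries, genPlus_l_succ, schurSeries_add, schurSeries_zetaCoeff, plusSeries, mul_comm]

theorem Admissible.minusSeries_n (h : Admissible σ ρ₁ ρ₂) (n k l : ℤ) :
    PowerSeries.C (rhoHat σ ρ₁ ρ₂ - Complex.I * (rho σ ρ₁ ρ₂ : ℝ))
        * minusSeries σ ρ₁ ρ₂ b x t n k l
      = shiftSeries σ ρ₁ ρ₂ (-rho σ ρ₁ ρ₂) * minusSeries σ ρ₁ ρ₂ b x t (n + 1) k l := by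
  have := congrArg conjSeries (h.plusSeries_n (b := b) (x := x) (t := t) (-1 - (n + 1)) (-k) (-l))
  rw [map_mul, map_mul, PowerSeries.map_C, conjSeries_shiftSeries, ← minusSeries_eq,
    conjSeries_plusSeries] at this
  convert this using 2
  · simp [sub_eq_add_neg]
  · congr 1 <;> ring

theorem Admissible.minusSeries_k (h : Admissible σ ρ₁ ρ₂) (n k l : ℤ) :
    PowerSeries.C (rhoHat σ ρ₁ ρ₂ - Complex.I * (σ * ρ₁ * ρ₂ : ℝ))
        * minusSeries σ ρ₁ ρ₂ b x t n k l
      = shiftSeries σ ρ₁ ρ₂ (-(σ * ρ₁ * ρ₂)) * minusSeries σ ρ₁ ρ₂ b x t n (k + 1) l := by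
  have := congrArg conjSeries (h.plusSeries_k (b := b) (x := x) (t := t) (-1 - n) (-(k + 1)) (-l))
  rw [map_mul, map_mul, PowerSeries.map_C, conjSeries_shiftSeries, ← minusSeries_eq,
    conjSeries_plusSeries] at this
  convert this using 2
  · simp [sub_eq_add_neg]
  · congr 1 <;> ring

theorem minusSeries_l (n k l : ℤ) : minusSeries σ ρ₁ ρ₂ b x t n k l
    = PowerSeries.exp ℂ * minusSeries σ ρ₁ ρ₂ b x t n k (l + 1) := by
  have := congrArg conjSeries
    (plusSeries_l (σ := σ) (ρ₁ := ρ₁) (ρ₂ := ρ₂) (b := b) (x := x) (t := t)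
      (-1 - n) (-k) (-(l + 1)))
  rw [map_mul, conjSeries_exp, ← minusSeries_eq, conjSeries_plusSeries] at this
  rw [← this]
  congr 1 <;> ring

theorem ofReal_sub_I_mul_ne_zero {a : ℝ} (ha : 0 < a) (b : ℝ) : (a : ℂ) - Complex.I * b ≠ 0 := by
  simpa [sub_eq_add_neg] using ofReal_add_I_mul_ne_zero ha (-b)

/-- The product is `ρ̂² e^κ - c d e^{-κ}` plus a constant, even exactly because of the hypothesis.
-/
theorem isEvenSeries_expNeg_mul {c d : ℝ} (h : rhoHat σ ρ₁ ρ₂ ^ 2 = -(c * d)) :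
    IsEvenSeries (expNeg * (shiftSeries σ ρ₁ ρ₂ c * shiftSeries σ ρ₁ ρ₂ d)) := by
  have h1 := exp_mul_expNeg
  have h2 : (Complex.I * c) * (Complex.I * d) = (rhoHat σ ρ₁ ρ₂ : ℂ) ^ 2 := by
    have : (rhoHat σ ρ₁ ρ₂ : ℂ) ^ 2 = -((c : ℂ) * d) := by exact_mod_cast h
    rw [this]
    linear_combination (c : ℂ) * d * Complex.I_sq
  have h3 : PowerSeries.C (Complex.I * c) * PowerSeries.C (Complex.I * d)
      = PowerSeries.C (rhoHat σ ρ₁ ρ₂ : ℂ) * PowerSeries.C (rhoHat σ ρ₁ ρ₂ : ℂ) := by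
    rw [← map_mul, h2, ← map_mul, sq]
  have : expNeg * (shiftSeries σ ρ₁ ρ₂ c * shiftSeries σ ρ₁ ρ₂ d)
      = PowerSeries.C ((rhoHat σ ρ₁ ρ₂ : ℂ) * rhoHat σ ρ₁ ρ₂) * (PowerSeries.exp ℂ + expNeg)
        + PowerSeries.C ((rhoHat σ ρ₁ ρ₂ : ℂ) * (Complex.I * c + Complex.I * d)) := by
    simp only [shiftSeries, specSeries, map_mul (PowerSeries.C (R := ℂ)) (rhoHat σ ρ₁ ρ₂ : ℂ),
      map_add]
    linear_combination expNeg * h3 + (PowerSeries.C (rhoHat σ ρ₁ ρ₂ : ℂ) ^ 2 * PowerSeries.exp ℂ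
      + PowerSeries.C (rhoHat σ ρ₁ ρ₂ : ℂ) * (PowerSeries.C (Complex.I * c)
        + PowerSeries.C (Complex.I * d))) * h1
  rw [this]
  exact (isEvenSeries_exp_add_expNeg.C_mul _).add (isEvenSeries_C _)

theorem constantCoeff_expNeg : PowerSeries.constantCoeff expNeg = 1 := by
  rw [← PowerSeries.coeff_zero_eq_constantCoeff_apply, coeff_expNeg]; simp

/-- The shifts `n → n + 1`, `k → k + 1` together amount to the shift `l → l + 1`. -/
theorem Admissible.genTau_succ_succ (h : Admissible σ ρ₁ ρ₂) (N : ℕ) (n k l : ℤ) :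
    genTau N σ ρ₁ ρ₂ b (n + 1) (k + 1) l x t = genTau N σ ρ₁ ρ₂ b n k (l + 1) x t := by
  have hsq : rhoHat σ ρ₁ ρ₂ ^ 2 = -(rho σ ρ₁ ρ₂ * (σ * ρ₁ * ρ₂)) := by
    rw [h.rhoHat_sq, mul_eq_rho_sub_one]; ring
  -- On the plus side the two generating series differ by a normalized even factor. On the minus
  -- side the shifts act inversely and `c`, `d` change sign, which preserves the product `c d`.
  have key : ∀ {c d : ℝ} {F G : PowerSeries ℂ}, rhoHat σ ρ₁ ρ₂ ^ 2 = -(c * d) →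
      PowerSeries.C ((rhoHat σ ρ₁ ρ₂ + Complex.I * c) * (rhoHat σ ρ₁ ρ₂ + Complex.I * d)) * F
        = shiftSeries σ ρ₁ ρ₂ c * (shiftSeries σ ρ₁ ρ₂ d * (expNeg * G)) →
      ∃ e, IsEvenSeries e ∧ PowerSeries.constantCoeff e = 1 ∧ F = e * G := by
    intro c d F G hcd hFG
    have hne : ((rhoHat σ ρ₁ ρ₂ + Complex.I * c) * (rhoHat σ ρ₁ ρ₂ + Complex.I * d) : ℂ) ≠ 0 :=
      mul_ne_zero (ofReal_add_I_mul_ne_zero h.rhoHat_pos c)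
        (ofReal_add_I_mul_ne_zero h.rhoHat_pos d)
    refine ⟨PowerSeries.C ((rhoHat σ ρ₁ ρ₂ + Complex.I * c) * (rhoHat σ ρ₁ ρ₂ + Complex.I * d))⁻¹
      * (expNeg * (shiftSeries σ ρ₁ ρ₂ c * shiftSeries σ ρ₁ ρ₂ d)),
      (isEvenSeries_expNeg_mul hcd).C_mul _, ?_, ?_⟩
    · rw [map_mul, map_mul, map_mul, constantCoeff_shiftSeries, constantCoeff_shiftSeries,
        constantCoeff_expNeg, PowerSeries.constantCoeff_C, one_mul, inv_mul_cancel₀ hne]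
    · have h1 : PowerSeries.C ((rhoHat σ ρ₁ ρ₂ + Complex.I * c) *
          (rhoHat σ ρ₁ ρ₂ + Complex.I * d) : ℂ)⁻¹
          * PowerSeries.C ((rhoHat σ ρ₁ ρ₂ + Complex.I * c) *
          (rhoHat σ ρ₁ ρ₂ + Complex.I * d)) = 1 := by
        rw [← map_mul, inv_mul_cancel₀ hne, map_one]
      rw [← one_mul F, ← h1, mul_assoc, hFG]
      ring
  have hexp := exp_mul_expNeg
  obtain ⟨e, he, he1, hplus⟩ := key (F := plusSeries σ ρ₁ ρ₂ b x t (n + 1) (k + 1) l)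
    (G := plusSeries σ ρ₁ ρ₂ b x t n k (l + 1)) hsq (by
      rw [map_mul, plusSeries_l, ← mul_assoc expNeg, mul_comm expNeg, hexp, one_mul,
        ← h.plusSeries_k, mul_left_comm, ← h.plusSeries_n]
      ring)
  obtain ⟨e', he', he1', hminus⟩ := key (c := -rho σ ρ₁ ρ₂) (d := -(σ * ρ₁ * ρ₂))
    (F := minusSeries σ ρ₁ ρ₂ b x t n k (l + 1))
    (G := minusSeries σ ρ₁ ρ₂ b x t (n + 1) (k + 1) l) (by rw [hsq]; ring) (by
      rw [map_mul, minusSeries_l (n + 1), ← mul_assoc expNeg, mul_comm expNeg, hexp, one_mul,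
        ← h.minusSeries_k, mul_left_comm, ← h.minusSeries_n]
      simp only [Complex.ofReal_neg, mul_neg, sub_eq_add_neg]
      ring)
  rw [genTau_eq_det_pairing, genTau_eq_det_pairing, hplus, hminus,
    det_pairing_even_mul_left he, det_pairing_even_mul_right he', he1, he1']

/-- `H` is proportional to the plus series at `(-1, 0, 0)`, whose conjugate is the minus series at
`(0, 0, 0)`. So the matrix has the form treated in `det_pairing_conj_ne_zero` with `c = ρ`. -/
theorem Admissible.genTau_zero_ne_zero (h : Admissible σ ρ₁ ρ₂) (N : ℕ) :
    genTau N σ ρ₁ ρ₂ b 0 0 0 x t ≠ 0 := by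
  set H := (shiftSeries σ ρ₁ ρ₂ (rho σ ρ₁ ρ₂))⁻¹ * plusSeries σ ρ₁ ρ₂ b x t 0 0 0 with hH
  have h1 := h.shiftSeries_mul_inv (rho σ ρ₁ ρ₂)
  have hne := ofReal_sub_I_mul_ne_zero h.rhoHat_pos (rho σ ρ₁ ρ₂)
  have hH0 : PowerSeries.constantCoeff H ≠ 0 := by
    rw [hH, map_mul]
    have h2 := congrArg PowerSeries.constantCoeff h1
    rw [map_mul, map_one] at h2
    refine mul_ne_zero (right_ne_zero_of_mul_eq_one h2) ?_
    rw [plusSeries, constantCoeff_schurSeries]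
    exact one_ne_zero
  have hplus : shiftSeries σ ρ₁ ρ₂ (rho σ ρ₁ ρ₂) * H = plusSeries σ ρ₁ ρ₂ b x t 0 0 0 := by
    rw [hH, ← mul_assoc, h1, one_mul]
  have hminus : PowerSeries.C (rhoHat σ ρ₁ ρ₂ - Complex.I * (rho σ ρ₁ ρ₂ : ℝ) : ℂ) * conjSeries H
      = minusSeries σ ρ₁ ρ₂ b x t 0 0 0 := by
    have h2 := h.minusSeries_n (b := b) (x := x) (t := t) (-1) 0 0
    have h3 := congrArg conjSeries hplus
    rw [map_mul, conjSeries_shiftSeries, conjSeries_plusSeries] at h3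
    have h4 : shiftSeries σ ρ₁ ρ₂ (-rho σ ρ₁ ρ₂) ≠ 0 := fun h0 => by
      have := h.shiftSeries_mul_inv (-rho σ ρ₁ ρ₂)
      rw [h0, zero_mul] at this
      exact zero_ne_one this
    apply mul_left_cancel₀ h4
    rw [mul_left_comm, h3]
    exact h2
  have h5 := det_pairing_conj_ne_zero (N := N) h h.rho_pos.ne' hH0
  rw [genTau_eq_det_pairing, ← hplus, ← hminus, pairing_C_mul_right, Matrix.det_smul]
  exact mul_ne_zero (pow_ne_zero _ hne) h5

end TauFunctions

/-! ### The four bilinear equations -/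

section Bilinear

variable {N : ℕ} {σ ρ₁ ρ₂ : ℝ} {b : ℕ → ℂ}

theorem hasDerivAt_genTau_x (n k l : ℤ) (x t : ℝ) :
    HasDerivAt (fun y => genTau N σ ρ₁ ρ₂ b n k l y t)
      ((ρ₂ / ρ₁ : ℂ) * flowDet N (specSeries σ ρ₁ ρ₂) (specSeries σ ρ₁ ρ₂)
          (plusSeries σ ρ₁ ρ₂ b x t n k l) (minusSeries σ ρ₁ ρ₂ b x t n k l)
        + (-(ρ₂ / ρ₁ * rhoHat σ ρ₁ ρ₂) + -(ρ₂ / ρ₁ * rhoHat σ ρ₁ ρ₂))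
          * (N * genTau N σ ρ₁ ρ₂ b n k l x t)) x := by
  simp only [genTau_eq_det_pairing]
  have hv : varSeries (alphaCoeff σ ρ₁ ρ₂) = PowerSeries.C (ρ₂ / ρ₁ : ℂ) * specSeries σ ρ₁ ρ₂
      + PowerSeries.C (-(ρ₂ / ρ₁ * rhoHat σ ρ₁ ρ₂) : ℂ) := by
    rw [varSeries_alphaCoeff, map_neg, map_mul]; ring
  have hlin : ∀ (r : ℕ), HasDerivAt (fun y : ℝ => alphaCoeff σ ρ₁ ρ₂ r * (y : ℂ))
      (alphaCoeff σ ρ₁ ρ₂ r) x := fun r => by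
    simpa using (Complex.ofRealCLM.hasDerivAt (x := x)).const_mul (alphaCoeff σ ρ₁ ρ₂ r)
  refine hasDerivAt_det_pairing (isRankOneFlow_specSeries σ ρ₁ ρ₂) (fun r => ?_) (fun r => ?_) hv hv
  · exact (((((hlin r).add_const _).add_const _).add_const _).add_const _).add_const _
  · exact (((((hlin r).add_const _).sub_const _).sub_const _).sub_const _).add_const _

theorem conjSeries_varSeries (x : ℕ → ℂ) :
    conjSeries (varSeries x) = varSeries fun r => conj (x r) := by
  ext r
  simp only [varSeries, PowerSeries.coeff_map, PowerSeries.coeff_mk]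
  split_ifs <;> simp

theorem Admissible.conjSeries_inv_shiftSeries (h : Admissible σ ρ₁ ρ₂) (c : ℝ) :
    conjSeries (shiftSeries σ ρ₁ ρ₂ c)⁻¹ = (shiftSeries σ ρ₁ ρ₂ (-c))⁻¹ := by
  rw [PowerSeries.eq_inv_iff_mul_eq_one (h.constantCoeff_shiftSeries_ne_zero _),
    ← conjSeries_shiftSeries, ← map_mul, mul_comm, h.shiftSeries_mul_inv, map_one]

theorem Admissible.isRankOneFlow_inv_shiftSeries (h : Admissible σ ρ₁ ρ₂) (c : ℝ) :
    ∃ R₁ R₂, IsRankOneFlow N (shiftSeries σ ρ₁ ρ₂ c)⁻¹ (shiftSeries σ ρ₁ ρ₂ (-c))⁻¹ R₁ R₂ := by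
  have h1 := (isRankOneFlow_specSeries (N := N) σ ρ₁ ρ₂).add_const (Complex.I * c)
  refine ⟨_, _, h1.inverse (h.shiftSeries_mul_inv c) ?_⟩
  rw [← h.shiftSeries_mul_inv (-c), shiftSeries, Complex.ofReal_neg, mul_neg, map_neg,
    sub_eq_add_neg]

theorem Admissible.hasDerivAt_genTau_t (h : Admissible σ ρ₁ ρ₂) (n k l : ℤ) (x t : ℝ) :
    HasDerivAt (fun y => genTau N σ ρ₁ ρ₂ b n k l x y)
      (-(ρ₁ * rho σ ρ₁ ρ₂ / ρ₂ : ℂ) * flowDet N (shiftSeries σ ρ₁ ρ₂ (rho σ ρ₁ ρ₂))⁻¹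
          (shiftSeries σ ρ₁ ρ₂ (-rho σ ρ₁ ρ₂))⁻¹
          (plusSeries σ ρ₁ ρ₂ b x t n k l) (minusSeries σ ρ₁ ρ₂ b x t n k l)
        + ((ρ₁ * rho σ ρ₁ ρ₂ / ρ₂ : ℂ) * (rhoHat σ ρ₁ ρ₂ + Complex.I * (rho σ ρ₁ ρ₂ : ℝ))⁻¹
            + conj ((ρ₁ * rho σ ρ₁ ρ₂ / ρ₂ : ℂ)
              * (rhoHat σ ρ₁ ρ₂ + Complex.I * (rho σ ρ₁ ρ₂ : ℝ))⁻¹))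
          * (N * genTau N σ ρ₁ ρ₂ b n k l x t)) t := by
  simp only [genTau_eq_det_pairing]
  have hv : varSeries (betaCoeff σ ρ₁ ρ₂)
      = PowerSeries.C (-(ρ₁ * rho σ ρ₁ ρ₂ / ρ₂ : ℂ)) * (shiftSeries σ ρ₁ ρ₂ (rho σ ρ₁ ρ₂))⁻¹
      + PowerSeries.C ((ρ₁ * rho σ ρ₁ ρ₂ / ρ₂ : ℂ)
          * (rhoHat σ ρ₁ ρ₂ + Complex.I * (rho σ ρ₁ ρ₂ : ℝ))⁻¹) := by
    rw [h.varSeries_betaCoeff, map_neg, map_mul]; ring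
  have hv' : varSeries (fun r => conj (betaCoeff σ ρ₁ ρ₂ r))
      = PowerSeries.C (-(ρ₁ * rho σ ρ₁ ρ₂ / ρ₂ : ℂ)) * (shiftSeries σ ρ₁ ρ₂ (-rho σ ρ₁ ρ₂))⁻¹
      + PowerSeries.C (conj ((ρ₁ * rho σ ρ₁ ρ₂ / ρ₂ : ℂ)
          * (rhoHat σ ρ₁ ρ₂ + Complex.I * (rho σ ρ₁ ρ₂ : ℝ))⁻¹)) := by
    rw [← conjSeries_varSeries, hv, map_add, map_mul, h.conjSeries_inv_shiftSeries,
      PowerSeries.map_C, PowerSeries.map_C]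
    congr 3
    simp
  have hlin : ∀ (c : ℂ), HasDerivAt (fun y : ℝ => c * (y : ℂ)) c t := fun c => by
    simpa using (Complex.ofRealCLM.hasDerivAt (x := t)).const_mul c
  obtain ⟨R₁, R₂, hR⟩ := h.isRankOneFlow_inv_shiftSeries (N := N) (rho σ ρ₁ ρ₂)
  refine hasDerivAt_det_pairing hR (fun r => ?_) (fun r => ?_) hv hv'
  · exact (((((hlin _).const_add _).add_const _).add_const _).add_const _).add_const _
  · exact (((((hlin _).const_add _).sub_const _).sub_const _).sub_const _).add_const _

/-- Scalar parts of a flow cancel in a Wronskian, leaving the left side of the Toda identity. -/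
theorem wronskian_flow (c d n F₁ F₂ τ₁ τ₂ : ℂ) :
    (c * F₁ + d * (n * τ₁)) * τ₂ - τ₁ * (c * F₂ + d * (n * τ₂)) = c * (F₁ * τ₂ - τ₁ * F₂) := by
  ring

theorem wronskian_flow_swap (c d n F₁ F₂ τ₁ τ₂ : ℂ) :
    (c * F₁ + d * (n * τ₁)) * τ₂ - τ₁ * (c * F₂ + d * (n * τ₂)) = -c * (F₂ * τ₁ - τ₂ * F₁) := by
  ring

/-- Write `f = σ_{0,0,0}`, `g = σ_{-1,1,0}`, `h = σ_{-1,0,1}`. The Toda identity for the shifts of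
`k` and `n` has `a - b = i`, because `ρ - σρ₁ρ₂ = 1`, and its corner `σ_{0,1,0}` is `h` by the
reduction. -/
theorem Admissible.bilinear_x_gf (h : Admissible σ ρ₁ ρ₂) (x t : ℝ) :
    Complex.I * (ρ₁ : ℂ) *
        (deriv (fun y => genTau N σ ρ₁ ρ₂ b (-1) 1 0 y t) x * genTau N σ ρ₁ ρ₂ b 0 0 0 x t
          - genTau N σ ρ₁ ρ₂ b (-1) 1 0 x t * deriv (fun y => genTau N σ ρ₁ ρ₂ b 0 0 0 y t) x)
      = ρ₂ * (genTau N σ ρ₁ ρ₂ b (-1) 1 0 x t * genTau N σ ρ₁ ρ₂ b 0 0 0 x t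
          - genTau N σ ρ₁ ρ₂ b (-1) 0 1 x t * genTau N σ ρ₁ ρ₂ b (-1) 0 0 x t) := by
  have hr : (ρ₁ : ℂ) ≠ 0 := by exact_mod_cast h.left_ne_zero
  have hred := h.genTau_succ_succ (b := b) (x := x) (t := t) N (-1) 0 0
  have key := toda_identity_of_eq (N := N) (isRankOneFlow_specSeries σ ρ₁ ρ₂)
    (a := -(Complex.I * (σ * ρ₁ * ρ₂ : ℝ))) (b := -(Complex.I * (rho σ ρ₁ ρ₂ : ℝ)))
    (ofReal_add_I_mul_ne_zero h.rhoHat_pos (σ * ρ₁ * ρ₂))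
    (ofReal_add_I_mul_ne_zero h.rhoHat_pos (rho σ ρ₁ ρ₂))
    (ofReal_sub_I_mul_ne_zero h.rhoHat_pos (σ * ρ₁ * ρ₂))
    (ofReal_sub_I_mul_ne_zero h.rhoHat_pos (rho σ ρ₁ ρ₂))
    (A := plusSeries σ ρ₁ ρ₂ b x t (-1) 0 0) (Aa := plusSeries σ ρ₁ ρ₂ b x t (-1) 1 0)
    (Ab := plusSeries σ ρ₁ ρ₂ b x t 0 0 0) (Aab := plusSeries σ ρ₁ ρ₂ b x t 0 1 0)
    (B := minusSeries σ ρ₁ ρ₂ b x t (-1) 0 0) (Ba := minusSeries σ ρ₁ ρ₂ b x t (-1) 1 0)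
    (Bb := minusSeries σ ρ₁ ρ₂ b x t 0 0 0) (Bab := minusSeries σ ρ₁ ρ₂ b x t 0 1 0)
    (by simpa [shiftSeries] using h.plusSeries_k (b := b) (x := x) (t := t) (-1) 0 0)
    (by simpa [shiftSeries] using h.plusSeries_n (b := b) (x := x) (t := t) (-1) 0 0)
    (by simpa [shiftSeries] using h.plusSeries_k (b := b) (x := x) (t := t) 0 0 0)
    (by simpa [shiftSeries] using h.minusSeries_n (b := b) (x := x) (t := t) (-1) 1 0)
    (by simpa [shiftSeries] using h.minusSeries_k (b := b) (x := x) (t := t) 0 0 0)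
    (by simpa [shiftSeries] using h.minusSeries_k (b := b) (x := x) (t := t) (-1) 0 0)
  simp only [← genTau_eq_det_pairing] at key
  rw [show (-1 : ℤ) + 1 = 0 by norm_num, show (0 : ℤ) + 1 = 1 by norm_num] at hred
  rw [(hasDerivAt_genTau_x _ _ _ x t).deriv, (hasDerivAt_genTau_x _ _ _ x t).deriv, ← hred]
  rw [mul_eq_rho_sub_one] at key
  push_cast at key
  field_simp
  linear_combination (Complex.I * ρ₂) * key
    + ρ₂ * (genTau N σ ρ₁ ρ₂ b 0 1 0 x t * genTau N σ ρ₁ ρ₂ b (-1) 0 0 x t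
      - genTau N σ ρ₁ ρ₂ b (-1) 1 0 x t * genTau N σ ρ₁ ρ₂ b 0 0 0 x t) * Complex.I_sq

/-- Here the shifts are those of `l` (`a = 0`) and `k`, starting from `h^* = σ_{0,0,-1}`. The
reduction identifies `σ_{0,1,-1}` with `f^*` and `σ_{0,1,0}` with `h`. -/
theorem Admissible.bilinear_x_ff (h : Admissible σ ρ₁ ρ₂) (x t : ℝ) :
    Complex.I *
        (deriv (fun y => genTau N σ ρ₁ ρ₂ b 0 0 0 y t) x * genTau N σ ρ₁ ρ₂ b (-1) 0 0 x t
          - genTau N σ ρ₁ ρ₂ b 0 0 0 x t * deriv (fun y => genTau N σ ρ₁ ρ₂ b (-1) 0 0 y t) x)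
      = σ * ρ₂ ^ 2 * (genTau N σ ρ₁ ρ₂ b 0 0 0 x t * genTau N σ ρ₁ ρ₂ b (-1) 0 0 x t
          - genTau N σ ρ₁ ρ₂ b (-1) 0 1 x t * genTau N σ ρ₁ ρ₂ b 0 0 (-1) x t) := by
  have hr : (ρ₁ : ℂ) ≠ 0 := by exact_mod_cast h.left_ne_zero
  have hp : (rhoHat σ ρ₁ ρ₂ : ℂ) ≠ 0 := by exact_mod_cast h.rhoHat_pos.ne'
  have hred := h.genTau_succ_succ (b := b) (x := x) (t := t) N (-1) 0 0
  have hred' : ∀ y, genTau N σ ρ₁ ρ₂ b 0 1 (-1) y t = genTau N σ ρ₁ ρ₂ b (-1) 0 0 y t := fun y => by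
    simpa using h.genTau_succ_succ (b := b) (x := y) (t := t) N (-1) 0 (-1)
  have hl : ∀ n k l : ℤ, PowerSeries.C (rhoHat σ ρ₁ ρ₂ : ℂ) * plusSeries σ ρ₁ ρ₂ b x t n k (l + 1)
      = specSeries σ ρ₁ ρ₂ * plusSeries σ ρ₁ ρ₂ b x t n k l := fun n k l => by
    rw [plusSeries_l, specSeries, mul_assoc]
  have hl' : ∀ n k l : ℤ, PowerSeries.C (rhoHat σ ρ₁ ρ₂ : ℂ) * minusSeries σ ρ₁ ρ₂ b x t n k l
      = specSeries σ ρ₁ ρ₂ * minusSeries σ ρ₁ ρ₂ b x t n k (l + 1) := fun n k l => by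
    rw [minusSeries_l, specSeries, mul_assoc]
  have key := toda_identity_of_eq (N := N) (isRankOneFlow_specSeries σ ρ₁ ρ₂)
    (a := 0) (b := -(Complex.I * (σ * ρ₁ * ρ₂ : ℝ))) hp
    (ofReal_add_I_mul_ne_zero h.rhoHat_pos (σ * ρ₁ * ρ₂)) hp
    (ofReal_sub_I_mul_ne_zero h.rhoHat_pos (σ * ρ₁ * ρ₂))
    (A := plusSeries σ ρ₁ ρ₂ b x t 0 0 (-1)) (Aa := plusSeries σ ρ₁ ρ₂ b x t 0 0 0)
    (Ab := plusSeries σ ρ₁ ρ₂ b x t 0 1 (-1)) (Aab := plusSeries σ ρ₁ ρ₂ b x t 0 1 0)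
    (B := minusSeries σ ρ₁ ρ₂ b x t 0 0 (-1)) (Ba := minusSeries σ ρ₁ ρ₂ b x t 0 0 0)
    (Bb := minusSeries σ ρ₁ ρ₂ b x t 0 1 (-1)) (Bab := minusSeries σ ρ₁ ρ₂ b x t 0 1 0)
    (by simpa using hl 0 0 (-1))
    (by simpa [shiftSeries] using h.plusSeries_k (b := b) (x := x) (t := t) 0 0 (-1))
    (by simpa using hl 0 1 (-1))
    (by simpa [shiftSeries] using h.minusSeries_k (b := b) (x := x) (t := t) 0 0 0)
    (by simpa using hl' 0 1 (-1))
    (by simpa using hl' 0 0 (-1))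
  simp only [← genTau_eq_det_pairing] at key
  rw [show (-1 : ℤ) + 1 = 0 by norm_num, show (0 : ℤ) + 1 = 1 by norm_num] at hred
  simp only [← hred', ← hred]
  rw [(hasDerivAt_genTau_x _ _ _ x t).deriv, (hasDerivAt_genTau_x _ _ _ x t).deriv]
  push_cast at key
  field_simp
  linear_combination (Complex.I * ρ₂) * key
    + ρ₂ * ρ₁ * ρ₂ * σ * (genTau N σ ρ₁ ρ₂ b 0 1 0 x t * genTau N σ ρ₁ ρ₂ b 0 0 (-1) x t
      - genTau N σ ρ₁ ρ₂ b 0 0 0 x t * genTau N σ ρ₁ ρ₂ b 0 1 (-1) x t) * Complex.I_sq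

/-- The shifts of the discrete variables in terms of the spectral parameter of the `t` flow. -/
theorem Admissible.inv_shiftSeries_relations (h : Admissible σ ρ₁ ρ₂) (x t : ℝ) {n m k k' l l' : ℤ}
    (hm : n + 1 = m) (hk : k + 1 = k') (hl : l + 1 = l') :
    PowerSeries.C (rhoHat σ ρ₁ ρ₂ + Complex.I * (rho σ ρ₁ ρ₂ : ℝ) : ℂ)⁻¹
        * plusSeries σ ρ₁ ρ₂ b x t n k l
      = (shiftSeries σ ρ₁ ρ₂ (rho σ ρ₁ ρ₂))⁻¹ * plusSeries σ ρ₁ ρ₂ b x t m k l ∧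
    PowerSeries.C ((rhoHat σ ρ₁ ρ₂ + Complex.I * (rho σ ρ₁ ρ₂ : ℝ) : ℂ)⁻¹ *
          (Complex.I * (rhoHat σ ρ₁ ρ₂ + Complex.I * (σ * ρ₁ * ρ₂ : ℝ))))
        * plusSeries σ ρ₁ ρ₂ b x t n k' l
      = ((shiftSeries σ ρ₁ ρ₂ (rho σ ρ₁ ρ₂))⁻¹ + PowerSeries.C Complex.I)
        * plusSeries σ ρ₁ ρ₂ b x t m k l ∧
    PowerSeries.C ((rhoHat σ ρ₁ ρ₂ + Complex.I * (rho σ ρ₁ ρ₂ : ℝ) : ℂ)⁻¹ *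
          (Complex.I / rho σ ρ₁ ρ₂ * rhoHat σ ρ₁ ρ₂)) * plusSeries σ ρ₁ ρ₂ b x t n k l'
      = ((shiftSeries σ ρ₁ ρ₂ (rho σ ρ₁ ρ₂))⁻¹ + PowerSeries.C (Complex.I / rho σ ρ₁ ρ₂))
        * plusSeries σ ρ₁ ρ₂ b x t m k l := by
  subst hm hk hl
  have hinv := h.shiftSeries_mul_inv (rho σ ρ₁ ρ₂)
  have hcN := ofReal_add_I_mul_ne_zero h.rhoHat_pos (rho σ ρ₁ ρ₂)
  have hc : PowerSeries.C (rhoHat σ ρ₁ ρ₂ + Complex.I * (rho σ ρ₁ ρ₂ : ℝ) : ℂ)⁻¹ *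
      PowerSeries.C (rhoHat σ ρ₁ ρ₂ + Complex.I * (rho σ ρ₁ ρ₂ : ℝ)) = 1 := by
    rw [← map_mul, inv_mul_cancel₀ hcN, map_one]
  have hrho : (rho σ ρ₁ ρ₂ : ℂ) ≠ 0 := by exact_mod_cast h.rho_pos.ne'
  have base : ∀ k l : ℤ, PowerSeries.C (rhoHat σ ρ₁ ρ₂ + Complex.I * (rho σ ρ₁ ρ₂ : ℝ) : ℂ)⁻¹
        * plusSeries σ ρ₁ ρ₂ b x t n k l
      = (shiftSeries σ ρ₁ ρ₂ (rho σ ρ₁ ρ₂))⁻¹ * plusSeries σ ρ₁ ρ₂ b x t (n + 1) k l := by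
    intro k l
    have h1 := h.plusSeries_n (b := b) (x := x) (t := t) n k l
    linear_combination -PowerSeries.C (rhoHat σ ρ₁ ρ₂ + Complex.I * (rho σ ρ₁ ρ₂ : ℝ) : ℂ)⁻¹ *
        (shiftSeries σ ρ₁ ρ₂ (rho σ ρ₁ ρ₂))⁻¹ * h1
      - PowerSeries.C (rhoHat σ ρ₁ ρ₂ + Complex.I * (rho σ ρ₁ ρ₂ : ℝ) : ℂ)⁻¹ *
        plusSeries σ ρ₁ ρ₂ b x t n k l * hinv
      + (shiftSeries σ ρ₁ ρ₂ (rho σ ρ₁ ρ₂))⁻¹ * plusSeries σ ρ₁ ρ₂ b x t (n + 1) k l * hc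
  refine ⟨base k l, ?_, ?_⟩
  · have e : PowerSeries.C Complex.I * shiftSeries σ ρ₁ ρ₂ (σ * ρ₁ * ρ₂)
        = 1 + PowerSeries.C Complex.I * shiftSeries σ ρ₁ ρ₂ (rho σ ρ₁ ρ₂) := by
      have : PowerSeries.C Complex.I * PowerSeries.C (Complex.I * (σ * ρ₁ * ρ₂ : ℝ))
          = 1 + PowerSeries.C Complex.I * PowerSeries.C (Complex.I * (rho σ ρ₁ ρ₂ : ℝ)) := by
        rw [← map_mul, ← map_mul, ← map_one PowerSeries.C, ← map_add, mul_eq_rho_sub_one]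
        congr 1
        push_cast
        linear_combination -Complex.I_sq
      simp only [shiftSeries]
      linear_combination this
    have h1 := h.plusSeries_k (b := b) (x := x) (t := t) (n + 1) k l
    rw [map_mul, map_mul]
    linear_combination PowerSeries.C Complex.I *
        PowerSeries.C (rhoHat σ ρ₁ ρ₂ + Complex.I * (σ * ρ₁ * ρ₂ : ℝ) : ℂ) * base (k + 1) l
      + PowerSeries.C Complex.I * (shiftSeries σ ρ₁ ρ₂ (rho σ ρ₁ ρ₂))⁻¹ * h1
      + (shiftSeries σ ρ₁ ρ₂ (rho σ ρ₁ ρ₂))⁻¹ * plusSeries σ ρ₁ ρ₂ b x t (n + 1) k l * e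
      + PowerSeries.C Complex.I * plusSeries σ ρ₁ ρ₂ b x t (n + 1) k l * hinv
  · have e : PowerSeries.C (Complex.I / rho σ ρ₁ ρ₂) * specSeries σ ρ₁ ρ₂
        = 1 + PowerSeries.C (Complex.I / rho σ ρ₁ ρ₂) * shiftSeries σ ρ₁ ρ₂ (rho σ ρ₁ ρ₂) := by
      have : 1 + PowerSeries.C (Complex.I / rho σ ρ₁ ρ₂)
          * PowerSeries.C (Complex.I * (rho σ ρ₁ ρ₂ : ℝ)) = 0 := by
        rw [← map_mul, ← map_one PowerSeries.C, ← map_add, ← map_zero PowerSeries.C]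
        congr 1
        field_simp
        linear_combination Complex.I_sq
      simp only [shiftSeries]
      linear_combination -this
    have h1 := plusSeries_l (σ := σ) (ρ₁ := ρ₁) (ρ₂ := ρ₂) (b := b) (x := x) (t := t) (n + 1) k l
    rw [map_mul, map_mul]
    rw [specSeries] at e
    linear_combination PowerSeries.C (Complex.I / rho σ ρ₁ ρ₂) *
        PowerSeries.C (rhoHat σ ρ₁ ρ₂ : ℂ) * base k (l + 1)
      + PowerSeries.C (Complex.I / rho σ ρ₁ ρ₂) * PowerSeries.C (rhoHat σ ρ₁ ρ₂ : ℂ) *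
        (shiftSeries σ ρ₁ ρ₂ (rho σ ρ₁ ρ₂))⁻¹ * h1
      + (shiftSeries σ ρ₁ ρ₂ (rho σ ρ₁ ρ₂))⁻¹ * plusSeries σ ρ₁ ρ₂ b x t (n + 1) k l * e
      + PowerSeries.C (Complex.I / rho σ ρ₁ ρ₂) * plusSeries σ ρ₁ ρ₂ b x t (n + 1) k l * hinv

/-- The counterpart of `Admissible.inv_shiftSeries_relations` for the minus variables. -/
theorem Admissible.inv_shiftSeries_relations_minus (h : Admissible σ ρ₁ ρ₂) (x t : ℝ)
    {n m k k' l l' : ℤ} (hm : n + 1 = m) (hk : k + 1 = k') (hl : l + 1 = l') :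
    PowerSeries.C (rhoHat σ ρ₁ ρ₂ - Complex.I * (rho σ ρ₁ ρ₂ : ℝ) : ℂ)⁻¹
        * minusSeries σ ρ₁ ρ₂ b x t m k l
      = (shiftSeries σ ρ₁ ρ₂ (-rho σ ρ₁ ρ₂))⁻¹ * minusSeries σ ρ₁ ρ₂ b x t n k l ∧
    PowerSeries.C ((rhoHat σ ρ₁ ρ₂ - Complex.I * (rho σ ρ₁ ρ₂ : ℝ) : ℂ)⁻¹ *
          (-Complex.I * (rhoHat σ ρ₁ ρ₂ - Complex.I * (σ * ρ₁ * ρ₂ : ℝ))))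
        * minusSeries σ ρ₁ ρ₂ b x t m k l
      = ((shiftSeries σ ρ₁ ρ₂ (-rho σ ρ₁ ρ₂))⁻¹ - PowerSeries.C Complex.I)
        * minusSeries σ ρ₁ ρ₂ b x t n k' l ∧
    PowerSeries.C ((rhoHat σ ρ₁ ρ₂ - Complex.I * (rho σ ρ₁ ρ₂ : ℝ) : ℂ)⁻¹ *
          (-Complex.I / rho σ ρ₁ ρ₂ * rhoHat σ ρ₁ ρ₂)) * minusSeries σ ρ₁ ρ₂ b x t m k l
      = ((shiftSeries σ ρ₁ ρ₂ (-rho σ ρ₁ ρ₂))⁻¹ - PowerSeries.C (Complex.I / rho σ ρ₁ ρ₂))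
        * minusSeries σ ρ₁ ρ₂ b x t n k l' := by
  subst hm hk hl
  have key : ∀ n' k' l' : ℤ, minusSeries σ ρ₁ ρ₂ b x t n' k' l'
      = conjSeries (plusSeries σ ρ₁ ρ₂ b x t (-1 - n') (-k') (-l')) := minusSeries_eq
  have en : -1 - n = -1 - (n + 1) + 1 := by ring
  have ek : -k = -(k + 1) + 1 := by ring
  have el : -l = -(l + 1) + 1 := by ring
  refine ⟨?_, ?_, ?_⟩
  · have := congrArg conjSeries
      (h.inv_shiftSeries_relations (b := b) x t (n := -1 - (n + 1)) (k := -k) (l := -l)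
        rfl rfl rfl).1
    rw [map_mul, map_mul, PowerSeries.map_C, h.conjSeries_inv_shiftSeries, ← en, ← key, ← key]
      at this
    simpa [sub_eq_add_neg] using this
  · have := congrArg conjSeries
      (h.inv_shiftSeries_relations (b := b) x t (n := -1 - (n + 1)) (k := -(k + 1)) (l := -l)
        rfl rfl rfl).2.1
    rw [map_mul conjSeries (PowerSeries.C _), map_mul conjSeries (_ + _), PowerSeries.map_C,
      map_add, h.conjSeries_inv_shiftSeries, ← en, ← ek,
      ← key, ← key, PowerSeries.map_C] at this
    simpa [sub_eq_add_neg] using this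
  · have := congrArg conjSeries
      (h.inv_shiftSeries_relations (b := b) x t (n := -1 - (n + 1)) (k := -k) (l := -(l + 1))
        rfl rfl rfl).2.2
    rw [map_mul conjSeries (PowerSeries.C _), map_mul conjSeries (_ + _), PowerSeries.map_C,
      map_add, h.conjSeries_inv_shiftSeries, ← en, ← el,
      ← key, ← key, PowerSeries.map_C] at this
    simpa [sub_eq_add_neg, neg_div] using this

/-- The Toda identity of the `t`-flow with parameters `-i` and `-i/ρ`, starting from `g^* =
σ_{0,-1,0}`. The reduction turns `σ_{-1,-1,1}` into `f` and `σ_{-2,0,1}` into `g`. -/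
theorem Admissible.bilinear_t_ff (h : Admissible σ ρ₁ ρ₂) (x t : ℝ) :
    Complex.I *
        (deriv (fun y => genTau N σ ρ₁ ρ₂ b (-1) 0 0 x y) t * genTau N σ ρ₁ ρ₂ b 0 0 0 x t
          - genTau N σ ρ₁ ρ₂ b (-1) 0 0 x t * deriv (fun y => genTau N σ ρ₁ ρ₂ b 0 0 0 x y) t)
      = σ * ρ₁ ^ 2 * (genTau N σ ρ₁ ρ₂ b 0 0 0 x t * genTau N σ ρ₁ ρ₂ b (-1) 0 0 x t
          - genTau N σ ρ₁ ρ₂ b (-1) 1 0 x t * genTau N σ ρ₁ ρ₂ b 0 (-1) 0 x t) := by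
  have hr : (ρ₂ : ℂ) ≠ 0 := by exact_mod_cast h.right_ne_zero
  have hp : (rhoHat σ ρ₁ ρ₂ : ℂ) ≠ 0 := by exact_mod_cast h.rhoHat_pos.ne'
  have hrho : (rho σ ρ₁ ρ₂ : ℂ) ≠ 0 := by exact_mod_cast h.rho_pos.ne'
  have hI := Complex.I_ne_zero
  have hcN := ofReal_add_I_mul_ne_zero h.rhoHat_pos (rho σ ρ₁ ρ₂)
  have hcN' := ofReal_sub_I_mul_ne_zero h.rhoHat_pos (rho σ ρ₁ ρ₂)
  have hcK := ofReal_add_I_mul_ne_zero h.rhoHat_pos (σ * ρ₁ * ρ₂)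
  have hcK' := ofReal_sub_I_mul_ne_zero h.rhoHat_pos (σ * ρ₁ * ρ₂)
  have hred := h.genTau_succ_succ (b := b) (x := x) (t := t) N (-2) 0 0
  have hred' : ∀ y, genTau N σ ρ₁ ρ₂ b 0 0 0 x y = genTau N σ ρ₁ ρ₂ b (-1) (-1) 1 x y := fun y => by
    simpa using h.genTau_succ_succ (b := b) (x := x) (t := y) N (-1) (-1) 0
  obtain ⟨R₁, R₂, hR⟩ := h.isRankOneFlow_inv_shiftSeries (N := N) (rho σ ρ₁ ρ₂)
  have rp := fun {n m k k' l l' : ℤ} =>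
    h.inv_shiftSeries_relations (b := b) x t (n := n) (m := m) (k := k)
    (k' := k') (l := l) (l' := l')
  have rm := fun {n m k k' l l' : ℤ} =>
    h.inv_shiftSeries_relations_minus (b := b) x t (n := n) (m := m) (k := k)
    (k' := k') (l := l) (l' := l')
  have key := toda_identity_of_eq hR (a := -Complex.I) (b := -(Complex.I / rho σ ρ₁ ρ₂))
    (mul_ne_zero (inv_ne_zero hcN) (mul_ne_zero hI hcK))
    (mul_ne_zero (inv_ne_zero hcN) (mul_ne_zero (div_ne_zero hI hrho) hp))
    (mul_ne_zero (inv_ne_zero hcN') (mul_ne_zero (neg_ne_zero.mpr hI) hcK'))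
    (mul_ne_zero (inv_ne_zero hcN') (mul_ne_zero (div_ne_zero (neg_ne_zero.mpr hI) hrho) hp))
    (A := plusSeries σ ρ₁ ρ₂ b x t 0 (-1) 0) (Aa := plusSeries σ ρ₁ ρ₂ b x t (-1) 0 0)
    (Ab := plusSeries σ ρ₁ ρ₂ b x t (-1) (-1) 1) (Aab := plusSeries σ ρ₁ ρ₂ b x t (-2) 0 1)
    (B := minusSeries σ ρ₁ ρ₂ b x t 0 (-1) 0) (Ba := minusSeries σ ρ₁ ρ₂ b x t (-1) 0 0)
    (Bb := minusSeries σ ρ₁ ρ₂ b x t (-1) (-1) 1) (Bab := minusSeries σ ρ₁ ρ₂ b x t (-2) 0 1)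
    (by rw [map_neg, sub_neg_eq_add]; exact (rp (n := (-1)) (k := (-1)) (l := 0) (by rfl)
      (by rfl) (by rfl)).2.1)
    (by rw [map_neg, sub_neg_eq_add]; exact (rp (n := (-1)) (k := (-1)) (l := 0) (by rfl)
      (by rfl) (by rfl)).2.2)
    (by rw [map_neg, sub_neg_eq_add]; exact (rp (n := (-2)) (k := (-1)) (l := 1) (by rfl)
      (by rfl) (by rfl)).2.1)
    (by rw [map_neg, ← sub_eq_add_neg]; exact (rm (n := (-2)) (k := 0) (l := 0) (by rfl)
      (by rfl) (by rfl)).2.2)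
    (by rw [map_neg, ← sub_eq_add_neg]; exact (rm (n := (-2)) (k := (-1)) (l := 1) (by rfl)
      (by rfl) (by rfl)).2.1)
    (by rw [map_neg, ← sub_eq_add_neg]; exact (rm (n := (-1)) (k := (-1)) (l := 0) (by rfl)
      (by rfl) (by rfl)).2.1)
  simp only [← genTau_eq_det_pairing] at key
  rw [show (-2 : ℤ) + 1 = -1 by norm_num, show (0 : ℤ) + 1 = 1 by norm_num] at hred
  simp only [hred', hred]
  rw [(h.hasDerivAt_genTau_t _ _ _ x t).deriv, (h.hasDerivAt_genTau_t _ _ _ x t).deriv,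
    wronskian_flow,
    key]
  have hrs : (rho σ ρ₁ ρ₂ : ℂ) = 1 + σ * ρ₁ * ρ₂ := by unfold rho; push_cast; ring
  field_simp
  linear_combination (genTau N σ ρ₁ ρ₂ b (-2) 0 1 x t * genTau N σ ρ₁ ρ₂ b 0 (-1) 0 x t
      - genTau N σ ρ₁ ρ₂ b (-1) 0 0 x t * genTau N σ ρ₁ ρ₂ b (-1) (-1) 1 x t)
    * (Complex.I ^ 2 * ρ₁ * hrs + ρ₁ ^ 2 * ρ₂ * σ * Complex.I_sq)

/-- The parameters are now `0`, which lowers `n` alone, and `-i/ρ`, starting from `f`; the corner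
`σ_{-2,0,1}` is again `g`. The Wronskian comes out in the opposite order, hence
`wronskian_flow_swap`. -/
theorem Admissible.bilinear_t_hf (h : Admissible σ ρ₁ ρ₂) (x t : ℝ) :
    Complex.I * (ρ₂ : ℂ) *
        (deriv (fun y => genTau N σ ρ₁ ρ₂ b (-1) 0 1 x y) t * genTau N σ ρ₁ ρ₂ b (-1) 0 0 x t
          - genTau N σ ρ₁ ρ₂ b (-1) 0 1 x t * deriv (fun y => genTau N σ ρ₁ ρ₂ b (-1) 0 0 x y) t)
      = ρ₁ * (genTau N σ ρ₁ ρ₂ b (-1) 0 1 x t * genTau N σ ρ₁ ρ₂ b (-1) 0 0 x t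
          - genTau N σ ρ₁ ρ₂ b (-1) 1 0 x t * genTau N σ ρ₁ ρ₂ b 0 0 0 x t) := by
  have hr : (ρ₂ : ℂ) ≠ 0 := by exact_mod_cast h.right_ne_zero
  have hp : (rhoHat σ ρ₁ ρ₂ : ℂ) ≠ 0 := by exact_mod_cast h.rhoHat_pos.ne'
  have hrho : (rho σ ρ₁ ρ₂ : ℂ) ≠ 0 := by exact_mod_cast h.rho_pos.ne'
  have hI := Complex.I_ne_zero
  have hcN := ofReal_add_I_mul_ne_zero h.rhoHat_pos (rho σ ρ₁ ρ₂)
  have hcN' := ofReal_sub_I_mul_ne_zero h.rhoHat_pos (rho σ ρ₁ ρ₂)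
  have hred := h.genTau_succ_succ (b := b) (x := x) (t := t) N (-2) 0 0
  obtain ⟨R₁, R₂, hR⟩ := h.isRankOneFlow_inv_shiftSeries (N := N) (rho σ ρ₁ ρ₂)
  have rp := fun {n m k k' l l' : ℤ} =>
    h.inv_shiftSeries_relations (b := b) x t (n := n) (m := m) (k := k)
    (k' := k') (l := l) (l' := l')
  have rm := fun {n m k k' l l' : ℤ} =>
    h.inv_shiftSeries_relations_minus (b := b) x t (n := n) (m := m) (k := k)
    (k' := k') (l := l) (l' := l')
  have key := toda_identity_of_eq hR (a := 0) (b := -(Complex.I / rho σ ρ₁ ρ₂))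
    (inv_ne_zero hcN)
    (mul_ne_zero (inv_ne_zero hcN) (mul_ne_zero (div_ne_zero hI hrho) hp))
    (inv_ne_zero hcN')
    (mul_ne_zero (inv_ne_zero hcN') (mul_ne_zero (div_ne_zero (neg_ne_zero.mpr hI) hrho) hp))
    (A := plusSeries σ ρ₁ ρ₂ b x t 0 0 0) (Aa := plusSeries σ ρ₁ ρ₂ b x t (-1) 0 0)
    (Ab := plusSeries σ ρ₁ ρ₂ b x t (-1) 0 1) (Aab := plusSeries σ ρ₁ ρ₂ b x t (-2) 0 1)
    (B := minusSeries σ ρ₁ ρ₂ b x t 0 0 0) (Ba := minusSeries σ ρ₁ ρ₂ b x t (-1) 0 0)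
    (Bb := minusSeries σ ρ₁ ρ₂ b x t (-1) 0 1) (Bab := minusSeries σ ρ₁ ρ₂ b x t (-2) 0 1)
    (by rw [map_zero, sub_zero]; exact (rp (n := (-1)) (k := 0) (l := 0) (by rfl)
      (by rfl) (by rfl)).1)
    (by rw [map_neg, sub_neg_eq_add]; exact (rp (n := (-1)) (k := 0) (l := 0) (by rfl)
      (by rfl) (by rfl)).2.2)
    (by rw [map_zero, sub_zero]; exact (rp (n := (-2)) (k := 0) (l := 1) (by rfl)
      (by rfl) (by rfl)).1)
    (by rw [map_neg, ← sub_eq_add_neg]; exact (rm (n := (-2)) (k := 0) (l := 0) (by rfl)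
      (by rfl) (by rfl)).2.2)
    (by rw [map_zero, add_zero]; exact (rm (n := (-2)) (k := 0) (l := 1) (by rfl)
      (by rfl) (by rfl)).1)
    (by rw [map_zero, add_zero]; exact (rm (n := (-1)) (k := 0) (l := 0) (by rfl)
      (by rfl) (by rfl)).1)
  simp only [← genTau_eq_det_pairing] at key
  rw [show (-2 : ℤ) + 1 = -1 by norm_num, show (0 : ℤ) + 1 = 1 by norm_num] at hred
  simp only [hred]
  rw [(h.hasDerivAt_genTau_t _ _ _ x t).deriv, (h.hasDerivAt_genTau_t _ _ _ x t).deriv,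
    wronskian_flow_swap,
    key]
  field_simp
  linear_combination ρ₁ * (genTau N σ ρ₁ ρ₂ b (-2) 0 1 x t * genTau N σ ρ₁ ρ₂ b 0 0 0 x t
      - genTau N σ ρ₁ ρ₂ b (-1) 0 0 x t * genTau N σ ρ₁ ρ₂ b (-1) 0 1 x t) * Complex.I_sq

end Bilinear

/-! ### From the bilinear equations to the MT system -/

section Solution

variable {N : ℕ} {σ ρ₁ ρ₂ : ℝ} {b : ℕ → ℂ}

theorem contDiff_mEntry {E : Type*} [NormedAddCommGroup E] [NormedSpace ℝ E] {n : WithTop ℕ∞}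
    {xp xm : E → ℕ → ℂ} (hp : ∀ r, ContDiff ℝ n fun z => xp z r)
    (hm : ∀ r, ContDiff ℝ n fun z => xm z r) (s : ℕ → ℂ) (i j : ℕ) :
    ContDiff ℝ n fun z => mEntry (xp z) (xm z) s i j := by
  unfold mEntry
  refine ContDiff.sum fun γ _ => (contDiff_const.mul ?_).mul ?_
  · exact contDiff_schur (fun z r => xp z r + (γ : ℂ) * s r) (fun r => (hp r).add contDiff_const) _
  · exact contDiff_schur (fun z r => xm z r + (γ : ℂ) * s r) (fun r => (hm r).add contDiff_const) _

theorem contDiff_schurDet {E : Type*} [NormedAddCommGroup E] [NormedSpace ℝ E] {n : WithTop ℕ∞}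
    {xp xm : E → ℕ → ℂ} (hp : ∀ r, ContDiff ℝ n fun z => xp z r)
    (hm : ∀ r, ContDiff ℝ n fun z => xm z r) (N : ℕ) (s : ℕ → ℂ) :
    ContDiff ℝ n fun z => schurDet N (xp z) (xm z) s := by
  simp only [schurDet, Matrix.det_apply]
  refine ContDiff.sum fun τ _ => ContDiff.const_smul _ (contDiff_prod fun i _ => ?_)
  exact contDiff_mEntry hp hm _ _ _

theorem contDiff_genTau (n k l : ℤ) :
    ContDiff ℝ ∞ fun z : ℝ × ℝ => genTau N σ ρ₁ ρ₂ b n k l z.1 z.2 := by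
  have hx : ContDiff ℝ ∞ fun z : ℝ × ℝ => (z.1 : ℂ) := Complex.ofRealCLM.contDiff.comp contDiff_fst
  have ht : ContDiff ℝ ∞ fun z : ℝ × ℝ => (z.2 : ℂ) := Complex.ofRealCLM.contDiff.comp contDiff_snd
  refine contDiff_schurDet (fun r => ?_) (fun r => ?_) _ _
  · simp only [genPlus]
    exact (((((contDiff_const.mul hx).add (contDiff_const.mul ht)).add contDiff_const).add
      contDiff_const).add contDiff_const).add contDiff_const
  · simp only [genMinus]
    exact (((((contDiff_const.mul hx).add (contDiff_const.mul ht)).sub contDiff_const).sub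
      contDiff_const).sub contDiff_const).add contDiff_const

theorem contDiff_planeWave : ContDiff ℝ ∞ fun z : ℝ × ℝ => planeWave σ ρ₁ ρ₂ z.1 z.2 := by
  unfold planeWave
  refine ContDiff.cexp (contDiff_const.mul (Complex.ofRealCLM.contDiff.comp ?_))
  exact contDiff_const.mul ((contDiff_const.mul contDiff_fst).add (contDiff_const.mul contDiff_snd))

theorem planeWave_mul_conj (x t : ℝ) :
    planeWave σ ρ₁ ρ₂ x t * conj (planeWave σ ρ₁ ρ₂ x t) = 1 := by
  rw [planeWave, ← Complex.exp_conj, ← Complex.exp_add]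
  simp

theorem hasDerivAt_planeWave_x (x t : ℝ) : HasDerivAt (fun y => planeWave σ ρ₁ ρ₂ y t)
    (Complex.I * ((1 + σ * ρ₁ * ρ₂) * (ρ₂ / ρ₁)) * planeWave σ ρ₁ ρ₂ x t) x := by
  have h1 : HasDerivAt (fun y : ℝ => (1 + σ * ρ₁ * ρ₂) * (ρ₂ / ρ₁ * y + ρ₁ / ρ₂ * t))
      ((1 + σ * ρ₁ * ρ₂) * (ρ₂ / ρ₁)) x := by
    simpa using ((hasDerivAt_id x).const_mul (ρ₂ / ρ₁)).add_const (ρ₁ / ρ₂ * t)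
      |>.const_mul (1 + σ * ρ₁ * ρ₂)
  refine HasDerivAt.congr_deriv (h1.ofReal_comp.const_mul Complex.I).cexp ?_
  change planeWave σ ρ₁ ρ₂ x t * _ = _
  push_cast; ring

theorem hasDerivAt_planeWave_t (x t : ℝ) : HasDerivAt (fun y => planeWave σ ρ₁ ρ₂ x y)
    (Complex.I * ((1 + σ * ρ₁ * ρ₂) * (ρ₁ / ρ₂)) * planeWave σ ρ₁ ρ₂ x t) t := by
  have h1 : HasDerivAt (fun y : ℝ => (1 + σ * ρ₁ * ρ₂) * (ρ₂ / ρ₁ * x + ρ₁ / ρ₂ * y))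
      ((1 + σ * ρ₁ * ρ₂) * (ρ₁ / ρ₂)) t := by
    simpa using ((hasDerivAt_id t).const_mul (ρ₁ / ρ₂)).const_add (ρ₂ / ρ₁ * x)
      |>.const_mul (1 + σ * ρ₁ * ρ₂)
  refine HasDerivAt.congr_deriv (h1.ofReal_comp.const_mul Complex.I).cexp ?_
  change planeWave σ ρ₁ ρ₂ x t * _ = _
  push_cast; ring

theorem conj_genTau_zero (x t : ℝ) :
    conj (genTau N σ ρ₁ ρ₂ b 0 0 0 x t) = genTau N σ ρ₁ ρ₂ b (-1) 0 0 x t := by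
  simpa using conj_genTau (σ := σ) (ρ₁ := ρ₁) (ρ₂ := ρ₂) (b := b) (x := x) (t := t) N 0 0 0

theorem Admissible.genTau_neg_one_ne_zero (h : Admissible σ ρ₁ ρ₂) (x t : ℝ) :
    genTau N σ ρ₁ ρ₂ b (-1) 0 0 x t ≠ 0 := by
  rw [← conj_genTau_zero, ne_eq, map_eq_zero]
  exact h.genTau_zero_ne_zero N

theorem norm_sq_genU (x t : ℝ) : ((‖genU N σ ρ₁ ρ₂ b x t‖ ^ 2 : ℝ) : ℂ)
    = ρ₁ ^ 2 * (genTau N σ ρ₁ ρ₂ b (-1) 1 0 x t * genTau N σ ρ₁ ρ₂ b 0 (-1) 0 x t)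
      / (genTau N σ ρ₁ ρ₂ b 0 0 0 x t * genTau N σ ρ₁ ρ₂ b (-1) 0 0 x t) := by
  have h1 : conj (genTau N σ ρ₁ ρ₂ b (-1) 1 0 x t) = genTau N σ ρ₁ ρ₂ b 0 (-1) 0 x t := by
    simpa using conj_genTau (σ := σ) (ρ₁ := ρ₁) (ρ₂ := ρ₂) (b := b) (x := x) (t := t) N (-1) 1 0
  have h2 : conj (genTau N σ ρ₁ ρ₂ b (-1) 0 0 x t) = genTau N σ ρ₁ ρ₂ b 0 0 0 x t := by
    rw [← conj_genTau_zero, Complex.conj_conj]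
  rw [Complex.ofReal_pow, ← Complex.mul_conj', genU, waveU, map_mul, map_mul, map_div₀, h1, h2,
    Complex.conj_ofReal]
  linear_combination ((ρ₁ : ℂ) * (genTau N σ ρ₁ ρ₂ b (-1) 1 0 x t / genTau N σ ρ₁ ρ₂ b (-1) 0 0 x t)
    * (ρ₁ * (genTau N σ ρ₁ ρ₂ b 0 (-1) 0 x t / genTau N σ ρ₁ ρ₂ b 0 0 0 x t)))
      * planeWave_mul_conj (σ := σ) (ρ₁ := ρ₁) (ρ₂ := ρ₂) x t

theorem norm_sq_genV (x t : ℝ) : ((‖genV N σ ρ₁ ρ₂ b x t‖ ^ 2 : ℝ) : ℂ)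
    = ρ₂ ^ 2 * (genTau N σ ρ₁ ρ₂ b (-1) 0 1 x t * genTau N σ ρ₁ ρ₂ b 0 0 (-1) x t)
      / (genTau N σ ρ₁ ρ₂ b 0 0 0 x t * genTau N σ ρ₁ ρ₂ b (-1) 0 0 x t) := by
  have h1 : conj (genTau N σ ρ₁ ρ₂ b (-1) 0 1 x t) = genTau N σ ρ₁ ρ₂ b 0 0 (-1) x t := by
    simpa using conj_genTau (σ := σ) (ρ₁ := ρ₁) (ρ₂ := ρ₂) (b := b) (x := x) (t := t) N (-1) 0 1
  rw [Complex.ofReal_pow, ← Complex.mul_conj', genV, waveV, map_mul, map_mul, map_div₀, h1,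
    conj_genTau_zero, Complex.conj_ofReal]
  linear_combination ((ρ₂ : ℂ) * (genTau N σ ρ₁ ρ₂ b (-1) 0 1 x t / genTau N σ ρ₁ ρ₂ b 0 0 0 x t)
    * (ρ₂ * (genTau N σ ρ₁ ρ₂ b 0 0 (-1) x t / genTau N σ ρ₁ ρ₂ b (-1) 0 0 x t)))
      * planeWave_mul_conj (σ := σ) (ρ₁ := ρ₁) (ρ₂ := ρ₂) x t

theorem deriv_mul_div_mul {c : ℂ} {g f E : ℝ → ℂ} {E' : ℂ} {x : ℝ} (hg : DifferentiableAt ℝ g x)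
    (hf : DifferentiableAt ℝ f x) (hf0 : f x ≠ 0) (hE : HasDerivAt E E' x) :
    deriv (fun y => c * (g y / f y) * E y) x
      = c * ((deriv g x * f x - g x * deriv f x) / f x ^ 2) * E x + c * (g x / f x) * E' :=
  (((hg.hasDerivAt.div hf.hasDerivAt hf0).const_mul c).mul hE).deriv

theorem Admissible.genU_equation (h : Admissible σ ρ₁ ρ₂) (x t : ℝ) :
    Complex.I * deriv (fun y : ℝ => genU N σ ρ₁ ρ₂ b y t) x + genV N σ ρ₁ ρ₂ b x t
      + (σ : ℂ) * genU N σ ρ₁ ρ₂ b x t * ((‖genV N σ ρ₁ ρ₂ b x t‖ ^ 2 : ℝ) : ℂ) = 0 := by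
  have hr : (ρ₁ : ℂ) ≠ 0 := by exact_mod_cast h.left_ne_zero
  have hf := h.genTau_zero_ne_zero (b := b) (x := x) (t := t) N
  have hfb := h.genTau_neg_one_ne_zero (N := N) (b := b) x t
  have e1 := h.bilinear_x_gf (N := N) (b := b) x t
  have e2 := h.bilinear_x_ff (N := N) (b := b) x t
  rw [norm_sq_genV]
  simp only [genU, genV, waveU, waveV]
  rw [deriv_mul_div_mul (hasDerivAt_genTau_x (-1) 1 0 x t).differentiableAt
    (hasDerivAt_genTau_x (-1) 0 0 x t).differentiableAt hfb (hasDerivAt_planeWave_x x t)]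
  generalize genTau N σ ρ₁ ρ₂ b 0 0 0 x t = f at *
  generalize genTau N σ ρ₁ ρ₂ b (-1) 0 0 x t = fb at *
  generalize genTau N σ ρ₁ ρ₂ b (-1) 1 0 x t = g at *
  generalize genTau N σ ρ₁ ρ₂ b (-1) 0 1 x t = k at *
  generalize genTau N σ ρ₁ ρ₂ b 0 0 (-1) x t = kb at *
  generalize deriv (fun y => genTau N σ ρ₁ ρ₂ b (-1) 1 0 y t) x = g' at *
  generalize deriv (fun y => genTau N σ ρ₁ ρ₂ b (-1) 0 0 y t) x = fb' at *
  generalize deriv (fun y => genTau N σ ρ₁ ρ₂ b 0 0 0 y t) x = f' at *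
  field_simp
  -- The combination of the two bilinear equations eliminates `f'`, leaving the Wronskian of `g` and
  -- `f^*`, that is, the derivative of `g/f^*`. The last term accounts for the derivative of the
  -- plane wave.
  linear_combination planeWave σ ρ₁ ρ₂ x t * (fb * e1 + ρ₁ * g * e2
    + (1 + σ * ρ₁ * ρ₂) * ρ₂ * g * fb * f * Complex.I_sq)

theorem Admissible.genV_equation (h : Admissible σ ρ₁ ρ₂) (x t : ℝ) :
    Complex.I * deriv (fun y : ℝ => genV N σ ρ₁ ρ₂ b x y) t + genU N σ ρ₁ ρ₂ b x t
      + (σ : ℂ) * genV N σ ρ₁ ρ₂ b x t * ((‖genU N σ ρ₁ ρ₂ b x t‖ ^ 2 : ℝ) : ℂ) = 0 := by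
  have hr : (ρ₂ : ℂ) ≠ 0 := by exact_mod_cast h.right_ne_zero
  have hf := h.genTau_zero_ne_zero (b := b) (x := x) (t := t) N
  have hfb := h.genTau_neg_one_ne_zero (N := N) (b := b) x t
  have e1 := h.bilinear_t_hf (N := N) (b := b) x t
  have e2 := h.bilinear_t_ff (N := N) (b := b) x t
  rw [norm_sq_genU]
  simp only [genU, genV, waveU, waveV]
  rw [deriv_mul_div_mul (h.hasDerivAt_genTau_t (-1) 0 1 x t).differentiableAt
    (h.hasDerivAt_genTau_t 0 0 0 x t).differentiableAt hf (hasDerivAt_planeWave_t x t)]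
  generalize genTau N σ ρ₁ ρ₂ b 0 0 0 x t = f at *
  generalize genTau N σ ρ₁ ρ₂ b (-1) 0 0 x t = fb at *
  generalize genTau N σ ρ₁ ρ₂ b (-1) 1 0 x t = g at *
  generalize genTau N σ ρ₁ ρ₂ b (-1) 0 1 x t = k at *
  generalize genTau N σ ρ₁ ρ₂ b 0 (-1) 0 x t = gb at *
  generalize deriv (fun y => genTau N σ ρ₁ ρ₂ b (-1) 0 1 x y) t = k' at *
  generalize deriv (fun y => genTau N σ ρ₁ ρ₂ b (-1) 0 0 x y) t = fb' at *
  generalize deriv (fun y => genTau N σ ρ₁ ρ₂ b 0 0 0 x y) t = f' at *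
  field_simp
  linear_combination planeWave σ ρ₁ ρ₂ x t * (f * e1 + ρ₂ * k * e2
    + (1 + σ * ρ₁ * ρ₂) * ρ₁ * k * fb * f * Complex.I_sq)

theorem Admissible.isMTSolution (h : Admissible σ ρ₁ ρ₂) :
    IsMTSolution σ (genU N σ ρ₁ ρ₂ b) (genV N σ ρ₁ ρ₂ b) where
  smooth_u := by
    simp only [genU, waveU, div_eq_mul_inv]
    exact (contDiff_const.mul ((contDiff_genTau _ _ _).mul ((contDiff_genTau _ _ _).inv
      fun z => h.genTau_neg_one_ne_zero z.1 z.2))).mul contDiff_planeWave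
  smooth_v := by
    simp only [genV, waveV, div_eq_mul_inv]
    exact (contDiff_const.mul ((contDiff_genTau _ _ _).mul ((contDiff_genTau _ _ _).inv
      fun z => h.genTau_zero_ne_zero N))).mul contDiff_planeWave
  eq_u := h.genU_equation
  eq_v := h.genV_equation

end Solution

/-! ### Leading behaviour of the determinants at infinity -/

section Asymptotics

variable {ι : Type*} {l : Filter ι} {N : ℕ}

/-- A rank-`2N` Gram-type determinant whose weights are the powers of a small parameter is
dominated by the first `N` weights. -/
theorem tendsto_det_div_prod_pow {A₁ A₂ B₁ B₂ : ι → Matrix (Fin N) (Fin N) ℂ}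
    {K K' : Matrix (Fin N) (Fin N) ℂ} {ε : ι → ℂ} (hA₁ : Tendsto A₁ l (𝓝 K))
    (hA₂ : Tendsto A₂ l (𝓝 K')) (hB₁ : Tendsto B₁ l (𝓝 K)) (hB₂ : Tendsto B₂ l (𝓝 K'))
    (hK : K.det ≠ 0) (hε : Tendsto ε l (𝓝 0)) (hε0 : ∀ᶠ z in l, ε z ≠ 0) :
    Tendsto (fun z => (A₁ z * Matrix.diagonal (fun i : Fin N => ε z ^ (i : ℕ)) * (B₁ z).transpose
      + ε z ^ N • (A₂ z * Matrix.diagonal (fun i : Fin N => ε z ^ (i : ℕ))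
        * (B₂ z).transpose)).det / ∏ i : Fin N, ε z ^ (i : ℕ)) l (𝓝 (K.det ^ 2)) := by
  have hdet : ∀ {A : ι → Matrix (Fin N) (Fin N) ℂ}, Tendsto A l (𝓝 K) →
      Tendsto (fun z => (A z).det) l (𝓝 K.det) := fun hA =>
    ((continuous_id.matrix_det).tendsto K).comp hA
  have hquot : ∀ {A A' : ι → Matrix (Fin N) (Fin N) ℂ}, Tendsto A l (𝓝 K) → Tendsto A' l (𝓝 K') →
      Tendsto (fun z => (A z).det⁻¹ • ((A z).adjugate * A' z)) l
        (𝓝 (K.det⁻¹ • (K.adjugate * K'))) := fun hA hA' =>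
    ((hdet hA).inv₀ hK).smul
      ((((continuous_id.matrix_adjugate).tendsto K).comp hA).mul hA')
  have hmul : ∀ A A' : Matrix (Fin N) (Fin N) ℂ, A.det ≠ 0 →
      A * (A.det⁻¹ • (A.adjugate * A')) = A' := fun A A' h => by
    rw [Matrix.mul_smul, ← Matrix.mul_assoc, Matrix.mul_adjugate, Matrix.smul_mul, Matrix.one_mul,
      smul_smul, inv_mul_cancel₀ h, one_smul]
  -- Writing `A₂ = A₁ X` and `B₂ = B₁ Y` turns the matrix into `A₁ (D + ε^N X D Yᵀ) B₁ᵀ = A₁ D (1 +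
  -- R) B₁ᵀ`. The exponents `N - i + k` in `R` are at least one because `i < N`, so `R` tends to
  -- zero.
  set X := fun z => (A₁ z).det⁻¹ • ((A₁ z).adjugate * A₂ z) with hX
  set Y := fun z => (B₁ z).det⁻¹ • ((B₁ z).adjugate * B₂ z) with hY
  set R : ι → Matrix (Fin N) (Fin N) ℂ := fun z => Matrix.of fun i j =>
    ∑ k : Fin N, ε z ^ (N - (i : ℕ) + k) * (X z i k * Y z j k) with hR
  have hRe : ∀ z i j, R z i j
      = ∑ k : Fin N, ε z ^ (N - (i : ℕ) + k) * (X z i k * Y z j k) := fun _ _ _ => rfl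
  have hentry : ∀ {F : ι → Matrix (Fin N) (Fin N) ℂ} {G : Matrix (Fin N) (Fin N) ℂ},
      Tendsto F l (𝓝 G) → ∀ i j, Tendsto (fun z => F z i j) l (𝓝 (G i j)) := fun hF i j =>
    (tendsto_pi_nhds.mp (tendsto_pi_nhds.mp hF i)) j
  have hR0 : Tendsto R l (𝓝 0) := by
    refine tendsto_pi_nhds.mpr fun i => tendsto_pi_nhds.mpr fun j => ?_
    rw [show (0 : Matrix (Fin N) (Fin N) ℂ) i j = ∑ k : Fin N, (0 : ℂ) by simp]
    refine tendsto_finsetSum _ fun k _ => ?_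
    have h1 : Tendsto (fun z => ε z ^ (N - (i : ℕ) + k)) l (𝓝 0) := by
      have := hε.pow (N - (i : ℕ) + k)
      rwa [zero_pow (by omega)] at this
    have h2 := (hentry (hquot hA₁ hA₂) i k).mul (hentry (hquot hB₁ hB₂) j k)
    have h3 := h1.mul h2
    rw [zero_mul] at h3
    exact h3
  have hlim : Tendsto (fun z => (A₁ z).det * (1 + R z).det * (B₁ z).det) l (𝓝 (K.det ^ 2)) := by
    have h1 : Tendsto (fun z => (1 + R z).det) l (𝓝 1) := by
      have := ((continuous_id.matrix_det).tendsto (1 + 0)).comp (hR0.const_add 1)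
      simpa [Function.comp_def] using this
    have := ((hdet hA₁).mul h1).mul (hdet hB₁)
    rwa [mul_one, ← sq] at this
  refine hlim.congr' ?_
  filter_upwards [(hdet hA₁).eventually_ne hK, (hdet hB₁).eventually_ne hK, hε0] with z hz1 hz2 hz3
  set D := Matrix.diagonal (fun i : Fin N => ε z ^ (i : ℕ)) with hD
  have hDR : D * R z = ε z ^ N • (X z * D * (Y z).transpose) := by
    ext i j
    rw [hD, Matrix.diagonal_mul, Matrix.smul_apply, Matrix.mul_apply, smul_eq_mul, hRe,
      Finset.mul_sum, Finset.mul_sum]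
    refine Finset.sum_congr rfl fun k _ => ?_
    rw [Matrix.mul_diagonal, Matrix.transpose_apply, ← mul_assoc, ← pow_add,
      show (i : ℕ) + (N - i + k) = N + k by omega, pow_add]
    ring
  have hfac : A₁ z * D * (B₁ z).transpose + ε z ^ N • (A₂ z * D * (B₂ z).transpose)
      = A₁ z * (D * (1 + R z)) * (B₁ z).transpose := by
    rw [Matrix.mul_add, Matrix.mul_one, hDR, Matrix.mul_add, Matrix.add_mul, Matrix.mul_smul,
      Matrix.smul_mul]
    congr 2
    conv_lhs => rw [← hmul (A₁ z) (A₂ z) hz1, ← hmul (B₁ z) (B₂ z) hz2]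
    rw [Matrix.transpose_mul]
    simp only [Matrix.mul_assoc, hX, hY]
  rw [hfac, Matrix.det_mul, Matrix.det_mul, Matrix.det_mul, Matrix.det_transpose, hD,
    Matrix.det_diagonal]
  have : ∏ i : Fin N, ε z ^ (i : ℕ) ≠ 0 := Finset.prod_ne_zero_iff.mpr fun i _ => pow_ne_zero _ hz3
  field_simp

/-- The leading coefficients of the Schur polynomials `S_{2i+1-γ}`. -/
noncomputable def leadingMatrix (N k : ℕ) : Matrix (Fin N) (Fin N) ℂ :=
  Matrix.of fun i γ => if k + (γ : ℕ) ≤ 2 * (i : ℕ) + 1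
    then (((2 * (i : ℕ) + 1 - (k + γ)).factorial : ℕ) : ℂ)⁻¹ else 0

/-- With `1/(2i+1)!` taken out of each row, the entries are descending factorials of `2i + 1`, monic
of degree `γ`. The determinant is therefore Vandermonde at distinct nodes; the zeros for `γ > 2i +
1` are automatic. -/
theorem det_leadingMatrix_ne_zero (N : ℕ) : (leadingMatrix N 0).det ≠ 0 := by
  have h : leadingMatrix N 0
      = Matrix.diagonal (fun i : Fin N => (((2 * (i : ℕ) + 1).factorial : ℕ) : ℂ)⁻¹)
        * Matrix.of fun i γ : Fin N =>
          (descPochhammer ℂ (γ : ℕ)).eval (((2 * (i : ℕ) + 1 : ℕ) : ℂ)) := by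
    ext i γ
    rw [Matrix.diagonal_mul, Matrix.of_apply, descPochhammer_eval_eq_descFactorial, leadingMatrix,
      Matrix.of_apply, zero_add]
    split_ifs with hle
    · have h1 := Nat.factorial_mul_descFactorial hle
      have h2 : ((2 * (i : ℕ) + 1).factorial : ℂ) ≠ 0 := by exact_mod_cast Nat.factorial_ne_zero _
      have h3 : ((2 * (i : ℕ) + 1 - γ).factorial : ℂ) ≠ 0 := by
        exact_mod_cast Nat.factorial_ne_zero _
      rw [← h1]
      push_cast
      rw [← h1] at h2
      push_cast at h2
      have h4 := right_ne_zero_of_mul h2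
      field_simp
    · rw [Nat.descFactorial_of_lt (by omega)]
      simp
  rw [h, Matrix.det_mul, Matrix.det_diagonal]
  refine mul_ne_zero (Finset.prod_ne_zero_iff.mpr fun i _ => inv_ne_zero ?_) ?_
  · exact_mod_cast Nat.factorial_ne_zero _
  · rw [← Matrix.det_eval_matrixOfPolynomials_eq_det_vandermonde
      (fun i : Fin N => ((2 * (i : ℕ) + 1 : ℕ) : ℂ)) (fun γ => descPochhammer ℂ (γ : ℕ))
      (fun i => descPochhammer_natDegree ..) (fun i => monic_descPochhammer ..),
      Matrix.det_vandermonde_ne_zero_iff]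
    intro i j hij
    have : 2 * (i : ℕ) + 1 = 2 * (j : ℕ) + 1 := Nat.cast_injective (R := ℂ) hij
    ext; omega

/-- The Schur polynomial `S_{2i+1-γ}(x + γ s)`, scaled by the size `c` of `x_1`. -/
noncomputable def scaledSchur (c : ℂ) (x s : ℕ → ℂ) (i γ : ℕ) : ℂ :=
  if γ ≤ 2 * i + 1 then
    schur (2 * i + 1 - γ) (fun r => x r + (γ : ℂ) * s r) / c ^ (2 * i + 1 - γ) else 0

theorem mEntry_eq_scaled {c d : ℂ} (hc : c ≠ 0) (hd : d ≠ 0) (xp xm s : ℕ → ℂ) {i j : ℕ}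
    (hi : i < N) : mEntry xp xm s (2 * i + 1) (2 * j + 1)
      = c ^ (2 * i + 1) * (∑ γ ∈ Finset.range (N + N), (4 * (c * d))⁻¹ ^ γ
          * (scaledSchur c xp s i γ * scaledSchur d xm s j γ)) * d ^ (2 * j + 1) := by
  have hsub : Finset.range (min (2 * i + 1) (2 * j + 1) + 1) ⊆ Finset.range (N + N) :=
    Finset.range_subset_range.mpr (by omega)
  rw [mEntry, ← Finset.sum_subset hsub, Finset.mul_sum, Finset.sum_mul]
  · refine Finset.sum_congr rfl fun γ hγ => ?_
    rw [Finset.mem_range] at hγ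
    rw [scaledSchur, scaledSchur, if_pos (by omega), if_pos (by omega),
      ← Nat.sub_add_cancel (show γ ≤ 2 * i + 1 by omega),
      ← Nat.sub_add_cancel (show γ ≤ 2 * j + 1 by omega)]
    simp only [Nat.add_sub_cancel, pow_add _ _ γ, inv_pow, mul_pow]
    field_simp
  · intro γ _ hγ
    rw [Finset.mem_range] at hγ
    rw [scaledSchur, scaledSchur]
    by_cases h : γ ≤ 2 * i + 1
    · rw [if_neg (show ¬ γ ≤ 2 * j + 1 by omega), mul_zero, mul_zero]
    · rw [if_neg h, zero_mul, mul_zero]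

theorem tendsto_const_div_pow {c : ι → ℂ}
    (hc : Tendsto (fun z => ‖c z‖) l atTop) (w : ℂ) {r : ℕ} (hr : 1 ≤ r) :
    Tendsto (fun z => w / c z ^ r) l (𝓝 0) := by
  rw [tendsto_zero_iff_norm_tendsto_zero]
  simp only [norm_div, norm_pow]
  exact tendsto_const_nhds.div_atTop ((tendsto_pow_atTop (by omega)).comp hc)

theorem tendsto_scaledSchur {x : ι → ℕ → ℂ} {c : ι → ℂ} (hc : Tendsto (fun z => ‖c z‖) l atTop)
    (h1 : Tendsto (fun z => x z 1 / c z) l (𝓝 1))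
    (h : ∀ r, 2 ≤ r → Tendsto (fun z => x z r / c z ^ r) l (𝓝 0)) (s : ℕ → ℂ) (k : ℕ) :
    Tendsto (fun z => (Matrix.of fun i γ : Fin N => scaledSchur (c z) (x z) s i (k + γ))) l
      (𝓝 (leadingMatrix N k)) := by
  refine tendsto_pi_nhds.mpr fun i => tendsto_pi_nhds.mpr fun γ => ?_
  simp only [Matrix.of_apply, scaledSchur, leadingMatrix]
  split_ifs with hle
  · refine tendsto_schur_div_pow (fun z r => x z r + ((k + γ : ℕ) : ℂ) * s r) c ?_ ?_ ?_ _
    · filter_upwards [hc.eventually_gt_atTop 0] with z hz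
      exact norm_pos_iff.mp hz
    · have := h1.add (tendsto_const_div_pow hc (((k + γ : ℕ) : ℂ) * s 1) le_rfl)
      simpa [add_div] using this
    · intro r hr
      have := (h r hr).add (tendsto_const_div_pow hc (((k + γ : ℕ) : ℂ) * s r)
        (one_le_two.trans hr))
      simpa [add_div] using this
  · exact tendsto_const_nhds

/-- Scaling rows and columns leaves a sum over `γ < 2N` with weights `(4cd)^{-γ}`. The first `N`
weights give the leading term, whose coefficient is independent of the other variables. -/
theorem tendsto_schurDet_div {xp xm : ι → ℕ → ℂ} {c d : ι → ℂ}
    (hc : Tendsto (fun z => ‖c z‖) l atTop) (hd : Tendsto (fun z => ‖d z‖) l atTop)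
    (hp1 : Tendsto (fun z => xp z 1 / c z) l (𝓝 1))
    (hp : ∀ r, 2 ≤ r → Tendsto (fun z => xp z r / c z ^ r) l (𝓝 0))
    (hm1 : Tendsto (fun z => xm z 1 / d z) l (𝓝 1))
    (hm : ∀ r, 2 ≤ r → Tendsto (fun z => xm z r / d z ^ r) l (𝓝 0)) (s : ℕ → ℂ) (N : ℕ) :
    Tendsto (fun z => schurDet N (xp z) (xm z) s
      / ((∏ i : Fin N, c z ^ (2 * (i : ℕ) + 1)) * (∏ i : Fin N, (4 * (c z * d z))⁻¹ ^ (i : ℕ))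
          * ∏ i : Fin N, d z ^ (2 * (i : ℕ) + 1))) l (𝓝 ((leadingMatrix N 0).det ^ 2)) := by
  have hc0 : ∀ᶠ z in l, c z ≠ 0 := by
    filter_upwards [hc.eventually_gt_atTop 0] with z hz
    exact norm_pos_iff.mp hz
  have hd0 : ∀ᶠ z in l, d z ≠ 0 := by
    filter_upwards [hd.eventually_gt_atTop 0] with z hz
    exact norm_pos_iff.mp hz
  have hε0 : ∀ᶠ z in l, (4 * (c z * d z))⁻¹ ≠ 0 := by
    filter_upwards [hc0, hd0] with z h1 h2
    exact inv_ne_zero (mul_ne_zero (by norm_num) (mul_ne_zero h1 h2))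
  have hε : Tendsto (fun z => (4 * (c z * d z))⁻¹) l (𝓝 0) := by
    rw [tendsto_zero_iff_norm_tendsto_zero]
    simp only [norm_inv, norm_mul]
    refine tendsto_inv_atTop_zero.comp (Tendsto.const_mul_atTop ?_ (hc.atTop_mul_atTop₀ hd))
    norm_num
  have key := tendsto_det_div_prod_pow (tendsto_scaledSchur (N := N) hc hp1 hp s 0)
    (tendsto_scaledSchur (N := N) hc hp1 hp s N) (tendsto_scaledSchur (N := N) hd hm1 hm s 0)
    (tendsto_scaledSchur (N := N) hd hm1 hm s N) (det_leadingMatrix_ne_zero N) hε hε0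
  refine key.congr' ?_
  filter_upwards [hc0, hd0] with z hz1 hz2
  set ε := (4 * (c z * d z))⁻¹ with hεz
  set S := Matrix.of (fun i γ : Fin N => scaledSchur (c z) (xp z) s i (0 + γ))
      * Matrix.diagonal (fun i : Fin N => ε ^ (i : ℕ))
      * (Matrix.of (fun i γ : Fin N => scaledSchur (d z) (xm z) s i (0 + γ))).transpose
    + ε ^ N • (Matrix.of (fun i γ : Fin N => scaledSchur (c z) (xp z) s i (N + γ))
      * Matrix.diagonal (fun i : Fin N => ε ^ (i : ℕ))
      * (Matrix.of (fun i γ : Fin N => scaledSchur (d z) (xm z) s i (N + γ))).transpose) with hS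
  have hfac : (Matrix.of fun i j : Fin N =>
      mEntry (xp z) (xm z) s (2 * (i : ℕ) + 1) (2 * (j : ℕ) + 1))
      = Matrix.diagonal (fun i : Fin N => c z ^ (2 * (i : ℕ) + 1)) * S
        * Matrix.diagonal (fun i : Fin N => d z ^ (2 * (i : ℕ) + 1)) := by
    ext i j
    rw [Matrix.of_apply, mEntry_eq_scaled hz1 hz2 _ _ _ i.isLt, Matrix.mul_diagonal,
      Matrix.diagonal_mul, ← hεz]
    congr 2
    rw [Finset.sum_range_add, Finset.sum_range, Finset.sum_range, hS, Matrix.add_apply,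
      Matrix.smul_apply, Matrix.mul_apply, Matrix.mul_apply, smul_eq_mul, Finset.mul_sum]
    congr 1
    · refine Finset.sum_congr rfl fun γ _ => ?_
      simp only [Matrix.mul_diagonal, Matrix.transpose_apply, Matrix.of_apply, zero_add]
      ring
    · refine Finset.sum_congr rfl fun γ _ => ?_
      simp only [Matrix.mul_diagonal, Matrix.transpose_apply, Matrix.of_apply, pow_add]
      ring
  rw [schurDet, hfac, Matrix.det_mul, Matrix.det_mul, Matrix.det_diagonal, Matrix.det_diagonal]
  have h1 : ∏ i : Fin N, c z ^ (2 * (i : ℕ) + 1) ≠ 0 :=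
    Finset.prod_ne_zero_iff.mpr fun i _ => pow_ne_zero _ hz1
  have h2 : ∏ i : Fin N, d z ^ (2 * (i : ℕ) + 1) ≠ 0 :=
    Finset.prod_ne_zero_iff.mpr fun i _ => pow_ne_zero _ hz2
  rw [mul_right_comm _ S.det, mul_right_comm _ (∏ i : Fin N, ε ^ (i : ℕ))]
  exact (mul_div_mul_left _ _ (mul_ne_zero h1 h2)).symm

end Asymptotics

/-! ### Convergence to the plane wave -/

section Background

variable {N : ℕ} {σ ρ₁ ρ₂ : ℝ} {b : ℕ → ℂ}

theorem Admissible.alphaCoeff_one_eq_ofReal (h : Admissible σ ρ₁ ρ₂) :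
    ∃ α : ℝ, α ≠ 0 ∧ alphaCoeff σ ρ₁ ρ₂ 1 = α := by
  refine ⟨ρ₂ * rhoHat σ ρ₁ ρ₂ / ρ₁, div_ne_zero (mul_ne_zero h.right_ne_zero h.rhoHat_pos.ne')
    h.left_ne_zero, ?_⟩
  rw [alphaCoeff_one]; push_cast; ring

/-- The imaginary part comes from that of `(ρ̂ + iρ)²`, which is `2 ρ̂ ρ > 0`. Since `α_1` is real,
this makes `α_1` and `β_1` independent over `ℝ`. -/
theorem Admissible.betaCoeff_one_im_ne_zero (h : Admissible σ ρ₁ ρ₂) :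
    (betaCoeff σ ρ₁ ρ₂ 1).im ≠ 0 := by
  have h1 := h.rho_pos
  have h2 := h.rhoHat_pos
  have hw := ofReal_add_I_mul_ne_zero h2 (rho σ ρ₁ ρ₂)
  have hk : betaCoeff σ ρ₁ ρ₂ 1 = ((ρ₁ * rho σ ρ₁ ρ₂ * rhoHat σ ρ₁ ρ₂ / ρ₂ : ℝ) : ℂ)
      * (((rhoHat σ ρ₁ ρ₂ : ℂ) + Complex.I * (rho σ ρ₁ ρ₂ : ℂ)) ^ 2)⁻¹ := by
    rw [h.betaCoeff_one, ← div_div, div_eq_mul_inv _ (_ ^ 2)]; push_cast; rfl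
  rw [hk, Complex.im_ofReal_mul, Complex.inv_im]
  refine mul_ne_zero (div_ne_zero (mul_ne_zero (mul_ne_zero h.left_ne_zero h1.ne') h2.ne')
    h.right_ne_zero) (div_ne_zero (neg_ne_zero.mpr ?_)
      (Complex.normSq_pos.mpr (pow_ne_zero 2 hw)).ne')
  have : (((rhoHat σ ρ₁ ρ₂ : ℂ) + Complex.I * (rho σ ρ₁ ρ₂ : ℂ)) ^ 2).im
      = 2 * (rhoHat σ ρ₁ ρ₂ * rho σ ρ₁ ρ₂) := by
    simp [sq]; ring
  rw [this]
  positivity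

variable (σ ρ₁ ρ₂) in
/-- The part `α_1 x + β_1 t` of `x_1⁺` that grows at infinity. -/
noncomputable def leadingForm : ℝ × ℝ →ₗ[ℝ] ℂ where
  toFun z := alphaCoeff σ ρ₁ ρ₂ 1 * z.1 + betaCoeff σ ρ₁ ρ₂ 1 * z.2
  map_add' z w := by simp only [Prod.fst_add, Prod.snd_add]; push_cast; ring
  map_smul' c z := by
    simp only [Prod.smul_fst, Prod.smul_snd, smul_eq_mul, Complex.real_smul, RingHom.id_apply]
    push_cast; ring

theorem leadingForm_apply (z : ℝ × ℝ) :
    leadingForm σ ρ₁ ρ₂ z = alphaCoeff σ ρ₁ ρ₂ 1 * z.1 + betaCoeff σ ρ₁ ρ₂ 1 * z.2 := rfl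

theorem Admissible.leadingForm_surjective (h : Admissible σ ρ₁ ρ₂) :
    Function.Surjective (leadingForm σ ρ₁ ρ₂) := by
  intro w
  obtain ⟨α, hα, hα1⟩ := h.alphaCoeff_one_eq_ofReal
  have hβ := h.betaCoeff_one_im_ne_zero
  refine ⟨((w.re - (betaCoeff σ ρ₁ ρ₂ 1).re * (w.im / (betaCoeff σ ρ₁ ρ₂ 1).im)) / α,
    w.im / (betaCoeff σ ρ₁ ρ₂ 1).im), ?_⟩
  rw [leadingForm_apply, hα1]
  apply Complex.ext
  · simp only [Complex.add_re, Complex.re_mul_ofReal, Complex.ofReal_re]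
    field_simp; ring
  · simp only [Complex.add_im, Complex.im_mul_ofReal, Complex.ofReal_im]
    field_simp; ring

theorem Admissible.exists_norm_le_leadingForm (h : Admissible σ ρ₁ ρ₂) :
    ∃ K : ℝ, 0 < K ∧ ∀ z, ‖z‖ ≤ K * ‖leadingForm σ ρ₁ ρ₂ z‖ := by
  have hinj : Function.Injective (leadingForm σ ρ₁ ρ₂) :=
    (LinearMap.injective_iff_surjective_of_finrank_eq_finrank (by simp)).mpr
      h.leadingForm_surjective
  obtain ⟨K, hK, hL⟩ := (leadingForm σ ρ₁ ρ₂).exists_antilipschitzWith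
    (LinearMap.ker_eq_bot.mpr hinj)
  exact ⟨K, hK, fun z => by simpa using hL.le_mul_dist z 0⟩

theorem Admissible.tendsto_norm_leadingForm (h : Admissible σ ρ₁ ρ₂) :
    Tendsto (fun z => ‖leadingForm σ ρ₁ ρ₂ z‖) (cocompact (ℝ × ℝ)) atTop := by
  obtain ⟨K, hK, hle⟩ := h.exists_norm_le_leadingForm
  refine tendsto_atTop_mono (fun z => ?_)
    ((tendsto_norm_cocompact_atTop (E := ℝ × ℝ)).const_mul_atTop (inv_pos.mpr hK))
  rw [inv_mul_le_iff₀ hK]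
  exact hle z

/-- All variables grow at most linearly in `(x, t)`, so those with index at least two are negligible
against the corresponding power of `x_1`. -/
theorem Admissible.tendsto_div_leadingForm_pow (h : Admissible σ ρ₁ ρ₂) {p : ℝ × ℝ → ℝ}
    (hp : ∀ z, ‖p z‖ ≤ ‖z‖) (w : ℂ) {r : ℕ} (hr : 2 ≤ r) :
    Tendsto (fun z => w * p z / leadingForm σ ρ₁ ρ₂ z ^ r) (cocompact (ℝ × ℝ)) (𝓝 0) := by
  obtain ⟨K, hK, hle⟩ := h.exists_norm_le_leadingForm
  have h1 := tendsto_const_div_pow h.tendsto_norm_leadingForm w (r := r - 1) (by omega)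
  rw [tendsto_zero_iff_norm_tendsto_zero] at h1 ⊢
  have h2 := h1.const_mul K
  rw [mul_zero] at h2
  refine squeeze_zero' (Eventually.of_forall fun z => norm_nonneg _) ?_ h2
  filter_upwards [h.tendsto_norm_leadingForm.eventually_gt_atTop 0] with z hz
  obtain ⟨q, rfl⟩ : ∃ q, r = q + 1 := ⟨r - 1, by omega⟩
  rw [norm_div, norm_div, norm_mul, norm_pow, norm_pow, Nat.add_sub_cancel, Complex.norm_real,
    pow_succ, ← mul_div_assoc, div_le_div_iff₀ (by positivity) (by positivity)]
  have h3 := (hp z).trans (hle z)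
  calc ‖w‖ * ‖p z‖ * ‖leadingForm σ ρ₁ ρ₂ z‖ ^ q
      ≤ ‖w‖ * (K * ‖leadingForm σ ρ₁ ρ₂ z‖) * ‖leadingForm σ ρ₁ ρ₂ z‖ ^ q := by gcongr
    _ = _ := by ring

theorem Admissible.tendsto_genPlus_one (h : Admissible σ ρ₁ ρ₂) (n k l : ℤ) :
    Tendsto (fun z : ℝ × ℝ => genPlus σ ρ₁ ρ₂ b n k l z.1 z.2 1 / leadingForm σ ρ₁ ρ₂ z)
      (cocompact (ℝ × ℝ)) (𝓝 1) := by
  have h1 := (tendsto_const_div_pow h.tendsto_norm_leadingForm (((n : ℂ) + 1 / 2)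
    * thetaCoeff σ ρ₁ ρ₂ 1 + k * varthetaCoeff σ ρ₁ ρ₂ 1 + l * zetaCoeff 1 + b 1)
    le_rfl).const_add 1
  rw [add_zero] at h1
  refine h1.congr' ?_
  filter_upwards [h.tendsto_norm_leadingForm.eventually_gt_atTop 0] with z hz
  have hz0 := norm_pos_iff.mp hz
  rw [pow_one, one_add_div hz0, genPlus, leadingForm_apply]
  ring

theorem Admissible.tendsto_genPlus_of_two_le (h : Admissible σ ρ₁ ρ₂) (n k l : ℤ) {r : ℕ}
    (hr : 2 ≤ r) :
    Tendsto (fun z : ℝ × ℝ => genPlus σ ρ₁ ρ₂ b n k l z.1 z.2 r / leadingForm σ ρ₁ ρ₂ z ^ r)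
      (cocompact (ℝ × ℝ)) (𝓝 0) := by
  have h1 := ((h.tendsto_div_leadingForm_pow (p := Prod.fst) norm_fst_le
      (alphaCoeff σ ρ₁ ρ₂ r) hr).add
    (h.tendsto_div_leadingForm_pow (p := Prod.snd) norm_snd_le (betaCoeff σ ρ₁ ρ₂ r) hr)).add
    (tendsto_const_div_pow h.tendsto_norm_leadingForm (((n : ℂ) + 1 / 2)
      * thetaCoeff σ ρ₁ ρ₂ r + k * varthetaCoeff σ ρ₁ ρ₂ r + l * zetaCoeff r + b r)
      (r := r) (by omega))
  rw [add_zero, add_zero] at h1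
  refine h1.congr fun z => ?_
  rw [genPlus]
  ring

theorem genMinus_eq_conj (n k l : ℤ) (x t : ℝ) (r : ℕ) : genMinus σ ρ₁ ρ₂ b n k l x t r
    = conj (genPlus σ ρ₁ ρ₂ b (-1 - n) (-k) (-l) x t r) := by
  rw [conj_genPlus]
  congr 1 <;> ring

/-- All the `σ_{n,k,l}` have the same leading behaviour at infinity. -/
theorem Admissible.tendsto_genTau_div (h : Admissible σ ρ₁ ρ₂) (N : ℕ) (b : ℕ → ℂ) :
    ∃ (D : ℝ × ℝ → ℂ) (κ : ℂ), κ ≠ 0 ∧ ∀ n k l : ℤ, Tendsto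
      (fun z : ℝ × ℝ => genTau N σ ρ₁ ρ₂ b n k l z.1 z.2 / D z) (cocompact (ℝ × ℝ)) (𝓝 κ) := by
  refine ⟨fun z => (∏ i : Fin N, leadingForm σ ρ₁ ρ₂ z ^ (2 * (i : ℕ) + 1))
    * (∏ i : Fin N, (4 * (leadingForm σ ρ₁ ρ₂ z * conj (leadingForm σ ρ₁ ρ₂ z)))⁻¹ ^ (i : ℕ))
    * ∏ i : Fin N, conj (leadingForm σ ρ₁ ρ₂ z) ^ (2 * (i : ℕ) + 1), _,
    pow_ne_zero 2 (det_leadingMatrix_ne_zero N), fun n k l => ?_⟩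
  refine tendsto_schurDet_div (c := leadingForm σ ρ₁ ρ₂)
    (d := fun z => conj (leadingForm σ ρ₁ ρ₂ z)) h.tendsto_norm_leadingForm ?_
    (h.tendsto_genPlus_one n k l) (fun r hr => h.tendsto_genPlus_of_two_le n k l hr) ?_
    (fun r hr => ?_) sCoeff N
  · simpa only [Complex.norm_conj] using h.tendsto_norm_leadingForm
  · have := (Complex.continuous_conj.tendsto _).comp
      (h.tendsto_genPlus_one (b := b) (-1 - n) (-k) (-l))
    simpa only [Function.comp_def, map_div₀, map_one, ← genMinus_eq_conj] using this
  · have := (Complex.continuous_conj.tendsto _).comp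
      (h.tendsto_genPlus_of_two_le (b := b) (-1 - n) (-k) (-l) hr)
    simpa only [Function.comp_def, map_div₀, map_pow, map_zero, ← genMinus_eq_conj] using this

theorem Admissible.tendsto_genTau_div_genTau (h : Admissible σ ρ₁ ρ₂) (n k l n' k' l' : ℤ) :
    Tendsto (fun z : ℝ × ℝ =>
        genTau N σ ρ₁ ρ₂ b n k l z.1 z.2 / genTau N σ ρ₁ ρ₂ b n' k' l' z.1 z.2)
      (cocompact (ℝ × ℝ)) (𝓝 1) := by
  obtain ⟨D, κ, hκ, hD⟩ := h.tendsto_genTau_div N b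
  have h1 := (hD n k l).div (hD n' k' l') hκ
  rw [div_self hκ] at h1
  refine h1.congr' ?_
  filter_upwards [(hD n k l).eventually_ne hκ] with z hz
  exact div_div_div_cancel_right₀ (fun h0 => hz (by rw [h0, div_zero])) _ _

theorem norm_planeWave (x t : ℝ) : ‖planeWave σ ρ₁ ρ₂ x t‖ = 1 := by
  rw [planeWave, mul_comm, Complex.norm_exp_ofReal_mul_I]

theorem tendsto_mul_planeWave_sub {q : ℝ × ℝ → ℂ} (hq : Tendsto q (cocompact (ℝ × ℝ)) (𝓝 1))
    (c : ℂ) :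
    Tendsto (fun z : ℝ × ℝ => c * q z * planeWave σ ρ₁ ρ₂ z.1 z.2 - c * planeWave σ ρ₁ ρ₂ z.1 z.2)
      (cocompact (ℝ × ℝ)) (𝓝 0) := by
  have h1 := ((hq.sub_const 1).const_mul c).norm
  rw [sub_self, mul_zero, norm_zero] at h1
  rw [tendsto_zero_iff_norm_tendsto_zero]
  refine h1.congr fun z => ?_
  -- The plane wave has modulus one, so the error is that of the quotient of determinants.
  rw [show c * q z * planeWave σ ρ₁ ρ₂ z.1 z.2 - c * planeWave σ ρ₁ ρ₂ z.1 z.2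
    = c * (q z - 1) * planeWave σ ρ₁ ρ₂ z.1 z.2 by ring, norm_mul _ (planeWave _ _ _ _ _),
    norm_planeWave, mul_one]

theorem Admissible.isRogueWave_gen (h : Admissible σ ρ₁ ρ₂) :
    IsRogueWave σ ρ₁ ρ₂ (genU N σ ρ₁ ρ₂ b) (genV N σ ρ₁ ρ₂ b) where
  solution := h.isMTSolution
  background_u := tendsto_mul_planeWave_sub (h.tendsto_genTau_div_genTau _ _ _ _ _ _) _
  background_v := tendsto_mul_planeWave_sub (h.tendsto_genTau_div_genTau _ _ _ _ _ _) _

end Background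

/-! ### Reduction to odd variables and removal of `b_1` -/

section Reduction

variable {N : ℕ} {σ ρ₁ ρ₂ : ℝ}

theorem sEven_eq_sCoeff : sEven = sCoeff := by
  funext r
  rw [sEven]
  split_ifs with hr
  · rfl
  · obtain ⟨m, rfl⟩ := Nat.not_even_iff_odd.mp hr
    rw [sCoeff_odd]

theorem Admissible.genPlus_eq_redPlus (h : Admissible σ ρ₁ ρ₂) {b : ℕ → ℂ} (hb : b 1 = 0)
    (n k l : ℤ) (x t : ℝ) {r : ℕ} (hr : Odd r) :
    genPlus σ ρ₁ ρ₂ b n k l x t r = redPlus σ ρ₁ ρ₂ b n k l x t r := by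
  rw [genPlus, redPlus]
  split_ifs with h1
  · subst h1
    rw [alphaCoeff_one, h.betaCoeff_one, h.thetaCoeff_one, h.varthetaCoeff_one, zetaCoeff_eq,
      if_pos rfl, hb]
    ring
  · rw [zetaCoeff_eq, if_neg h1]
    ring

theorem redMinus_eq_conj (a : ℕ → ℂ) (n k l : ℤ) (x t : ℝ) (r : ℕ) :
    redMinus σ ρ₁ ρ₂ a n k l x t r = conj (redPlus σ ρ₁ ρ₂ a (-1 - n) (-k) (-l) x t r) := by
  rw [redMinus, redPlus]
  split_ifs with h1 h2
  · simp only [map_add, map_mul, map_div₀, map_pow, Complex.conj_ofReal, Complex.conj_I,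
      map_one, map_ofNat, map_intCast]
    push_cast
    ring
  · simp only [map_add, map_mul, conj_alphaCoeff, Complex.conj_ofReal, map_div₀, map_one,
      map_ofNat, map_intCast]
    push_cast
    ring
  · rw [map_zero]

theorem Admissible.genMinus_eq_redMinus (h : Admissible σ ρ₁ ρ₂) {b : ℕ → ℂ} (hb : b 1 = 0)
    (n k l : ℤ) (x t : ℝ) {r : ℕ} (hr : Odd r) :
    genMinus σ ρ₁ ρ₂ b n k l x t r = redMinus σ ρ₁ ρ₂ b n k l x t r := by
  rw [redMinus_eq_conj, genMinus_eq_conj, h.genPlus_eq_redPlus hb _ _ _ _ _ hr]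

/-- The quotient of the two generating series is the exponential of the even-indexed differences. -/
theorem exists_even_mul_of_odd_eq {x y : ℕ → ℂ} (h : ∀ r, Odd r → x r = y r) :
    ∃ e, IsEvenSeries e ∧ PowerSeries.constantCoeff e = 1 ∧ schurSeries x = e * schurSeries y := by
  refine ⟨schurSeries fun r => x r - y r, isEvenSeries_schurSeries fun r hr => ?_,
    constantCoeff_schurSeries _, ?_⟩
  · rw [h r hr, sub_self]
  · rw [← schurSeries_add]
    simp only [sub_add_cancel]

/-- The determinants only depend on the variables with odd index. -/
theorem schurDet_congr_odd (N : ℕ) {xp xm yp ym : ℕ → ℂ} (hp : ∀ r, Odd r → xp r = yp r)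
    (hm : ∀ r, Odd r → xm r = ym r) : schurDet N xp xm sCoeff = schurDet N yp ym sCoeff := by
  obtain ⟨e, he, he1, hx⟩ := exists_even_mul_of_odd_eq hp
  obtain ⟨e', he', he1', hx'⟩ := exists_even_mul_of_odd_eq hm
  rw [schurDet_eq_det_pairing, schurDet_eq_det_pairing, hx, hx', det_pairing_even_mul_left he,
    det_pairing_even_mul_right he', he1, he1']
  simp

theorem Admissible.genTau_eq_redTau (h : Admissible σ ρ₁ ρ₂) {b : ℕ → ℂ} (hb : b 1 = 0) (N : ℕ) :
    genTau N σ ρ₁ ρ₂ b = redTau N σ ρ₁ ρ₂ b := by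
  funext n k l x t
  rw [genTau, redTau, sEven_eq_sCoeff]
  exact schurDet_congr_odd N (fun r hr => h.genPlus_eq_redPlus hb n k l x t hr)
    (fun r hr => h.genMinus_eq_redMinus hb n k l x t hr)

theorem redPlus_congr {a a' : ℕ → ℂ} (ha : ∀ r, 1 ≤ r → r < N → a (2 * r + 1) = a' (2 * r + 1))
    (n k l : ℤ) (x t : ℝ) {r : ℕ} (hr : r < 2 * N) :
    redPlus σ ρ₁ ρ₂ a n k l x t r = redPlus σ ρ₁ ρ₂ a' n k l x t r := by
  rw [redPlus, redPlus]
  split_ifs with h1 h2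
  · rfl
  · obtain ⟨m, rfl⟩ := h2
    rw [ha m (by omega) (by omega)]
  · rfl

theorem schurDet_congr (N : ℕ) {xp xm yp ym : ℕ → ℂ} (s : ℕ → ℂ) (hp : ∀ r < 2 * N, xp r = yp r)
    (hm : ∀ r < 2 * N, xm r = ym r) : schurDet N xp xm s = schurDet N yp ym s := by
  refine congrArg Matrix.det (Matrix.ext fun i j => ?_)
  simp only [Matrix.of_apply, mEntry]
  refine Finset.sum_congr rfl fun γ _ => ?_
  have h1 : schur (2 * i + 1 - γ) (fun r => xp r + (γ : ℂ) * s r)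
      = schur (2 * i + 1 - γ) (fun r => yp r + (γ : ℂ) * s r) :=
    schur_congr _ fun r _ hr => by rw [hp r (by omega)]
  have h2 : schur (2 * j + 1 - γ) (fun r => xm r + (γ : ℂ) * s r)
      = schur (2 * j + 1 - γ) (fun r => ym r + (γ : ℂ) * s r) :=
    schur_congr _ fun r _ hr => by rw [hm r (by omega)]
  rw [h1, h2]

theorem redTau_congr {a a' : ℕ → ℂ} (ha : ∀ r, 1 ≤ r → r < N → a (2 * r + 1) = a' (2 * r + 1)) :
    redTau N σ ρ₁ ρ₂ a = redTau N σ ρ₁ ρ₂ a' := by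
  funext n k l x t
  rw [redTau, redTau]
  refine schurDet_congr N _ (fun r hr => redPlus_congr ha n k l x t hr) fun r hr => ?_
  rw [redMinus_eq_conj, redMinus_eq_conj, redPlus_congr ha _ _ _ _ _ hr]

/-- The reduced formulas never read `a 1`, so it may be set to zero. This transfers all results on
the general family to the reduced one. -/
theorem Admissible.redTau_eq_genTau_update (h : Admissible σ ρ₁ ρ₂) (N : ℕ) (a : ℕ → ℂ) :
    redTau N σ ρ₁ ρ₂ a = genTau N σ ρ₁ ρ₂ (Function.update a 1 0) := by
  rw [h.genTau_eq_redTau (Function.update_self ..)]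
  exact redTau_congr fun r h1 _ => (Function.update_of_ne (by omega) _ _).symm

theorem genPlus_translate (b : ℕ → ℂ) (n k l : ℤ) (x t x₀ t₀ : ℝ) (r : ℕ) :
    genPlus σ ρ₁ ρ₂ b n k l x t r = genPlus σ ρ₁ ρ₂
      (fun r => b r + alphaCoeff σ ρ₁ ρ₂ r * x₀ + betaCoeff σ ρ₁ ρ₂ r * t₀) n k l
      (x - x₀) (t - t₀) r := by
  simp only [genPlus]
  push_cast
  ring

theorem genTau_translate (N : ℕ) (b : ℕ → ℂ) (n k l : ℤ) (x t x₀ t₀ : ℝ) :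
    genTau N σ ρ₁ ρ₂ b n k l x t = genTau N σ ρ₁ ρ₂
      (fun r => b r + alphaCoeff σ ρ₁ ρ₂ r * x₀ + betaCoeff σ ρ₁ ρ₂ r * t₀) n k l
      (x - x₀) (t - t₀) := by
  rw [genTau, genTau]
  congr 1
  · funext r
    exact genPlus_translate b n k l x t x₀ t₀ r
  · funext r
    rw [genMinus_eq_conj, genMinus_eq_conj, genPlus_translate b _ _ _ x t x₀ t₀ r]

theorem planeWave_translate (x t x₀ t₀ : ℝ) : planeWave σ ρ₁ ρ₂ x t
    = planeWave σ ρ₁ ρ₂ x₀ t₀ * planeWave σ ρ₁ ρ₂ (x - x₀) (t - t₀) := by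
  simp only [planeWave]
  rw [← Complex.exp_add]
  congr 1
  push_cast
  ring

end Reduction

end MTRogue

/-! ### Assembly of the theorem -/

theorem theorem4 (N : ℕ) (hN : 1 ≤ N) (σ ρ₁ ρ₂ : ℝ) (hρ : MTRogue.Admissible σ ρ₁ ρ₂) :
    -- the shift vector of the general family is `(0, s_2, 0, s_4, …)`
    (∀ r : ℕ, MTRogue.sCoeff (2 * r + 1) = 0) ∧
    -- for arbitrary parameters the reduced formulas give a global rogue wave
    (∀ a : ℕ → ℂ,
      (∀ x t : ℝ, MTRogue.redTau N σ ρ₁ ρ₂ a (-1) 0 0 x t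
        = conj (MTRogue.redTau N σ ρ₁ ρ₂ a 0 0 0 x t)) ∧
      (∀ x t : ℝ, MTRogue.redTau N σ ρ₁ ρ₂ a 0 0 0 x t ≠ 0) ∧
      MTRogue.IsRogueWave σ ρ₁ ρ₂ (MTRogue.redU N σ ρ₁ ρ₂ a) (MTRogue.redV N σ ρ₁ ρ₂ a)) ∧
    -- which depends only on `a_3, a_5, …, a_{2N-1}`
    (∀ a a' : ℕ → ℂ, (∀ r : ℕ, 1 ≤ r → r < N → a (2 * r + 1) = a' (2 * r + 1)) →
      MTRogue.redTau N σ ρ₁ ρ₂ a = MTRogue.redTau N σ ρ₁ ρ₂ a' ∧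
      MTRogue.redU N σ ρ₁ ρ₂ a = MTRogue.redU N σ ρ₁ ρ₂ a' ∧
      MTRogue.redV N σ ρ₁ ρ₂ a = MTRogue.redV N σ ρ₁ ρ₂ a') ∧
    -- if `b_1 = 0`, the odd-indexed variables of the general family are those of the reduced one,
    -- and putting the even-indexed ones equal to zero changes nothing
    (∀ b : ℕ → ℂ, b 1 = 0 →
      (∀ (n k l : ℤ) (x t : ℝ) (r : ℕ), Odd r →
        MTRogue.genPlus σ ρ₁ ρ₂ b n k l x t r = MTRogue.redPlus σ ρ₁ ρ₂ b n k l x t r ∧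
        MTRogue.genMinus σ ρ₁ ρ₂ b n k l x t r = MTRogue.redMinus σ ρ₁ ρ₂ b n k l x t r) ∧
      MTRogue.genTau N σ ρ₁ ρ₂ b = MTRogue.redTau N σ ρ₁ ρ₂ b ∧
      MTRogue.genU N σ ρ₁ ρ₂ b = MTRogue.redU N σ ρ₁ ρ₂ b ∧
      MTRogue.genV N σ ρ₁ ρ₂ b = MTRogue.redV N σ ρ₁ ρ₂ b) ∧
    -- for arbitrary `b`, the parameter `b_1` is removed by a translation of `x` and `t`
    (∀ b : ℕ → ℂ, ∃ (x₀ t₀ : ℝ) (a : ℕ → ℂ), ∀ x t : ℝ,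
      (∀ n k l : ℤ, MTRogue.genTau N σ ρ₁ ρ₂ b n k l x t
        = MTRogue.redTau N σ ρ₁ ρ₂ a n k l (x - x₀) (t - t₀)) ∧
      MTRogue.genU N σ ρ₁ ρ₂ b x t
        = MTRogue.planeWave σ ρ₁ ρ₂ x₀ t₀ * MTRogue.redU N σ ρ₁ ρ₂ a (x - x₀) (t - t₀) ∧
      MTRogue.genV N σ ρ₁ ρ₂ b x t
        = MTRogue.planeWave σ ρ₁ ρ₂ x₀ t₀ * MTRogue.redV N σ ρ₁ ρ₂ a (x - x₀) (t - t₀)) := by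
  refine ⟨MTRogue.sCoeff_odd, fun a => ?_, fun a a' ha => ?_, fun b hb => ?_, fun b => ?_⟩
  · have hτ := hρ.redTau_eq_genTau_update N a
    refine ⟨fun x t => ?_, fun x t => ?_, ?_⟩
    · rw [hτ, MTRogue.conj_genTau_zero]
    · rw [hτ]
      exact hρ.genTau_zero_ne_zero N
    · rw [MTRogue.redU, MTRogue.redV, hτ]
      exact hρ.isRogueWave_gen
  · have hτ := MTRogue.redTau_congr (σ := σ) (ρ₁ := ρ₁) (ρ₂ := ρ₂) ha
    refine ⟨hτ, ?_, ?_⟩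
    · rw [MTRogue.redU, MTRogue.redU, hτ]
    · rw [MTRogue.redV, MTRogue.redV, hτ]
  · have hτ := hρ.genTau_eq_redTau hb N
    refine ⟨fun n k l x t r hr => ⟨hρ.genPlus_eq_redPlus hb n k l x t hr,
      hρ.genMinus_eq_redMinus hb n k l x t hr⟩, hτ, ?_, ?_⟩
    · rw [MTRogue.genU, MTRogue.redU, hτ]
    · rw [MTRogue.genV, MTRogue.redV, hτ]
  -- The translation solves `α_1 x₀ + β_1 t₀ = -b_1`; it is absorbed into the parameters, whose
  -- first entry becomes zero.
  · obtain ⟨⟨x₀, t₀⟩, h0⟩ := hρ.leadingForm_surjective (-b 1)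
    rw [MTRogue.leadingForm_apply] at h0
    set a : ℕ → ℂ := fun r => b r + MTRogue.alphaCoeff σ ρ₁ ρ₂ r * x₀
      + MTRogue.betaCoeff σ ρ₁ ρ₂ r * t₀ with ha
    have ha1 : a 1 = 0 := by
      rw [ha]
      linear_combination h0
    have hτ : ∀ (x t : ℝ) (n k l : ℤ), MTRogue.genTau N σ ρ₁ ρ₂ b n k l x t
        = MTRogue.redTau N σ ρ₁ ρ₂ a n k l (x - x₀) (t - t₀) := fun x t n k l => by
      rw [← hρ.genTau_eq_redTau ha1]
      exact MTRogue.genTau_translate N b n k l x t x₀ t₀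
    refine ⟨x₀, t₀, a, fun x t => ⟨hτ x t, ?_, ?_⟩⟩
    · rw [MTRogue.genU, MTRogue.redU, MTRogue.waveU, MTRogue.waveU, hτ, hτ,
        MTRogue.planeWave_translate x t x₀ t₀]
      ring
    · rw [MTRogue.genV, MTRogue.redV, MTRogue.waveV, MTRogue.waveV, hτ, hτ,
        MTRogue.planeWave_translate x t x₀ t₀]
      ring
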